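/- Let $k\neq 0$ and $\nu>0$, $\lambda$ be real parameters. The Pomeransky–Senkov (PS) metric in coordinates $(t,y,\psi,\varphi,x)\in\mathbb R^5$ is $$ds^2=\frac{2H(x,y)k^2}{(1-\nu)^2(x-y)^2}\Big(\frac{dx^2}{G(x)}-\frac{dy^2}{G(y)}\Big)-2\frac{J(x,y)}{H(y,x)}d\varphi\, d\psi-\frac{H(y,x)}{H(x,y)}(dt+M\,d\psi+P\,d\varphi)^2-\frac{F(x,y)}{H(y,x)}d\psi^2+\frac{F(y,x)}{H(y,x)}d\varphi^2,$$ where $G(x)=(1-x^2)(\nu x^2+\lambda x+1)$, $$H(x,y)=\lambda^2+2\nu(1-x^2)y\lambda+2x(1-\nu^2y^2)\lambda-\nu^2+\nu(1-\lambda^2-\nu^2)x^2y^2+1,$$ $$\begin{aligned}F(x,y)=\tfrac{2k^2}{(x-y)^2(1-\nu)^2}\Big[&(1-y^2)\big(((1-\nu)^2-\lambda^2)(\nu+1)+y\lambda(1+2\nu-3\nu^2-\lambda^2)\big)G(x)\\&+\big(-(1-\nu)\nu(\lambda^2+\nu^2-1)x^4+\lambda(2\nu^3-3\nu^2-\lambda^2+1)x^3\\&\quad+((1-\nu)^2-\lambda^2)(\nu+1)x^2+\lambda(\lambda^2+(1-\nu)^2)x+2\lambda^2\big)G(y)\Big],\end{aligned}$$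 $$J(x,y)=\tfrac{2k^2(1-x^2)(1-y^2)\lambda\sqrt\nu\,\left(\lambda^2+2(x+y)\nu\lambda-\nu^2-xy\nu(1-\lambda^2-\nu^2)+1\right)}{(x-y)(1-\nu)^2},$$ $$M=\tfrac{2k\lambda\sqrt{(\nu+1)^2-\lambda^2}\,(y+1)\left(-\lambda+\nu-2\nu x+\nu x((\lambda+\nu-1)x+2)y-1\right)}{(1-\lambda+\nu)H(y,x)},\qquad P=\tfrac{2k\lambda\sqrt\nu\sqrt{(\nu+1)^2-\lambda^2}\,(x^2-1)y}{H(y,x)}.$$ Let $D$ be the set of points with $G(x),\,G(y),\,x-y,\,H(x,y),\,H(y,x)$ all nonzero. Put $y_h=\frac{-\lambda+\sqrt{\lambda^2-4\nu}}{2\nu}$ and $y_c=\frac{-\lambda-\sqrt{\lambda^2-4\nu}}{2\nu}$. **Non-degenerate case.** Assume $\nu\neq1$, $|\lambda|<1+\nu$ and $\lambda^2>4\nu$. Let $y_\star\in\{y_h,y_c\}$, let $y_\bullet$ be the other root, and take the upper signs for $y_\star=y_h$ and the lower signs for $y_\star=y_c$. Put $$a=\frac{1-\lambda+\nu}{2k\sqrt{(1+\nu)^2-\lambda^2}},\qquad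 b=\frac{\big(\pm(\nu-1)\sqrt{\lambda^2-4\nu}+\lambda(1+\nu)\big)(1+\nu-\lambda)}{4k\lambda\sqrt{\nu((1+\nu)^2-\lambda^2)}},$$ $$s_\star=\frac{2k^2\lambda^2\big(\lambda^2(\nu^2+1)\mp\lambda(\nu^2-1)\sqrt{\lambda^2-4\nu}-2\nu(\nu+1)^2\big)}{(\nu-1)^2(\lambda^2-4\nu)(1+\nu-\lambda)^2},$$ and for $\sigma\neq0$ let $u=t+\sigma\ln|y-y_\star|$, $v=t-\sigma\ln|y-y_\star|$, $\hat\psi=\psi-at$, $\hat\varphi=\varphi-bt$. Then: 1. For every $\sigma\ne0$ and every $x$ with $G(x)\ne0$, $x\neq y_\star$, $H(x,y_\star)\neq0$, the coefficients $g_{uu},g_{vv},g_{uv},g_{u\hat\psi},g_{v\hat\psi},g_{u\hat\varphi},g_{v\hat\varphi}$ tend to $0$ as $y\to y_\star$, and $g_{uu}=O((y-y_\star)^2)$ there if and only if $\sigma^2=s_\star$. Moreover $s_\star>0$. 2. Let $\sigma^2=s_\star$ and $\gamma=1/(2\sigma)$. On the open set $W$ of points $(\hat u,\hat v,\hat\psi,\hat\varphi,x)\in\mathbb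 R^5$ at which $y:=y_\star+\hat u\hat v$ satisfies $y^2\neq1$, $y\neq y_\bullet$, $x\ne y$, $G(x)\neq0$, $H(x,y)\neq0$, there is a real-analytic nondegenerate symmetric tensor field $\hat g$, with coefficients depending only on $(\hat u,\hat v,x)$ and $$\det\hat g=-\frac{64k^8\sigma^2H(x,y)^2}{(1-\nu)^6(x-y)^8},$$ such that for $\epsilon=\pm1$ the map $\hat u=\epsilon e^{\gamma u}$, $\hat v=\epsilon\,\mathrm{sgn}(y-y_\star)e^{-\gamma v}$ (which is $\hat u=e^{\gamma u}$, $\hat v=e^{-\gamma v}$ when $\epsilon=1$ and $y>y_\star$), together with $\hat\psi,\hat\varphi,x$, is an injective analytic map from $D$ into $W$ that pulls $\hat g$ back to the PS metric. 3. If moreover $\nu<1$ and $\lambda>0$, then for some $\delta>0$ the set $W$ contains all points with $|x|<1$ and $|\hat u\hat v|<\delta$; so the PS metric extends analytically across the horizon $\{y=y_\star\}=\{\hat u\hat v=0\}$. **Degenerate case.** Assume $0<\nu<1$ and $\lambda=2\sqrt\nu$. Let $y_0=-1/\sqrt\nu$, $a_\psi=\frac{1-\nu}{2k(1+\sqrt\nu)^2}$,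 $a_\varphi=\frac{1-\nu^2}{4k\sqrt\nu(1+\sqrt\nu)^2}$, and for constants $a_0,a_1,b^\psi,b^\varphi$ define coordinates $(v,z,\Psi,\Phi,x)$ by $$t=v-\frac{a_0}{z-y_0}+a_1\ln|z-y_0|,\quad y=z,\quad \psi-a_\psi t=\Psi+b^\psi\ln|z-y_0|,\quad \varphi-a_\varphi t=\Phi+b^\varphi\ln|z-y_0|.$$ Then: 1. For every $x\in(-1,1)$, as $z\to y_0$: $g_{vv}=O((z-y_0)^2)$ and $g_{v\Psi},g_{v\Phi}=O(z-y_0)$ for all values of the constants, while $g_{zz},g_{z\Psi},g_{z\Phi}$ are all bounded if and only if $$(a_0,b^\psi,b^\varphi,a_1)=\pm\Big(\frac{4k}{(1-\sqrt\nu)^2},\,0,\,-1,\,\frac{4k\sqrt\nu(1+\nu)}{(1-\sqrt\nu)^2(1-\nu)}\Big)$$ for one of the two signs. 2. For each of these two choices, on the open set $W_0$ of points $(v,z,\Psi,\Phi,x)$ with $z^2\neq1$, $x\neq z$, $G(x)\neq0$, $H(x,z)\ne0$ there is a real-analytic nondegenerate symmetric tensor field $\hat g$, with coefficients depending only on $(z,x)$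 and $\det\hat g=-\frac{16k^8H(x,z)^2}{(1-\nu)^6(x-z)^8}$, which the change of coordinates $D\to W_0$ (injective and analytic) pulls back to the PS metric. 3. For some $\delta>0$ the set $W_0$ contains all points with $|x|<1$ and $|z-y_0|<\delta$; so the PS metric extends analytically across the degenerate horizon $y=y_0$. -/

import Mathlib

open scoped Topology Matrix
open Filter Asymptotics

noncomputable section

namespace PomeranskySenkov

/-- Coordinate space `ℝ⁵`. -/
abbrev Coords : Type := Fin 5 → ℝ

/-- The matrix of components of a symmetric two-tensor at a point. -/
abbrev Mat5 : Type := Matrix (Fin 5) (Fin 5) ℝ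

/-! ### Tensors and changes of coordinates -/

/-- The Jacobian matrix `∂Φⁱ/∂pʲ` of a map at a point. -/
def jac (Φ : Coords → Coords) (p : Coords) : Mat5 :=
  LinearMap.toMatrix' (fderiv ℝ Φ p : Coords →ₗ[ℝ] Coords)

/-- The components, at the point with old coordinates `p`, of the tensor `g` with respect to the
new coordinates `Φ`. -/
def newComponents (Φ : Coords → Coords) (g : Coords → Mat5) (p : Coords) : Mat5 :=
  ((jac Φ p)⁻¹)ᵀ * g p * (jac Φ p)⁻¹

/-- `g` is a real-analytic, symmetric, nondegenerate tensor field on the open set `W`. -/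
structure IsAnalyticMetricOn (g : Coords → Mat5) (W : Set Coords) : Prop where
  isOpen : IsOpen W
  analytic : ∀ i j, AnalyticOnNhd ℝ (fun p => g p i j) W
  symm : ∀ p ∈ W, (g p).IsSymm
  nondegenerate : ∀ p ∈ W, (g p).det ≠ 0

/-- `Φ` is an injective analytic map from `D` into `W` that pulls back `g'` to `g`. -/
structure IsIsometricEmbeddingOn (Φ : Coords → Coords) (D : Set Coords) (g : Coords → Mat5)
    (W : Set Coords) (g' : Coords → Mat5) : Prop where
  analytic : AnalyticOnNhd ℝ Φ D
  injOn : Set.InjOn Φ D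
  mapsTo : Set.MapsTo Φ D W
  pullback : ∀ p ∈ D, (jac Φ p)ᵀ * g' (Φ p) * jac Φ p = g p

/-! ### The Pomeransky–Senkov metric, with parameters `k`, `ν` and `lam = λ` -/

def H (ν lam x y : ℝ) : ℝ :=
  lam ^ 2 + 2 * ν * (1 - x ^ 2) * y * lam + 2 * x * (1 - ν ^ 2 * y ^ 2) * lam - ν ^ 2
    + ν * (-lam ^ 2 - ν ^ 2 + 1) * x ^ 2 * y ^ 2 + 1

def G (ν lam x : ℝ) : ℝ := (1 - x ^ 2) * (ν * x ^ 2 + lam * x + 1)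

def F (k ν lam x y : ℝ) : ℝ :=
  2 * k ^ 2 / ((x - y) ^ 2 * (1 - ν) ^ 2) *
    ((1 - y ^ 2) * (((1 - ν) ^ 2 - lam ^ 2) * (ν + 1)
        + y * lam * (-lam ^ 2 - 3 * ν ^ 2 + 2 * ν + 1)) * G ν lam x
      + (-(1 - ν) * ν * (lam ^ 2 + ν ^ 2 - 1) * x ^ 4
        + lam * (2 * ν ^ 3 - 3 * ν ^ 2 - lam ^ 2 + 1) * x ^ 3
        + ((1 - ν) ^ 2 - lam ^ 2) * (ν + 1) * x ^ 2
        + lam * (lam ^ 2 + (1 - ν) ^ 2) * x + 2 * lam ^ 2) * G ν lam y)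

def J (k ν lam x y : ℝ) : ℝ :=
  2 * k ^ 2 * (1 - x ^ 2) * (1 - y ^ 2) * lam * √ν *
      (lam ^ 2 + 2 * (x + y) * ν * lam - ν ^ 2 - x * y * ν * (-lam ^ 2 - ν ^ 2 + 1) + 1)
    / ((x - y) * (1 - ν) ^ 2)

/-- The `dψ`-component of the one-form `Ω`. -/
def M (k ν lam x y : ℝ) : ℝ :=
  2 * k * lam * √((ν + 1) ^ 2 - lam ^ 2) * (y + 1) *
      (-lam + ν - 2 * ν * x + ν * x * ((lam + ν - 1) * x + 2) * y - 1)
    / ((1 - lam + ν) * H ν lam y x)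

/-- The `dφ`-component of the one-form `Ω`. -/
def P (k ν lam x y : ℝ) : ℝ :=
  2 * k * lam * √ν * √((ν + 1) ^ 2 - lam ^ 2) * (x ^ 2 - 1) * y / H ν lam y x

/-- The Pomeransky–Senkov metric in the coordinates `(t, y, ψ, φ, x)`. -/
def metric (k ν lam : ℝ) (p : Coords) : Mat5 :=
  let y := p 1
  let x := p 4
  let c := 2 * H ν lam x y * k ^ 2 / ((1 - ν) ^ 2 * (x - y) ^ 2)
  -- the one-form `dt + Ω`
  let ω : Fin 5 → ℝ := ![1, 0, M k ν lam x y, P k ν lam x y, 0]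
  !![0, 0, 0, 0, 0;
     0, -(c / G ν lam y), 0, 0, 0;
     0, 0, -(F k ν lam x y / H ν lam y x), -(J k ν lam x y / H ν lam y x), 0;
     0, 0, -(J k ν lam x y / H ν lam y x), F k ν lam y x / H ν lam y x, 0;
     0, 0, 0, 0, c / G ν lam x]
    - (H ν lam y x / H ν lam x y) • Matrix.vecMulVec ω ω

/-- The set of points `(t, y, ψ, φ, x)` at which no denominator in the line element vanishes. -/
def domain (ν lam : ℝ) : Set Coords :=
  {p | G ν lam (p 4) ≠ 0 ∧ G ν lam (p 1) ≠ 0 ∧ p 4 ≠ p 1 ∧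
    H ν lam (p 4) (p 1) ≠ 0 ∧ H ν lam (p 1) (p 4) ≠ 0}

/-! ### Non-degenerate horizons -/

/-- The two Killing horizons `y = y_h` and `y = y_c`. -/
inductive Horizon
  | h
  | c

def yh (ν lam : ℝ) : ℝ := -(lam - √(lam ^ 2 - 4 * ν)) / (2 * ν)

def yc (ν lam : ℝ) : ℝ := -(lam + √(lam ^ 2 - 4 * ν)) / (2 * ν)

namespace Horizon

/-- The value of `y` on the horizon. -/
def root (ν lam : ℝ) : Horizon → ℝ
  | h => yh ν lam
  | c => yc ν lam

/-- The value of `y` on the other horizon. -/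
def otherRoot (ν lam : ℝ) : Horizon → ℝ
  | h => yc ν lam
  | c => yh ν lam

/-- The constant `b`. -/
def b (k ν lam : ℝ) : Horizon → ℝ
  | h => ((ν - 1) * √(lam ^ 2 - 4 * ν) + lam * (1 + ν)) * (1 + ν - lam)
      / (4 * k * lam * √(ν * ((1 + ν) ^ 2 - lam ^ 2)))
  | c => ((-ν + 1) * √(lam ^ 2 - 4 * ν) + lam * (1 + ν)) * (1 + ν - lam)
      / (4 * k * lam * √(ν * ((1 + ν) ^ 2 - lam ^ 2)))

/-- The value of `σ²`. -/
def sigmaSq (k ν lam : ℝ) : Horizon → ℝ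
  | h => 2 * k ^ 2 * lam ^ 2 *
        (lam ^ 2 * (ν ^ 2 + 1) - lam * (ν ^ 2 - 1) * √(lam ^ 2 - 4 * ν) - 2 * ν * (ν + 1) ^ 2)
      / ((ν - 1) ^ 2 * (lam ^ 2 - 4 * ν) * (-lam + ν + 1) ^ 2)
  | c => 2 * k ^ 2 * lam ^ 2 *
        (lam ^ 2 * (ν ^ 2 + 1) + lam * (ν ^ 2 - 1) * √(lam ^ 2 - 4 * ν) - 2 * ν * (ν + 1) ^ 2)
      / ((ν - 1) ^ 2 * (lam ^ 2 - 4 * ν) * (-lam + ν + 1) ^ 2)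

end Horizon

/-- The constant `a`, which is the same at both horizons. -/
def aConst (k ν lam : ℝ) : ℝ := (1 - lam + ν) / (2 * k * √((1 + ν) ^ 2 - lam ^ 2))

/-- The coordinates `(u, v, ψ̂, φ̂, x)` as functions of `(t, y, ψ, φ, x)`:
`u = t + σ log |y - y⋆|`, `v = t - σ log |y - y⋆|`, `ψ̂ = ψ - a t`, `φ̂ = φ - b t`
(recall that `Real.log r = log |r|`). -/
def uvChart (σ a b ystar : ℝ) (p : Coords) : Coords :=
  ![p 0 + σ * Real.log (p 1 - ystar), p 0 - σ * Real.log (p 1 - ystar),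
    p 2 - a * p 0, p 3 - b * p 0, p 4]

/-- The exponential coordinates `(û, v̂, ψ̂, φ̂, x)` as functions of `(t, y, ψ, φ, x)`. For `ε = 1`
and `y > y⋆` these are `û = e^{γ u}`, `v̂ = e^{-γ v}` with `γ = 1 / (2 σ)`. The signs are such that
`û v̂ = y - y⋆` on both sides of the horizon; the choices `ε = ±1` and `y > y⋆`, `y < y⋆` correspond
to the four quadrants of the `(û, v̂)`-plane. -/
def ksChart (ε σ a b ystar : ℝ) (p : Coords) : Coords :=
  let γ := 1 / (2 * σ)
  let q := uvChart σ a b ystar p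
  ![ε * Real.exp (γ * q 0), ε * Real.sign (p 1 - ystar) * Real.exp (-γ * q 1), q 2, q 3, q 4]

/-- The function `y = y⋆ + û v̂` in the coordinates `(û, v̂, ψ̂, φ̂, x)`. -/
def ksY (ystar : ℝ) (p : Coords) : ℝ := ystar + p 0 * p 1

/-- The domain of the extended metric in the coordinates `(û, v̂, ψ̂, φ̂, x)`; `y = y⋆`, that is
`û v̂ = 0`, is allowed, and so is `H(y,x) = 0`. -/
def ksDomain (ν lam : ℝ) (hor : Horizon) : Set Coords :=
  {p | G ν lam (p 4) ≠ 0 ∧ p 4 ≠ ksY (hor.root ν lam) p ∧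
    ksY (hor.root ν lam) p ^ 2 ≠ 1 ∧ ksY (hor.root ν lam) p ≠ hor.otherRoot ν lam ∧
    H ν lam (p 4) (ksY (hor.root ν lam) p) ≠ 0}

/-! ### The degenerate horizon, `λ = 2 √ν` -/

def y0 (ν : ℝ) : ℝ := -1 / √ν

def aPsi (k ν : ℝ) : ℝ := (1 - ν) / (2 * k * (1 + √ν) ^ 2)

def aPhi (k ν : ℝ) : ℝ := (1 - ν ^ 2) / (4 * k * √ν * (1 + √ν) ^ 2)

/-- The coordinates `(v, z, Ψ, Φ, x)` as functions of `(t, y, ψ, φ, x)`, with `z = y`,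
`t = v - a₀ / (z - y₀) + a₁ log |z - y₀|`, `ψ - a_ψ t = Ψ + b^ψ log |z - y₀|` and
`φ - a_φ t = Φ + b^φ log |z - y₀|`. -/
def degChart (k ν a₀ a₁ bψ bφ : ℝ) (p : Coords) : Coords :=
  ![p 0 + a₀ / (p 1 - y0 ν) - a₁ * Real.log (p 1 - y0 ν), p 1,
    p 2 - aPsi k ν * p 0 - bψ * Real.log (p 1 - y0 ν),
    p 3 - aPhi k ν * p 0 - bφ * Real.log (p 1 - y0 ν), p 4]

/-- The two admissible choices of `(a₀, a₁, b^ψ, b^φ)`, labelled by `s = 1` and `s = -1`. -/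
def IsDegConstants (k ν s a₀ a₁ bψ bφ : ℝ) : Prop :=
  a₀ = s * (4 * k / (1 - √ν) ^ 2) ∧
  a₁ = s * (4 * k * √ν * (1 + ν) / ((1 - √ν) ^ 2 * (1 - ν))) ∧
  bψ = 0 ∧ bφ = -s

/-- The domain of the extended metric in the coordinates `(v, z, Ψ, Φ, x)`; `z = y₀` is allowed,
and so is `H(z,x) = 0`. -/
def degDomain (ν : ℝ) : Set Coords :=
  {p | G ν (2 * √ν) (p 4) ≠ 0 ∧ p 4 ≠ p 1 ∧ p 1 ^ 2 ≠ 1 ∧ H ν (2 * √ν) (p 4) (p 1) ≠ 0}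

end PomeranskySenkov

end

open scoped Topology Matrix
open Filter Asymptotics

noncomputable section

namespace PomeranskySenkov


/-! ### Polynomial identities -/

/-! Let r be a root of νy² + λy + 1, s the other root, w = y - r and K = ∂t + a ∂ψ + b ∂φ, which
becomes the time derivative once ψ - at and φ - bt are used as coordinates. The heart of the proof
is that in the frame (K, ∂y, ∂ψ, ∂φ, ∂x) the singularity is completely explicit: g(K,K) = wA,
g(K,∂ψ) = wC₁, g(K,∂φ) = wC₂ and g_yy = B/w, where A, B, C₁, C₂ and the remaining components are
rational in (x, y) and regular at the points of the extended domain (`IsHorizonData.metric_eq`). Two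
cancellations lie behind this. The poles at H(y,x) = 0 cancel between the F, J terms and the square
of dt + Ω (`psiPsiNum_mul_H`, `psiPhiNum_mul_H`, `phiPhiNum_mul_H`). Modulo νy² + λy + 1 the
products of K with ∂t, ∂ψ, ∂φ vanish, for exactly the stated a and b.

Nondegenerate case. In the coordinates (u, v) one finds g_uu = w(σ²A + B)/(4σ²), so second-order
vanishing means σ²A + B = 0 at y = r. By `IsHorizonData.kkNum_root` the ratio of A to B at y = r
does not depend on x (constancy of the surface gravity), so a single σ² serves all x, and then σ²A +
B = wE with E analytic (`IsHorizonData.exists_radial_quotient`). Inserting dt = σ(dû/û - dv̂/v̂) and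
w = ûv̂ gives v̂²E dû² + 2(B - σ²A) dû dv̂ + û²E dv̂², with cross terms linear in û and v̂; every
coefficient is analytic across ûv̂ = 0.

Nondegeneracy. The product identity `fNum_mul_fNum` evaluates the determinant of the (t, ψ, φ) block
as a multiple of G(x)G(y) (`det_block`). Dividing by w gives `IsHorizonData.det_frame`, which
remains valid and nonzero at the horizon.

Degenerate case. For r = s the surface gravity is zero, A acquires a further factor w, and g_yy is a
regular function over w². In the new coordinates g_zz has denominator w² and g_zΨ, g_zΦ have
denominator w; boundedness is a vanishing condition on the numerators, solved in
`radial_isBigO_one_iff`.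

Neighbourhood of the horizon. H(x, r) is a nonzero multiple of a quadratic in x that is positive for
x ≥ -1 (`horizon_quadratic_pos`); compactness of [-1, 1] makes the neighbourhood uniform in x. -/

/-- The nontrivial factor of `J`. -/
def jNum (ν lam x y : ℝ) : ℝ :=
  lam ^ 2 + 2 * (x + y) * ν * lam - ν ^ 2 - x * y * ν * (-lam ^ 2 - ν ^ 2 + 1) + 1

/-- The nontrivial factor of `M`. -/
def mNum (ν lam x y : ℝ) : ℝ :=
  -lam + ν - 2 * ν * x + ν * x * ((lam + ν - 1) * x + 2) * y - 1

/-- The polynomial factor of `F`. -/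
def fNum (ν lam x y : ℝ) : ℝ :=
  (1 - y ^ 2) * (((1 - ν) ^ 2 - lam ^ 2) * (ν + 1)
      + y * lam * (-lam ^ 2 - 3 * ν ^ 2 + 2 * ν + 1)) * G ν lam x
    + (-(1 - ν) * ν * (lam ^ 2 + ν ^ 2 - 1) * x ^ 4
      + lam * (2 * ν ^ 3 - 3 * ν ^ 2 - lam ^ 2 + 1) * x ^ 3
      + ((1 - ν) ^ 2 - lam ^ 2) * (ν + 1) * x ^ 2
      + lam * (lam ^ 2 + (1 - ν) ^ 2) * x + 2 * lam ^ 2) * G ν lam y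

/-- The antisymmetric part of `F`, as a polynomial in `s = x + y` and `t = x y`. -/
def fAnti (ν lam s t : ℝ) : ℝ :=
  (-3 * ν ^ 3 * lam + 2 * ν ^ 2 * lam - ν * lam ^ 3 + ν * lam) * t + (ν ^ 4 - ν ^ 3
    - ν ^ 2 * lam ^ 2 - ν ^ 2 - ν * lam ^ 2 + ν) * s + ν ^ 3 * lam + 2 * ν ^ 2 * lam - ν * lam ^ 3
    - 3 * ν * lam

/-- The reduced numerator of `g_ψφ`. -/
def qNum (ν lam x y : ℝ) : ℝ :=
    ((-ν ^ 3 - ν * lam ^ 2 + ν) * x - 2 * ν ^ 2 * lam) * y ^ 2 + ((ν ^ 3 + 2 * ν ^ 2 * lam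
    + ν * lam ^ 2 - 4 * ν * lam - ν) * x + ν ^ 2 + 4 * ν * lam - lam ^ 2 - 2 * lam - 1) * y
    + 2 * lam * x - ν ^ 2 + lam ^ 2 + 1

/-- The reduced numerator of `g(K, ∂ψ)`, modulo `g_ψφ`. -/
def zNum (ν lam x y : ℝ) : ℝ :=
    ((-ν ^ 3 - ν * lam ^ 2 + ν) * x ^ 3 - 2 * ν ^ 2 * lam * x ^ 2 + (ν ^ 3 + ν * lam ^ 2 - ν) * x
    + 2 * ν ^ 2 * lam) * y ^ 2 + ((ν ^ 3 + ν * lam ^ 2 - 2 * ν * lam - ν) * x ^ 3 + (-ν ^ 3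
    + 2 * ν ^ 2 * lam - ν * lam ^ 2 + ν) * x ^ 2 + (-ν ^ 3 - 4 * ν ^ 2 * lam - ν * lam ^ 2
    + 6 * ν * lam + ν) * x - ν ^ 2 - 4 * ν * lam + lam ^ 2 + 2 * lam + 1) * y
    + 2 * ν * lam * x ^ 3 + (ν ^ 3 + 2 * ν ^ 2 * lam + ν * lam ^ 2 - 4 * ν * lam - ν
    + 2 * lam) * x ^ 2 + (2 * ν * lam - 4 * lam) * x + ν ^ 2 - lam ^ 2 - 1

/-- The reduced numerator of `g_φφ`. -/
def pNum (ν lam x y : ℝ) : ℝ :=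
    ((ν ^ 5 - ν ^ 4 + ν ^ 3 * lam ^ 2 - ν ^ 3 - ν ^ 2 * lam ^ 2 + ν ^ 2) * x ^ 2
    + (3 * ν ^ 4 * lam - 2 * ν ^ 3 * lam + ν ^ 2 * lam ^ 3 - ν ^ 2 * lam) * x
    + 2 * ν ^ 3 * lam ^ 2) * y ^ 4 + ((ν ^ 3 * lam - 2 * ν ^ 2 * lam - ν * lam ^ 3
    + ν * lam) * x ^ 2 - ν ^ 3 * lam + 2 * ν ^ 2 * lam + ν * lam ^ 3 - ν * lam) * y ^ 3 + ((ν ^ 4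
    - ν ^ 3 + ν ^ 2 * lam ^ 2 - ν ^ 2 - 3 * ν * lam ^ 2 + ν) * x ^ 2 + (2 * ν ^ 3 * lam
    - 4 * ν ^ 2 * lam - 2 * ν * lam ^ 3 + 2 * ν * lam) * x + ν ^ 4 - ν ^ 3 - 3 * ν ^ 2 * lam ^ 2
    - ν ^ 2 + ν * lam ^ 2 + ν) * y ^ 2 + ((-ν ^ 3 * lam + 2 * ν ^ 2 * lam + ν * lam ^ 3
    - ν * lam) * x ^ 2 + ν ^ 3 * lam - 2 * ν ^ 2 * lam - ν * lam ^ 3 + ν * lam) * y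
    + 2 * lam ^ 2 * x ^ 2 + (-ν ^ 2 * lam - 2 * ν * lam + lam ^ 3 + 3 * lam) * x + ν ^ 3 - ν ^ 2
    - ν * lam ^ 2 - ν + lam ^ 2 + 1

/-- The reduced numerator of `g(K, ∂φ)`, modulo `g_φφ`. -/
def wNum (ν lam x y : ℝ) : ℝ :=
    ((-ν ^ 4 + ν ^ 3 - ν ^ 2 * lam ^ 2 + ν ^ 2 + ν * lam ^ 2 - ν) * x ^ 2 + (-3 * ν ^ 3 * lam
    + 2 * ν ^ 2 * lam - ν * lam ^ 3 + ν * lam) * x - 2 * ν ^ 2 * lam ^ 2) * y ^ 3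
    + ((-2 * ν ^ 2 * lam + 2 * ν * lam) * x ^ 2 - 2 * ν * lam ^ 2 * x + ν ^ 2 * lam - 2 * ν * lam
    - lam ^ 3 + lam) * y ^ 2 + ((ν ^ 2 * lam + 2 * ν * lam + lam ^ 3 - 3 * lam) * x - ν ^ 3
    + ν ^ 2 + 3 * ν * lam ^ 2 + ν - lam ^ 2 - 1) * y + 2 * lam ^ 2 * x - ν ^ 2 * lam + lam ^ 3
    + lam

/-- The factor `fAnti` depends only on x + y and x y, so F(x,y) and F(y,x) share it up to the sign
of x - y. This is what makes their product computable. -/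
theorem fNum_eq (ν lam x y : ℝ) :
    fNum ν lam x y = (1 - y ^ 2) * ((1 - x ^ 2) * (x - y) * fAnti ν lam (x + y) (x * y)
      + (1 - ν) * H ν lam x x * (ν * y ^ 2 + lam * y + 1)) := by
  unfold fNum fAnti H G
  ring

/-- `(G(x) H(y,y) - G(y) H(x,x)) / (x - y)` in terms of `s = x + y` and `t = x y`. -/
def ghAnti (ν lam s t : ℝ) : ℝ :=
  (ν ^ 3 * lam + 2 * ν ^ 2 * lam - ν * lam ^ 3 + ν * lam) * t ^ 3 + ((ν ^ 4 - ν ^ 3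
    + ν ^ 2 * lam ^ 2 - ν ^ 2 - ν * lam ^ 2 + ν) * s + ν ^ 3 * lam + 2 * ν ^ 2 * lam - ν * lam ^ 3
    + ν * lam) * t ^ 2 + ((ν ^ 3 * lam - 2 * ν ^ 2 * lam + ν * lam ^ 3 - 3 * ν * lam) * s ^ 2
    + (-4 * ν ^ 3 + 2 * ν ^ 2 * lam ^ 2 + 4 * ν - 2 * lam ^ 2) * s - ν ^ 2 * lam - 2 * ν * lam
    + lam ^ 3 - lam) * t + (2 * ν ^ 3 - 2 * ν) * s ^ 3 + (3 * ν ^ 2 * lam + 2 * ν * lam - lam ^ 3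
    - lam) * s ^ 2 + (-ν ^ 3 + ν ^ 2 + ν * lam ^ 2 + ν - lam ^ 2 - 1) * s - ν ^ 2 * lam
    - 2 * ν * lam + lam ^ 3 - lam

/-- `(H(x,x) H(y,y) - H(x,y) H(y,x)) / (x - y)²` in terms of `s = x + y` and `t = x y`. -/
def hhAnti (ν lam s t : ℝ) : ℝ :=
  -4 * ν ^ 3 * lam ^ 2 * t ^ 2 + ((-2 * ν ^ 4 * lam - 2 * ν ^ 3 * lam - 2 * ν ^ 2 * lam ^ 3
    + 2 * ν ^ 2 * lam - 2 * ν * lam ^ 3 + 2 * ν * lam) * s - 4 * ν ^ 3 * lam ^ 2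
    - 4 * ν * lam ^ 2) * t + (ν ^ 5 - 2 * ν ^ 3 - ν * lam ^ 4 + ν) * s ^ 2 + (2 * ν ^ 4 * lam
    + 2 * ν ^ 3 * lam - 2 * ν ^ 2 * lam ^ 3 - 2 * ν ^ 2 * lam - 2 * ν * lam ^ 3 - 2 * ν * lam) * s
    - 4 * ν * lam ^ 2

theorem ghAnti_eq (ν lam x y : ℝ) :
    G ν lam x * H ν lam y y - G ν lam y * H ν lam x x
      = (x - y) * ghAnti ν lam (x + y) (x * y) := by
  unfold ghAnti H G
  ring

theorem hhAnti_eq (ν lam x y : ℝ) :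
    H ν lam x x * H ν lam y y - H ν lam x y * H ν lam y x
      = (x - y) ^ 2 * hhAnti ν lam (x + y) (x * y) := by
  unfold hhAnti H
  ring

/-- This is the residue of `fNum_mul_fNum` once common factors are removed. Passing to s = x + y and
t = x y lowers the degree: (1 + t)² - s² is (1 - x²)(1 - y²), and the long bracket is the product of
the values of νz² + λz + 1 at z = x and z = y. -/
theorem symmetric_identity (ν lam s t : ℝ) :
    ((1 + t) ^ 2 - s ^ 2) * (ν * lam ^ 2 *
        (lam ^ 2 + 2 * s * ν * lam - ν ^ 2 - t * ν * (-lam ^ 2 - ν ^ 2 + 1) + 1) ^ 2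
          - fAnti ν lam s t ^ 2)
      + (1 - ν) * fAnti ν lam s t * ghAnti ν lam s t
      + (1 - ν) ^ 2 * (ν ^ 2 * t ^ 2 + (ν * lam * s - 2 * ν + lam ^ 2) * t + ν * s ^ 2 + lam * s + 1)
        * hhAnti ν lam s t = 0 := by
  unfold fAnti ghAnti hhAnti
  ring

/-- Up to normalisation the left side is F(x,y)F(y,x) + J(x,y)², minus the determinant of the (ψ, φ)
block without its Ω part. -/
theorem fNum_mul_fNum (ν lam x y : ℝ) :
    fNum ν lam x y * fNum ν lam y x
        + ν * (lam * ((1 - x ^ 2) * (1 - y ^ 2) * (x - y)) * jNum ν lam x y) ^ 2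
      = (1 - ν) ^ 2 * G ν lam x * G ν lam y * H ν lam x y * H ν lam y x := by
  have h1 := ghAnti_eq ν lam x y
  have h2 := hhAnti_eq ν lam x y
  have h3 := symmetric_identity ν lam (x + y) (x * y)
  rw [fNum_eq ν lam x y, fNum_eq ν lam y x, add_comm y x, mul_comm y x]
  unfold G at h1 ⊢
  unfold jNum
  generalize fAnti ν lam (x + y) (x * y) = N at *
  -- The values of H and the symmetric factors become unknowns, related only by `h1`, `h2`, `h3`;
  -- this keeps the final polynomial identity small.
  generalize ghAnti ν lam (x + y) (x * y) = U at *
  generalize hhAnti ν lam (x + y) (x * y) = V at *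
  generalize H ν lam x y = A at *
  generalize H ν lam y x = B at *
  generalize H ν lam x x = C at *
  generalize H ν lam y y = E at *
  linear_combination (1 - x ^ 2) * (1 - y ^ 2) * ((x - y) ^ 2 * h3 + (1 - ν) * (x - y) * N * h1
    + (1 - ν) ^ 2 * (ν * x ^ 2 + lam * x + 1) * (ν * y ^ 2 + lam * y + 1) * h2)

/-! ### Cancellation of H(y,x) and reduction modulo νy² + λy + 1 -/

theorem qNum_mul_H (ν lam x y : ℝ) :
    qNum ν lam x y * H ν lam y x = (1 - y) * jNum ν lam x y * H ν lam x y
      - 2 * lam * (1 + ν + lam) * (1 - ν) ^ 2 * (x - y) * mNum ν lam x y * y := by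
  unfold qNum jNum mNum H
  ring

/-- Modulo the horizon polynomial the symmetric part of F is a multiple of the factor of J. Hence
g_ψψ can be written as a multiple of `qNum` plus terms controlled at the horizon, as in the
definition of `psiPsiNum`. -/
theorem fAnti_eq (ν lam x y : ℝ) :
    fAnti ν lam (x + y) (x * y) = ν * ((1 - ν) * y - lam) * jNum ν lam x y
      + ν * (1 - ν) * (ν * y ^ 2 + lam * y + 1) * ((1 - ν ^ 2 - lam ^ 2) * x - 2 * lam) := by
  unfold fAnti jNum
  ring

theorem zNum_mul_H (ν lam x y : ℝ) :
    zNum ν lam x y * H ν lam y x = -((1 - y) * H ν lam x y *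
        (ν * (x - y) * (1 - x ^ 2) * ((1 - ν ^ 2 - lam ^ 2) * x - 2 * lam) + H ν lam x x))
      - 2 * (1 + ν + lam) * ((1 - ν) ^ 2 * (x - y) ^ 2) * lam * mNum ν lam x y := by
  unfold zNum mNum H
  ring

/-- The left side is the numerator of -(g_tt + a g_tψ). Modulo the horizon polynomial it is
proportional to (x² - 1)y, the factor occurring in g_tφ; adding b g_tφ can therefore cancel it at a
root, for all x at once. -/
theorem H_add_mNum (ν lam x y : ℝ) :
    H ν lam y x + lam * ((y + 1) * mNum ν lam x y)
      = ν * (1 - lam + ν) * ((x ^ 2 - 1) * y) * ((1 - ν) * y - lam)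
        + (1 - ν) * (1 - lam + ν) * (ν * y ^ 2 + lam * y + 1) := by
  unfold mNum H
  ring

theorem pNum_mul_H (ν lam x y : ℝ) :
    pNum ν lam x y * H ν lam y x = (-((1 - y ^ 2) * (x - y) * fAnti ν lam (x + y) (x * y))
        + (1 - ν) * H ν lam y y * (ν * x ^ 2 + lam * x + 1)) * H ν lam x y
      - 2 * lam ^ 2 * ν * (1 - lam + ν) * (1 + ν + lam) * ((1 - ν) ^ 2 * (x - y) ^ 2)
        * (1 - x ^ 2) * y ^ 2 := by
  unfold pNum fAnti H
  ring

/-- The left side is, up to the factor 1 - x², the numerator of g(K, ∂φ) with y in place of r inside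
the constant b; replacing y by r there costs only a multiple of y - r. -/
theorem wNum_eq (ν lam x y : ℝ) :
    2 * (1 + ν + lam) * ((1 - ν) ^ 2 * (x - y) ^ 2) * lam ^ 2 * y
      - lam ^ 2 * (x - y) * (1 + y) * qNum ν lam x y - ((1 - ν) * y - lam) * pNum ν lam x y
      = (1 - ν) * (ν * y ^ 2 + lam * y + 1) * wNum ν lam x y := by
  unfold qNum pNum wNum
  ring

/-- The numerator of `g_ψψ`, after cancellation of `H(y,x)`. -/
def psiPsiNum (ν lam x y : ℝ) : ℝ :=
  (1 + y) * (-(2 * (1 + ν + lam) * ((1 - ν) ^ 2 * (x - y) ^ 2) * lam * mNum ν lam x y)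
    + ν * (1 - lam + ν) * ((x - y) * (1 - x ^ 2)) * ((1 - ν) * y - lam) * qNum ν lam x y
    - (1 - ν) * (1 - lam + ν) * (ν * y ^ 2 + lam * y + 1) * zNum ν lam x y)

/-- The numerator of `g_ψφ`, after cancellation of `H(y,x)`. -/
def psiPhiNum (ν lam x y : ℝ) : ℝ :=
  lam * ((x - y) * (1 - x ^ 2) * (1 + y)) * qNum ν lam x y

/-- The numerator of `g_φφ`, after cancellation of `H(y,x)`. -/
def phiPhiNum (ν lam x y : ℝ) : ℝ := (1 - x ^ 2) * pNum ν lam x y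

/-- Both -F/H(y,x) and the contribution of M² to g_ψψ have a pole at H(y,x) = 0. Over a common
denominator their numerator is the right side, so divisibility by H(y,x) says that the pole cancels.
-/
theorem psiPsiNum_mul_H (ν lam x y : ℝ) :
    psiPsiNum ν lam x y * H ν lam y x = (1 - lam + ν) * fNum ν lam x y * H ν lam x y
      + 2 * lam ^ 2 * (1 + ν + lam) * ((1 - ν) ^ 2 * (x - y) ^ 2)
        * ((y + 1) * mNum ν lam x y) ^ 2 := by
  have h1 := qNum_mul_H ν lam x y
  have h2 := fAnti_eq ν lam x y
  have h3 := zNum_mul_H ν lam x y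
  have h4 := H_add_mNum ν lam x y
  rw [fNum_eq ν lam x y]
  unfold psiPsiNum
  generalize fAnti ν lam (x + y) (x * y) = N at *
  generalize H ν lam x y = A at *
  generalize H ν lam y x = B at *
  generalize H ν lam x x = C at *
  generalize qNum ν lam x y = q at *
  generalize zNum ν lam x y = z at *
  generalize jNum ν lam x y = j at *
  generalize mNum ν lam x y = m at *
  linear_combination (1 + y) * (-(2 * (1 + ν + lam) * ((1 - ν) ^ 2 * (x - y) ^ 2) * lam * m) * h4
    + ν * (1 - lam + ν) * ((x - y) * (1 - x ^ 2)) * ((1 - ν) * y - lam) * h1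
    - (1 - lam + ν) * (1 - y) * (1 - x ^ 2) * (x - y) * A * h2
    - (1 - ν) * (1 - lam + ν) * (ν * y ^ 2 + lam * y + 1) * h3)

theorem psiPhiNum_mul_H (ν lam x y : ℝ) :
    psiPhiNum ν lam x y * H ν lam y x
      = lam * ((1 - x ^ 2) * (1 - y ^ 2) * (x - y)) * jNum ν lam x y * H ν lam x y
      + 2 * lam ^ 2 * (1 + ν + lam) * ((1 - ν) ^ 2 * (x - y) ^ 2) * ((y + 1) * mNum ν lam x y)
        * ((x ^ 2 - 1) * y) := by
  unfold psiPhiNum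
  linear_combination lam * ((x - y) * (1 - x ^ 2) * (1 + y)) * qNum_mul_H ν lam x y

theorem phiPhiNum_mul_H (ν lam x y : ℝ) :
    phiPhiNum ν lam x y * H ν lam y x = fNum ν lam y x * H ν lam x y
      - 2 * lam ^ 2 * ν * (1 - lam + ν) * (1 + ν + lam) * ((1 - ν) ^ 2 * (x - y) ^ 2)
        * ((x ^ 2 - 1) * y) ^ 2 := by
  rw [fNum_eq ν lam y x, add_comm y x, mul_comm y x]
  unfold phiPhiNum
  linear_combination (1 - x ^ 2) * pNum_mul_H ν lam x y

/-! ### The metric in a frame adapted to a Killing horizon -/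

/-- A metric of the block form shared by all adapted coordinate systems. -/
def blockMat (tt tψ tφ ψψ ψφ φφ yy xx : ℝ) : Mat5 :=
  !![tt, 0, tψ, tφ, 0;
     0, yy, 0, 0, 0;
     tψ, 0, ψψ, ψφ, 0;
     tφ, 0, ψφ, φφ, 0;
     0, 0, 0, 0, xx]

/-- The conformal factor of the `(x, y)` part of the metric. -/
def conf (k ν lam x y : ℝ) : ℝ := 2 * H ν lam x y * k ^ 2 / ((1 - ν) ^ 2 * (x - y) ^ 2)

/-- The common denominator of the metric coefficients. -/
def den (ν lam x y : ℝ) : ℝ := H ν lam x y * ((1 - ν) ^ 2 * (x - y) ^ 2)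

/-- In this and the next five definitions n and m stand for √ν and √((1 + ν)² - λ²). None of the
denominators contains H(y,x). -/
def gTT (ν lam x y : ℝ) : ℝ := -(H ν lam y x / H ν lam x y)

def gTPsi (k ν lam m x y : ℝ) : ℝ :=
  -(2 * k * lam * m * ((y + 1) * mNum ν lam x y) / ((1 - lam + ν) * H ν lam x y))

def gTPhi (k ν lam n m x y : ℝ) : ℝ :=
  -(2 * k * lam * n * m * ((x ^ 2 - 1) * y) / H ν lam x y)

def gPsiPsi (k ν lam x y : ℝ) : ℝ :=
  -(2 * k ^ 2 * psiPsiNum ν lam x y / ((1 - lam + ν) * den ν lam x y))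

def gPsiPhi (k ν lam n x y : ℝ) : ℝ :=
  -(2 * k ^ 2 * n * psiPhiNum ν lam x y / den ν lam x y)

def gPhiPhi (k ν lam x y : ℝ) : ℝ := 2 * k ^ 2 * phiPhiNum ν lam x y / den ν lam x y

theorem metric_eq_blockMat {k ν lam n m : ℝ} (hν : ν ≠ 1) (he : 1 - lam + ν ≠ 0)
    (hn : √ν = n) (hn2 : n ^ 2 = ν) (hm : √((1 + ν) ^ 2 - lam ^ 2) = m)
    (hm2 : m ^ 2 = (1 - lam + ν) * (1 + ν + lam)) {p : Coords} (hxy : p 4 ≠ p 1)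
    (hH : H ν lam (p 4) (p 1) ≠ 0) (hH' : H ν lam (p 1) (p 4) ≠ 0) :
    metric k ν lam p = blockMat (gTT ν lam (p 4) (p 1)) (gTPsi k ν lam m (p 4) (p 1))
      (gTPhi k ν lam n m (p 4) (p 1)) (gPsiPsi k ν lam (p 4) (p 1)) (gPsiPhi k ν lam n (p 4) (p 1))
      (gPhiPhi k ν lam (p 4) (p 1)) (-(conf k ν lam (p 4) (p 1) / G ν lam (p 1)))
      (conf k ν lam (p 4) (p 1) / G ν lam (p 4)) := by
  have hsub : p 4 - p 1 ≠ 0 := sub_ne_zero.mpr hxy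
  have hsub' : p 1 - p 4 ≠ 0 := sub_ne_zero.mpr hxy.symm
  have hν' : 1 - ν ≠ 0 := sub_ne_zero.mpr hν.symm
  -- Eliminating 1 + ν + λ in favour of m lets the squared roots coming from products of M and P
  -- cancel as rational expressions.
  have hep : 1 + ν + lam = m ^ 2 / (1 - lam + ν) := by rw [hm2]; field_simp
  have hm' : √((ν + 1) ^ 2 - lam ^ 2) = m := by rw [add_comm, hm]
  have hM : M k ν lam (p 4) (p 1) = 2 * k * lam * m * ((p 1 + 1) * mNum ν lam (p 4) (p 1))
      / ((1 - lam + ν) * H ν lam (p 1) (p 4)) := by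
    unfold M mNum; rw [hm', mul_assoc (2 * k * lam * m)]
  have hP : P k ν lam (p 4) (p 1) = 2 * k * lam * n * m * ((p 4 ^ 2 - 1) * p 1)
      / H ν lam (p 1) (p 4) := by
    unfold P; rw [hm', hn, mul_assoc (2 * k * lam * n * m)]
  have hF : ∀ x y, F k ν lam x y = 2 * k ^ 2 / ((x - y) ^ 2 * (1 - ν) ^ 2) * fNum ν lam x y :=
    fun x y => rfl
  have hJ : J k ν lam (p 4) (p 1) = 2 * k ^ 2 * n
      * (lam * ((1 - p 4 ^ 2) * (1 - p 1 ^ 2) * (p 4 - p 1)) * jNum ν lam (p 4) (p 1))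
      / ((p 4 - p 1) ^ 2 * (1 - ν) ^ 2) := by
    unfold J jNum; rw [hn]; field_simp
  have h1 := eq_div_of_mul_eq hH' (psiPsiNum_mul_H ν lam (p 4) (p 1))
  have h2 := eq_div_of_mul_eq hH' (psiPhiNum_mul_H ν lam (p 4) (p 1))
  have h3 := eq_div_of_mul_eq hH' (phiPhiNum_mul_H ν lam (p 4) (p 1))
  rw [hep] at h1 h2 h3
  have e1 : -(F k ν lam (p 4) (p 1) / H ν lam (p 1) (p 4)) - H ν lam (p 1) (p 4)
      / H ν lam (p 4) (p 1) * (M k ν lam (p 4) (p 1) * M k ν lam (p 4) (p 1))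
      = gPsiPsi k ν lam (p 4) (p 1) := by
    unfold gPsiPsi den
    rw [hM, hF, h1]; field_simp; ring
  have e2 : -(J k ν lam (p 4) (p 1) / H ν lam (p 1) (p 4)) - H ν lam (p 1) (p 4)
      / H ν lam (p 4) (p 1) * (M k ν lam (p 4) (p 1) * P k ν lam (p 4) (p 1))
      = gPsiPhi k ν lam n (p 4) (p 1) := by
    unfold gPsiPhi den
    rw [hM, hP, hJ, h2]; field_simp; ring
  have e3 : F k ν lam (p 1) (p 4) / H ν lam (p 1) (p 4) - H ν lam (p 1) (p 4)
      / H ν lam (p 4) (p 1) * (P k ν lam (p 4) (p 1) * P k ν lam (p 4) (p 1))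
      = gPhiPhi k ν lam (p 4) (p 1) := by
    unfold gPhiPhi den
    rw [hP, hF, h3, ← hn2, show (p 1 - p 4) ^ 2 = (p 4 - p 1) ^ 2 by ring]
    rw [← hn2] at hH hH' he hν'
    field_simp
  have e4 : -(H ν lam (p 1) (p 4) / H ν lam (p 4) (p 1) * M k ν lam (p 4) (p 1))
      = gTPsi k ν lam m (p 4) (p 1) := by
    unfold gTPsi; rw [hM]; field_simp
  have e5 : -(H ν lam (p 1) (p 4) / H ν lam (p 4) (p 1) * P k ν lam (p 4) (p 1))
      = gTPhi k ν lam n m (p 4) (p 1) := by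
    unfold gTPhi; rw [hP]; field_simp
  have hmet : ∀ i j, metric k ν lam p i j =
      !![0, 0, 0, 0, 0;
        0, -(conf k ν lam (p 4) (p 1) / G ν lam (p 1)), 0, 0, 0;
        0, 0, -(F k ν lam (p 4) (p 1) / H ν lam (p 1) (p 4)),
          -(J k ν lam (p 4) (p 1) / H ν lam (p 1) (p 4)), 0;
        0, 0, -(J k ν lam (p 4) (p 1) / H ν lam (p 1) (p 4)),
          F k ν lam (p 1) (p 4) / H ν lam (p 1) (p 4), 0;
        0, 0, 0, 0, conf k ν lam (p 4) (p 1) / G ν lam (p 4)] i j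
      - H ν lam (p 1) (p 4) / H ν lam (p 4) (p 1)
        * ((![1, 0, M k ν lam (p 4) (p 1), P k ν lam (p 4) (p 1), 0] : Fin 5 → ℝ) i
          * (![1, 0, M k ν lam (p 4) (p 1), P k ν lam (p 4) (p 1), 0] : Fin 5 → ℝ) j) :=
    fun _ _ => rfl
  ext i j
  rw [hmet, ← e1, ← e2, ← e3, ← e4, ← e5]
  fin_cases i <;> fin_cases j <;> simp [blockMat, gTT, mul_comm]

/-- The change from the frame `(∂t, ∂y, ∂ψ, ∂φ, ∂x)` to `(K, ∂y, ∂ψ, ∂φ, ∂x)`, with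
`K = ∂t + a ∂ψ + b ∂φ`. -/
def shift (a b : ℝ) : Mat5 :=
  !![1, 0, 0, 0, 0;
     0, 1, 0, 0, 0;
     -a, 0, 1, 0, 0;
     -b, 0, 0, 1, 0;
     0, 0, 0, 0, 1]

theorem shift_mul_shift (a b : ℝ) : shift a b * shift (-a) (-b) = 1 := by
  ext i j
  fin_cases i <;> fin_cases j <;> simp [shift, Matrix.mul_apply, Fin.sum_univ_five]

/-- The first three entries of the block on the right are g(K,K), g(K,∂ψ), g(K,∂φ), expanded by
bilinearity. -/
theorem blockMat_eq_shift (a b tt tψ tφ ψψ ψφ φφ yy xx : ℝ) :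
    blockMat tt tψ tφ ψψ ψφ φφ yy xx = (shift a b)ᵀ *
      blockMat (tt + 2 * a * tψ + 2 * b * tφ + a ^ 2 * ψψ + 2 * a * b * ψφ + b ^ 2 * φφ)
        (tψ + a * ψψ + b * ψφ) (tφ + a * ψφ + b * φφ) ψψ ψφ φφ yy xx * shift a b := by
  ext i j
  fin_cases i <;> fin_cases j <;>
    simp [shift, blockMat, Matrix.mul_apply, Fin.sum_univ_five] <;> ring

/-- The numerator of `g(K, ∂ψ) / (y - r)`, where `s` is the other root of `ν y² + λ y + 1`. -/
def kPsiNum (ν lam s x y : ℝ) : ℝ :=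
  ν * (y - s) * zNum ν lam x y - ν * ((x - y) * (1 - x ^ 2)) * qNum ν lam x y

/-- The numerator of `g(K, ∂φ) / (y - r)`. -/
def kPhiNum (ν lam s x y : ℝ) : ℝ := ν * (y - s) * wNum ν lam x y + pNum ν lam x y

/-- The numerator of `g(K, K) / (y - r)`. -/
def kkNum (ν lam r s x y : ℝ) : ℝ :=
  -(2 * (1 + ν + lam) * ((1 - ν) ^ 2 * (x - y) ^ 2) * (ν * (x ^ 2 * y - s)))
    + (1 + y) * kPsiNum ν lam s x y
    - ν * ((1 - ν) * r - lam) / lam ^ 2 * ((1 - x ^ 2) * kPhiNum ν lam s x y)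

/-- `g(K, K) / (y - r)`. -/
def gKK (ν lam r s x y : ℝ) : ℝ :=
  (1 - ν) * (1 - lam + ν) * kkNum ν lam r s x y / (2 * (1 + ν + lam) * den ν lam x y)

/-- `g(K, ∂ψ) / (y - r)`. -/
def gKPsi (k ν lam m s x y : ℝ) : ℝ :=
  k * (1 - ν) * (1 - lam + ν) * ((1 + y) * kPsiNum ν lam s x y) / (m * den ν lam x y)

/-- `g(K, ∂φ) / (y - r)`. -/
def gKPhi (k ν lam n m s x y : ℝ) : ℝ :=
  k * n * (1 - ν) * (1 - lam + ν) * ((1 - x ^ 2) * kPhiNum ν lam s x y) / (lam * m * den ν lam x y)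

/-- `(y - r) g_yy`. -/
def gRad (k ν lam s x y : ℝ) : ℝ := -(conf k ν lam x y / ((1 - y ^ 2) * (ν * (y - s))))

/-- The parameters of a Killing horizon `y = r`, where `r` and `s` are the roots of
`ν y² + λ y + 1` and `∂t + a ∂ψ + b ∂φ` is null at the horizon. -/
structure IsHorizonData (k ν lam r s n m a b : ℝ) : Prop where
  k_ne : k ≠ 0
  ν_ne : ν ≠ 1
  lam_ne : lam ≠ 0
  n_pos : 0 < n
  n_sq : n ^ 2 = ν
  m_pos : 0 < m
  m_sq : m ^ 2 = (1 - lam + ν) * (1 + ν + lam)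
  e_ne : 1 - lam + ν ≠ 0
  mul_roots : ν * (r * s) = 1
  add_roots : lam = -(ν * (r + s))
  a_eq : a = (1 - lam + ν) / (2 * k * m)
  b_eq : b = -(a * n * ((1 - ν) * r - lam) / lam)

/-! ### Division of the products with K by y - r -/

namespace IsHorizonData

variable {k ν lam r s n m a b : ℝ}

theorem ep_ne (h : IsHorizonData k ν lam r s n m a b) : 1 + ν + lam ≠ 0 := fun h0 => by
  have := h.m_sq
  rw [h0, mul_zero] at this
  exact h.m_pos.ne' (by simpa using this)

theorem sqrt_n (h : IsHorizonData k ν lam r s n m a b) : √ν = n := by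
  rw [← h.n_sq, Real.sqrt_sq h.n_pos.le]

theorem sqrt_m (h : IsHorizonData k ν lam r s n m a b) : √((1 + ν) ^ 2 - lam ^ 2) = m := by
  rw [show (1 + ν) ^ 2 - lam ^ 2 = m ^ 2 by rw [h.m_sq]; ring, Real.sqrt_sq h.m_pos.le]

theorem quadratic (h : IsHorizonData k ν lam r s n m a b) (y : ℝ) :
    ν * y ^ 2 + lam * y + 1 = ν * (y - r) * (y - s) := by
  rw [h.add_roots]; linear_combination -h.mul_roots

theorem ν_ne_zero (h : IsHorizonData k ν lam r s n m a b) : ν ≠ 0 := by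
  rw [← h.n_sq]; exact pow_ne_zero 2 h.n_pos.ne'

/-- The `mNum` terms cancel. The `qNum` terms, one with (1 - ν)y - λ and one with (1 - ν)r - λ,
differ by a multiple of y - r, and the `zNum` term carries ν(y - r)(y - s). -/
theorem psi_num (h : IsHorizonData k ν lam r s n m a b) (x y : ℝ) :
    -(2 * (1 + ν + lam) * ((1 - ν) ^ 2 * (x - y) ^ 2) * lam * ((y + 1) * mNum ν lam x y))
      - psiPsiNum ν lam x y
      + ((1 - ν) * r - lam) / lam * n ^ 2 * (1 - lam + ν) * psiPhiNum ν lam x y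
      = (y - r) * ((1 - ν) * (1 - lam + ν) * ((1 + y) * kPsiNum ν lam s x y)) := by
  have hl := h.lam_ne
  unfold psiPsiNum psiPhiNum kPsiNum
  rw [h.quadratic y, h.n_sq]
  field_simp
  ring

theorem phi_num (h : IsHorizonData k ν lam r s n m a b) (x y : ℝ) :
    -(2 * (1 + ν + lam) * ((1 - ν) ^ 2 * (x - y) ^ 2) * lam * ((x ^ 2 - 1) * y))
      - psiPhiNum ν lam x y - ((1 - ν) * r - lam) / lam * phiPhiNum ν lam x y
      = (y - r) * ((1 - ν) * ((1 - x ^ 2) * kPhiNum ν lam s x y)) / lam := by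
  have hl := h.lam_ne
  have h1 := wNum_eq ν lam x y
  rw [h.quadratic y] at h1
  unfold psiPhiNum phiPhiNum kPhiNum
  field_simp
  linear_combination (1 - x ^ 2) * h1

theorem gK_psi (h : IsHorizonData k ν lam r s n m a b) {x y : ℝ} (hxy : x ≠ y)
    (hH : H ν lam x y ≠ 0) :
    gTPsi k ν lam m x y + a * gPsiPsi k ν lam x y + b * gPsiPhi k ν lam n x y
      = (y - r) * gKPsi k ν lam m s x y := by
  have hl := h.lam_ne
  have he := h.e_ne
  have hk := h.k_ne
  have hm := h.m_pos.ne'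
  have hν : 1 - ν ≠ 0 := sub_ne_zero.mpr h.ν_ne.symm
  have hx : x - y ≠ 0 := sub_ne_zero.mpr hxy
  have hep : 1 + ν + lam = m ^ 2 / (1 - lam + ν) := by rw [h.m_sq]; field_simp
  have h1 := h.psi_num x y
  have h2 : (y - r) * gKPsi k ν lam m s x y = k * ((y - r) * ((1 - ν) * (1 - lam + ν)
      * ((1 + y) * kPsiNum ν lam s x y))) / (m * den ν lam x y) := by
    unfold gKPsi; ring
  rw [h2, ← h1, hep, h.b_eq, h.a_eq]
  unfold gTPsi gPsiPsi gPsiPhi den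
  field_simp
  ring

theorem gK_phi (h : IsHorizonData k ν lam r s n m a b) {x y : ℝ} (hxy : x ≠ y)
    (hH : H ν lam x y ≠ 0) :
    gTPhi k ν lam n m x y + a * gPsiPhi k ν lam n x y + b * gPhiPhi k ν lam x y
      = (y - r) * gKPhi k ν lam n m s x y := by
  have hl := h.lam_ne
  have he := h.e_ne
  have hk := h.k_ne
  have hm := h.m_pos.ne'
  have hν : 1 - ν ≠ 0 := sub_ne_zero.mpr h.ν_ne.symm
  have hx : x - y ≠ 0 := sub_ne_zero.mpr hxy
  have hep : 1 + ν + lam = m ^ 2 / (1 - lam + ν) := by rw [h.m_sq]; field_simp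
  have h1 := h.phi_num x y
  have h2 : (y - r) * gKPhi k ν lam n m s x y = k * n * (1 - lam + ν) * ((y - r) * ((1 - ν)
      * ((1 - x ^ 2) * kPhiNum ν lam s x y)) / lam) / (m * den ν lam x y) := by
    unfold gKPhi; field_simp
  rw [h2, ← h1, hep, h.b_eq, h.a_eq]
  unfold gTPhi gPhiPhi gPsiPhi den
  field_simp
  ring

theorem gK_t (h : IsHorizonData k ν lam r s n m a b) {x y : ℝ} :
    gTT ν lam x y + a * gTPsi k ν lam m x y + b * gTPhi k ν lam n m x y
      = -((y - r) * ((1 - ν) * (1 - lam + ν) * (ν * (x ^ 2 * y - s))) / H ν lam x y) := by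
  have hl := h.lam_ne
  have he := h.e_ne
  have hk := h.k_ne
  have hm := h.m_pos.ne'
  have h1 := H_add_mNum ν lam x y
  rw [h.quadratic y] at h1
  have h2 : (y - r) * ((1 - ν) * (1 - lam + ν) * (ν * (x ^ 2 * y - s)))
      = H ν lam y x + lam * ((y + 1) * mNum ν lam x y)
        - n ^ 2 * (1 - lam + ν) * ((x ^ 2 - 1) * y) * ((1 - ν) * r - lam) := by
    rw [h.n_sq]
    linear_combination -h1
  rw [h2, h.b_eq, h.a_eq]
  unfold gTT gTPsi gTPhi
  field_simp
  ring

/-- By bilinearity g(K,K) = g(K,∂t) + a g(K,∂ψ) + b g(K,∂φ), and each term is divisible by y - r. -/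
theorem gK_K (h : IsHorizonData k ν lam r s n m a b) {x y : ℝ} (hxy : x ≠ y)
    (hH : H ν lam x y ≠ 0) :
    gTT ν lam x y + 2 * a * gTPsi k ν lam m x y + 2 * b * gTPhi k ν lam n m x y
        + a ^ 2 * gPsiPsi k ν lam x y + 2 * a * b * gPsiPhi k ν lam n x y
        + b ^ 2 * gPhiPhi k ν lam x y
      = (y - r) * gKK ν lam r s x y := by
  have hl := h.lam_ne
  have he := h.e_ne
  have hk := h.k_ne
  have hm := h.m_pos.ne'
  have hν : 1 - ν ≠ 0 := sub_ne_zero.mpr h.ν_ne.symm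
  have hx : x - y ≠ 0 := sub_ne_zero.mpr hxy
  have hep : 1 + ν + lam = m ^ 2 / (1 - lam + ν) := by rw [h.m_sq]; field_simp
  have h3 : gKK ν lam r s x y = -((1 - ν) * (1 - lam + ν) * (ν * (x ^ 2 * y - s)) / H ν lam x y)
      + a * gKPsi k ν lam m s x y + b * gKPhi k ν lam n m s x y := by
    unfold gKK kkNum gKPsi gKPhi den
    rw [hep, h.b_eq, h.a_eq, ← h.n_sq]
    have hν' := hν
    have hH' := hH
    have he' := he
    rw [← h.n_sq] at hν' hH' he'
    field_simp
    ring
  rw [h3]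
  linear_combination h.gK_t (x := x) (y := y) + a * h.gK_psi hxy hH + b * h.gK_phi hxy hH

/-- The metric in the frame adapted to the horizon. -/
theorem metric_eq (h : IsHorizonData k ν lam r s n m a b) {p : Coords} (hxy : p 4 ≠ p 1)
    (hH : H ν lam (p 4) (p 1) ≠ 0) (hH' : H ν lam (p 1) (p 4) ≠ 0) :
    metric k ν lam p = (shift a b)ᵀ * blockMat ((p 1 - r) * gKK ν lam r s (p 4) (p 1))
      ((p 1 - r) * gKPsi k ν lam m s (p 4) (p 1)) ((p 1 - r) * gKPhi k ν lam n m s (p 4) (p 1))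
      (gPsiPsi k ν lam (p 4) (p 1)) (gPsiPhi k ν lam n (p 4) (p 1)) (gPhiPhi k ν lam (p 4) (p 1))
      (gRad k ν lam s (p 4) (p 1) / (p 1 - r)) (conf k ν lam (p 4) (p 1) / G ν lam (p 4))
      * shift a b := by
  rw [metric_eq_blockMat h.ν_ne h.e_ne h.sqrt_n h.n_sq h.sqrt_m h.m_sq hxy hH hH',
    blockMat_eq_shift a b, h.gK_K hxy hH, h.gK_psi hxy hH, h.gK_phi hxy hH]
  congr 3
  unfold gRad G
  rw [h.quadratic, neg_div, div_div]
  ring_nf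

end IsHorizonData

/-! ### The determinant of the metric -/

/-- The polynomial form of the formula for the determinant of the `(t, ψ, φ)` block, as the
difference of its two sides. -/
def detDefect (ν lam x y : ℝ) : ℝ :=
  H ν lam y x * (psiPsiNum ν lam x y * phiPhiNum ν lam x y
      + (1 - lam + ν) * ν * psiPhiNum ν lam x y ^ 2)
    - (1 - ν) ^ 2 * (x - y) ^ 2 * (2 * lam ^ 2 * (1 + ν + lam)) *
      (((y + 1) * mNum ν lam x y) ^ 2 * phiPhiNum ν lam x y
        + 2 * ν * (1 - lam + ν) * ((y + 1) * mNum ν lam x y) * ((x ^ 2 - 1) * y)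
          * psiPhiNum ν lam x y
        - ν * (1 - lam + ν) * ((x ^ 2 - 1) * y) ^ 2 * psiPsiNum ν lam x y)
    - (1 - lam + ν) * H ν lam x y ^ 3 * (1 - ν) ^ 2 * G ν lam x * G ν lam y

/-- Multiplication by H(y,x) brings back F, J and Ω. Replacing dt by dt + Ω is unimodular, so the Ω
terms drop out of the determinant, and `fNum_mul_fNum` evaluates the rest. -/
theorem detDefect_mul_H (ν lam x y : ℝ) : H ν lam y x * detDefect ν lam x y = 0 := by
  have h1 := psiPsiNum_mul_H ν lam x y
  have h2 := psiPhiNum_mul_H ν lam x y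
  have h3 := phiPhiNum_mul_H ν lam x y
  have h4 := fNum_mul_fNum ν lam x y
  have h5 : H ν lam y x * detDefect ν lam x y =
      (psiPsiNum ν lam x y * H ν lam y x) * (phiPhiNum ν lam x y * H ν lam y x)
      + (1 - lam + ν) * ν * (psiPhiNum ν lam x y * H ν lam y x) ^ 2
    - (1 - ν) ^ 2 * (x - y) ^ 2 * (2 * lam ^ 2 * (1 + ν + lam)) *
      (((y + 1) * mNum ν lam x y) ^ 2 * (phiPhiNum ν lam x y * H ν lam y x)
        + 2 * ν * (1 - lam + ν) * ((y + 1) * mNum ν lam x y) * ((x ^ 2 - 1) * y)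
          * (psiPhiNum ν lam x y * H ν lam y x)
        - ν * (1 - lam + ν) * ((x ^ 2 - 1) * y) ^ 2 * (psiPsiNum ν lam x y * H ν lam y x))
    - (1 - lam + ν) * H ν lam x y ^ 2 *
      ((1 - ν) ^ 2 * G ν lam x * G ν lam y * H ν lam x y * H ν lam y x) := by
    unfold detDefect; ring
  rw [h5, ← h4, h1, h2, h3]
  generalize lam * ((1 - x ^ 2) * (1 - y ^ 2) * (x - y)) * jNum ν lam x y = j
  generalize (y + 1) * mNum ν lam x y = P1
  generalize (x ^ 2 - 1) * y = X
  generalize (1 - ν) ^ 2 * (x - y) ^ 2 = Δ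
  ring

/-! ### Analytic dependence of the numerators on variables and parameters -/

section Analytic

variable {E : Type*} [NormedAddCommGroup E] [NormedSpace ℝ E] {f g ν lam : E → ℝ} {p : E}

@[fun_prop]
theorem analyticAt_H (hν : AnalyticAt ℝ ν p) (hlam : AnalyticAt ℝ lam p) (hf : AnalyticAt ℝ f p)
    (hg : AnalyticAt ℝ g p) : AnalyticAt ℝ (fun q => H (ν q) (lam q) (f q) (g q)) p := by
  unfold H; fun_prop

@[fun_prop]
theorem analyticAt_G (hν : AnalyticAt ℝ ν p) (hlam : AnalyticAt ℝ lam p)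
    (hf : AnalyticAt ℝ f p) : AnalyticAt ℝ (fun q => G (ν q) (lam q) (f q)) p := by
  unfold G; fun_prop

@[fun_prop]
theorem analyticAt_mNum (hν : AnalyticAt ℝ ν p) (hlam : AnalyticAt ℝ lam p)
    (hf : AnalyticAt ℝ f p) (hg : AnalyticAt ℝ g p) :
    AnalyticAt ℝ (fun q => mNum (ν q) (lam q) (f q) (g q)) p := by
  unfold mNum; fun_prop

@[fun_prop]
theorem analyticAt_qNum (hν : AnalyticAt ℝ ν p) (hlam : AnalyticAt ℝ lam p)
    (hf : AnalyticAt ℝ f p) (hg : AnalyticAt ℝ g p) :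
    AnalyticAt ℝ (fun q => qNum (ν q) (lam q) (f q) (g q)) p := by
  unfold qNum; fun_prop

@[fun_prop]
theorem analyticAt_zNum (hν : AnalyticAt ℝ ν p) (hlam : AnalyticAt ℝ lam p)
    (hf : AnalyticAt ℝ f p) (hg : AnalyticAt ℝ g p) :
    AnalyticAt ℝ (fun q => zNum (ν q) (lam q) (f q) (g q)) p := by
  unfold zNum; fun_prop

@[fun_prop]
theorem analyticAt_pNum (hν : AnalyticAt ℝ ν p) (hlam : AnalyticAt ℝ lam p)
    (hf : AnalyticAt ℝ f p) (hg : AnalyticAt ℝ g p) :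
    AnalyticAt ℝ (fun q => pNum (ν q) (lam q) (f q) (g q)) p := by
  unfold pNum; fun_prop

@[fun_prop]
theorem analyticAt_wNum (hν : AnalyticAt ℝ ν p) (hlam : AnalyticAt ℝ lam p)
    (hf : AnalyticAt ℝ f p) (hg : AnalyticAt ℝ g p) :
    AnalyticAt ℝ (fun q => wNum (ν q) (lam q) (f q) (g q)) p := by
  unfold wNum; fun_prop

@[fun_prop]
theorem analyticAt_psiPsiNum (hν : AnalyticAt ℝ ν p) (hlam : AnalyticAt ℝ lam p)
    (hf : AnalyticAt ℝ f p) (hg : AnalyticAt ℝ g p) :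
    AnalyticAt ℝ (fun q => psiPsiNum (ν q) (lam q) (f q) (g q)) p := by
  unfold psiPsiNum; fun_prop

@[fun_prop]
theorem analyticAt_psiPhiNum (hν : AnalyticAt ℝ ν p) (hlam : AnalyticAt ℝ lam p)
    (hf : AnalyticAt ℝ f p) (hg : AnalyticAt ℝ g p) :
    AnalyticAt ℝ (fun q => psiPhiNum (ν q) (lam q) (f q) (g q)) p := by
  unfold psiPhiNum; fun_prop

@[fun_prop]
theorem analyticAt_phiPhiNum (hν : AnalyticAt ℝ ν p) (hlam : AnalyticAt ℝ lam p)
    (hf : AnalyticAt ℝ f p) (hg : AnalyticAt ℝ g p) :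
    AnalyticAt ℝ (fun q => phiPhiNum (ν q) (lam q) (f q) (g q)) p := by
  unfold phiPhiNum; fun_prop

theorem analyticAt_detDefect (hν : AnalyticAt ℝ ν p) (hlam : AnalyticAt ℝ lam p)
    (hf : AnalyticAt ℝ f p) (hg : AnalyticAt ℝ g p) :
    AnalyticAt ℝ (fun q => detDefect (ν q) (lam q) (f q) (g q)) p := by
  unfold detDefect; fun_prop

end Analytic

/-- H(y,x) must be cancelled even where it vanishes. All four arguments, parameters included, are
scaled by t: at t = 0 the value of H is 1, so the defect vanishes for small t, hence by analyticity
for every t, in particular t = 1. -/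
theorem detDefect_eq_zero (ν lam x y : ℝ) : detDefect ν lam x y = 0 := by
  have hlin : ∀ (c t : ℝ), AnalyticAt ℝ (fun t : ℝ => t * c) t := fun c t => by fun_prop
  have ha : AnalyticOnNhd ℝ (fun t : ℝ => detDefect (t * ν) (t * lam) (t * x) (t * y)) Set.univ :=
    fun t _ => analyticAt_detDefect (hlin _ _) (hlin _ _) (hlin _ _) (hlin _ _)
  have hH : ContinuousAt (fun t : ℝ => H (t * ν) (t * lam) (t * y) (t * x)) 0 :=
    (analyticAt_H (hlin _ _) (hlin _ _) (hlin _ _) (hlin _ _)).continuousAt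
  have hne : ∀ᶠ t in 𝓝 (0 : ℝ), H (t * ν) (t * lam) (t * y) (t * x) ≠ 0 :=
    hH.eventually_ne (by simp [H])
  have hev : (fun t : ℝ => detDefect (t * ν) (t * lam) (t * x) (t * y)) =ᶠ[𝓝 0] 0 := by
    filter_upwards [hne] with t ht
    exact (mul_eq_zero.mp (detDefect_mul_H _ _ _ _)).resolve_left ht
  have := ha.eqOn_zero_of_preconnected_of_eventuallyEq_zero isPreconnected_univ
    (Set.mem_univ 0) hev (Set.mem_univ 1)
  simpa using this

/-- The determinant of the `(t, ψ, φ)` block of the metric. -/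
theorem det_block {k ν lam n m x y : ℝ} (hν : ν ≠ 1) (he : 1 - lam + ν ≠ 0) (hn : n ^ 2 = ν)
    (hm : m ^ 2 = (1 - lam + ν) * (1 + ν + lam)) (hxy : x ≠ y) (hH : H ν lam x y ≠ 0) :
    gTT ν lam x y * (gPsiPsi k ν lam x y * gPhiPhi k ν lam x y - gPsiPhi k ν lam n x y ^ 2)
        - gTPsi k ν lam m x y ^ 2 * gPhiPhi k ν lam x y
        + 2 * gTPsi k ν lam m x y * gTPhi k ν lam n m x y * gPsiPhi k ν lam n x y
        - gTPhi k ν lam n m x y ^ 2 * gPsiPsi k ν lam x y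
      = 4 * k ^ 4 * G ν lam x * G ν lam y / ((1 - ν) ^ 2 * (x - y) ^ 4) := by
  have hx : x - y ≠ 0 := sub_ne_zero.mpr hxy
  have hν' : 1 - ν ≠ 0 := sub_ne_zero.mpr hν.symm
  have h := detDefect_eq_zero ν lam x y
  unfold detDefect at h
  have h1 : G ν lam x * G ν lam y = (H ν lam y x * (psiPsiNum ν lam x y * phiPhiNum ν lam x y
      + (1 - lam + ν) * n ^ 2 * psiPhiNum ν lam x y ^ 2)
    - (1 - ν) ^ 2 * (x - y) ^ 2 * (2 * lam ^ 2 * (m ^ 2 / (1 - lam + ν))) *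
      (((y + 1) * mNum ν lam x y) ^ 2 * phiPhiNum ν lam x y
        + 2 * n ^ 2 * (1 - lam + ν) * ((y + 1) * mNum ν lam x y) * ((x ^ 2 - 1) * y)
          * psiPhiNum ν lam x y
        - n ^ 2 * (1 - lam + ν) * ((x ^ 2 - 1) * y) ^ 2 * psiPsiNum ν lam x y))
      / ((1 - lam + ν) * H ν lam x y ^ 3 * (1 - ν) ^ 2) := by
    rw [hn, hm, eq_div_iff (by positivity), mul_div_cancel_left₀ _ he]
    linear_combination -h
  rw [mul_assoc (4 * k ^ 4), h1]
  unfold gTT gPsiPsi gPhiPhi gPsiPhi gTPsi gTPhi den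
  field_simp
  ring

namespace IsHorizonData

variable {k ν lam r s n m a b : ℝ}

/-- Passing to the frame with K has determinant one, so this is `det_block` with G(y) factored
through y - r. -/
theorem det_frame_mul (h : IsHorizonData k ν lam r s n m a b) {x y : ℝ} (hxy : x ≠ y)
    (hH : H ν lam x y ≠ 0) :
    (y - r) * (gKK ν lam r s x y
          * (gPsiPsi k ν lam x y * gPhiPhi k ν lam x y - gPsiPhi k ν lam n x y ^ 2)
        - (y - r) * (gKPsi k ν lam m s x y ^ 2 * gPhiPhi k ν lam x y
          - 2 * gKPsi k ν lam m s x y * gKPhi k ν lam n m s x y * gPsiPhi k ν lam n x y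
          + gKPhi k ν lam n m s x y ^ 2 * gPsiPsi k ν lam x y))
      = (y - r) * (4 * k ^ 4 * G ν lam x * ((1 - y ^ 2) * (ν * (y - s)))
          / ((1 - ν) ^ 2 * (x - y) ^ 4)) := by
  have h1 := det_block (k := k) h.ν_ne h.e_ne h.n_sq h.m_sq hxy hH
  have hG : G ν lam y = (y - r) * ((1 - y ^ 2) * (ν * (y - s))) := by
    unfold G; rw [h.quadratic]; ring
  rw [hG] at h1
  have h2 := h.gK_K hxy hH
  have h3 := h.gK_psi hxy hH
  have h4 := h.gK_phi hxy hH
  calc _ = ((y - r) * gKK ν lam r s x y)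
          * (gPsiPsi k ν lam x y * gPhiPhi k ν lam x y - gPsiPhi k ν lam n x y ^ 2)
        - (((y - r) * gKPsi k ν lam m s x y) ^ 2 * gPhiPhi k ν lam x y
          - 2 * ((y - r) * gKPsi k ν lam m s x y) * ((y - r) * gKPhi k ν lam n m s x y)
            * gPsiPhi k ν lam n x y
          + ((y - r) * gKPhi k ν lam n m s x y) ^ 2 * gPsiPsi k ν lam x y) := by ring
    _ = _ := by
      rw [← h2, ← h3, ← h4]
      linear_combination h1

end IsHorizonData

/-! ### Regularity of the frame components -/

theorem den_ne_zero {ν lam x y : ℝ} (hν : ν ≠ 1) (hxy : x ≠ y) (hH : H ν lam x y ≠ 0) :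
    den ν lam x y ≠ 0 :=
  mul_ne_zero hH (mul_ne_zero (pow_ne_zero 2 (sub_ne_zero.mpr hν.symm))
    (pow_ne_zero 2 (sub_ne_zero.mpr hxy)))

section Analytic

variable {E : Type*} [NormedAddCommGroup E] [NormedSpace ℝ E] {f g : E → ℝ} {p : E}
  {k ν lam r s n m a b : ℝ}

@[fun_prop]
theorem analyticAt_den (hf : AnalyticAt ℝ f p) (hg : AnalyticAt ℝ g p) :
    AnalyticAt ℝ (fun q => den ν lam (f q) (g q)) p := by
  unfold den; fun_prop

@[fun_prop]
theorem analyticAt_kPsiNum (hf : AnalyticAt ℝ f p) (hg : AnalyticAt ℝ g p) :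
    AnalyticAt ℝ (fun q => kPsiNum ν lam s (f q) (g q)) p := by
  unfold kPsiNum; fun_prop

@[fun_prop]
theorem analyticAt_kPhiNum (hf : AnalyticAt ℝ f p) (hg : AnalyticAt ℝ g p) :
    AnalyticAt ℝ (fun q => kPhiNum ν lam s (f q) (g q)) p := by
  unfold kPhiNum; fun_prop

@[fun_prop]
theorem analyticAt_kkNum (hf : AnalyticAt ℝ f p) (hg : AnalyticAt ℝ g p) :
    AnalyticAt ℝ (fun q => kkNum ν lam r s (f q) (g q)) p := by
  unfold kkNum; fun_prop

theorem analyticAt_conf (hν : ν ≠ 1) (hf : AnalyticAt ℝ f p) (hg : AnalyticAt ℝ g p)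
    (hxy : f p ≠ g p) : AnalyticAt ℝ (fun q => conf k ν lam (f q) (g q)) p := by
  unfold conf
  refine AnalyticAt.fun_div (by fun_prop) (by fun_prop) ?_
  exact mul_ne_zero (pow_ne_zero 2 (sub_ne_zero.mpr hν.symm))
    (pow_ne_zero 2 (sub_ne_zero.mpr hxy))

theorem analyticAt_gPsiPsi (he : 1 - lam + ν ≠ 0) (hν : ν ≠ 1) (hf : AnalyticAt ℝ f p)
    (hg : AnalyticAt ℝ g p) (hxy : f p ≠ g p) (hH : H ν lam (f p) (g p) ≠ 0) :
    AnalyticAt ℝ (fun q => gPsiPsi k ν lam (f q) (g q)) p := by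
  unfold gPsiPsi
  exact AnalyticAt.fun_neg (AnalyticAt.fun_div (by fun_prop) (by fun_prop)
    (mul_ne_zero he (den_ne_zero hν hxy hH)))

theorem analyticAt_gPsiPhi (hν : ν ≠ 1) (hf : AnalyticAt ℝ f p)
    (hg : AnalyticAt ℝ g p) (hxy : f p ≠ g p) (hH : H ν lam (f p) (g p) ≠ 0) :
    AnalyticAt ℝ (fun q => gPsiPhi k ν lam n (f q) (g q)) p := by
  unfold gPsiPhi
  exact AnalyticAt.fun_neg
    (AnalyticAt.fun_div (by fun_prop) (by fun_prop) (den_ne_zero hν hxy hH))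

theorem analyticAt_gPhiPhi (hν : ν ≠ 1) (hf : AnalyticAt ℝ f p)
    (hg : AnalyticAt ℝ g p) (hxy : f p ≠ g p) (hH : H ν lam (f p) (g p) ≠ 0) :
    AnalyticAt ℝ (fun q => gPhiPhi k ν lam (f q) (g q)) p := by
  unfold gPhiPhi
  exact AnalyticAt.fun_div (by fun_prop) (by fun_prop) (den_ne_zero hν hxy hH)

theorem analyticAt_gKK (hep : 1 + ν + lam ≠ 0) (hν : ν ≠ 1) (hf : AnalyticAt ℝ f p)
    (hg : AnalyticAt ℝ g p) (hxy : f p ≠ g p) (hH : H ν lam (f p) (g p) ≠ 0) :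
    AnalyticAt ℝ (fun q => gKK ν lam r s (f q) (g q)) p := by
  unfold gKK
  exact AnalyticAt.fun_div (by fun_prop) (by fun_prop)
    (mul_ne_zero (mul_ne_zero two_ne_zero hep) (den_ne_zero hν hxy hH))

theorem analyticAt_gKPsi (hm : m ≠ 0) (hν : ν ≠ 1) (hf : AnalyticAt ℝ f p)
    (hg : AnalyticAt ℝ g p) (hxy : f p ≠ g p) (hH : H ν lam (f p) (g p) ≠ 0) :
    AnalyticAt ℝ (fun q => gKPsi k ν lam m s (f q) (g q)) p := by
  unfold gKPsi
  exact AnalyticAt.fun_div (by fun_prop) (by fun_prop) (mul_ne_zero hm (den_ne_zero hν hxy hH))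

theorem analyticAt_gKPhi (hl : lam ≠ 0) (hm : m ≠ 0) (hν : ν ≠ 1) (hf : AnalyticAt ℝ f p)
    (hg : AnalyticAt ℝ g p) (hxy : f p ≠ g p) (hH : H ν lam (f p) (g p) ≠ 0) :
    AnalyticAt ℝ (fun q => gKPhi k ν lam n m s (f q) (g q)) p := by
  unfold gKPhi
  exact AnalyticAt.fun_div (by fun_prop) (by fun_prop)
    (mul_ne_zero (mul_ne_zero hl hm) (den_ne_zero hν hxy hH))

theorem one_sub_sq_ne_zero {y : ℝ} (hy : y ^ 2 ≠ 1) : 1 - y ^ 2 ≠ 0 :=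
  sub_ne_zero.mpr hy.symm

theorem analyticAt_gRad (hν0 : ν ≠ 0) (hν : ν ≠ 1) (hf : AnalyticAt ℝ f p)
    (hg : AnalyticAt ℝ g p) (hxy : f p ≠ g p) (h1 : g p ^ 2 ≠ 1) (hs : g p ≠ s) :
    AnalyticAt ℝ (fun q => gRad k ν lam s (f q) (g q)) p := by
  unfold gRad
  exact AnalyticAt.fun_neg (AnalyticAt.fun_div (analyticAt_conf hν hf hg hxy) (by fun_prop)
    (mul_ne_zero (one_sub_sq_ne_zero h1) (mul_ne_zero hν0 (sub_ne_zero.mpr hs))))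

end Analytic

theorem eq_zero_of_eventually_punctured {F : ℝ → ℝ} {r : ℝ} (hc : ContinuousAt F r)
    (h : ∀ᶠ y in 𝓝[≠] r, F y = 0) : F r = 0 :=
  tendsto_nhds_unique (hc.mono_left nhdsWithin_le_nhds)
    (tendsto_const_nhds.congr' (h.mono fun _ hy => hy.symm))

theorem eventually_regular {ν lam x r : ℝ} (hxr : x ≠ r) (hH : H ν lam x r ≠ 0) :
    ∀ᶠ y in 𝓝 r, x ≠ y ∧ H ν lam x y ≠ 0 := by
  have hc : ContinuousAt (fun y => H ν lam x y) r :=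
    (analyticAt_H (by fun_prop) (by fun_prop) (by fun_prop) (by fun_prop) :
      AnalyticAt ℝ (fun y => H ν lam x y) r).continuousAt
  filter_upwards [hc.eventually_ne hH, eventually_ne_nhds hxr.symm] with y h1 h2
  exact ⟨h2.symm, h1⟩

/-! ### The determinant and the norm of K at the horizon -/

namespace IsHorizonData

variable {k ν lam r s n m a b : ℝ}

/-- Off the horizon y - r is cancelled; at y = r both sides are continuous, so the identity
persists. -/
theorem det_frame (h : IsHorizonData k ν lam r s n m a b) {x y : ℝ} (hxy : x ≠ y)
    (hH : H ν lam x y ≠ 0) :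
    gKK ν lam r s x y
          * (gPsiPsi k ν lam x y * gPhiPhi k ν lam x y - gPsiPhi k ν lam n x y ^ 2)
        - (y - r) * (gKPsi k ν lam m s x y ^ 2 * gPhiPhi k ν lam x y
          - 2 * gKPsi k ν lam m s x y * gKPhi k ν lam n m s x y * gPsiPhi k ν lam n x y
          + gKPhi k ν lam n m s x y ^ 2 * gPsiPsi k ν lam x y)
      = 4 * k ^ 4 * G ν lam x * ((1 - y ^ 2) * (ν * (y - s)))
          / ((1 - ν) ^ 2 * (x - y) ^ 4) := by
  rcases ne_or_eq y r with hy | rfl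
  · exact mul_left_cancel₀ (sub_ne_zero.mpr hy) (h.det_frame_mul hxy hH)
  · rw [← sub_eq_zero]
    have hx : AnalyticAt ℝ (fun _ : ℝ => x) y := by fun_prop
    have hy : AnalyticAt ℝ (fun z : ℝ => z) y := by fun_prop
    have hν := h.ν_ne
    have a1 := (analyticAt_gKK (r := y) (s := s) h.ep_ne hν hx hy hxy hH).continuousAt
    have a2 := (analyticAt_gPsiPsi (k := k) h.e_ne hν hx hy hxy hH).continuousAt
    have a3 := (analyticAt_gPsiPhi (k := k) (n := n) hν hx hy hxy hH).continuousAt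
    have a4 := (analyticAt_gPhiPhi (k := k) hν hx hy hxy hH).continuousAt
    have a5 := (analyticAt_gKPsi (k := k) (s := s) h.m_pos.ne' hν hx hy hxy hH).continuousAt
    have a6 := (analyticAt_gKPhi (k := k) (n := n) (s := s) h.lam_ne h.m_pos.ne' hν hx hy
      hxy hH).continuousAt
    have a7 : ContinuousAt (fun z => 4 * k ^ 4 * G ν lam x * ((1 - z ^ 2) * (ν * (z - s)))
          / ((1 - ν) ^ 2 * (x - z) ^ 4)) y := by
      refine ContinuousAt.div (by fun_prop) (by fun_prop) ?_
      exact mul_ne_zero (pow_ne_zero 2 (sub_ne_zero.mpr hν.symm))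
        (pow_ne_zero 4 (sub_ne_zero.mpr hxy))
    refine eq_zero_of_eventually_punctured (F := fun z => gKK ν lam y s x z
          * (gPsiPsi k ν lam x z * gPhiPhi k ν lam x z - gPsiPhi k ν lam n x z ^ 2)
        - (z - y) * (gKPsi k ν lam m s x z ^ 2 * gPhiPhi k ν lam x z
          - 2 * gKPsi k ν lam m s x z * gKPhi k ν lam n m s x z * gPsiPhi k ν lam n x z
          + gKPhi k ν lam n m s x z ^ 2 * gPsiPsi k ν lam x z)
        - 4 * k ^ 4 * G ν lam x * ((1 - z ^ 2) * (ν * (z - s)))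
          / ((1 - ν) ^ 2 * (x - z) ^ 4)) (by fun_prop) ?_
    filter_upwards [(eventually_regular hxy hH).filter_mono nhdsWithin_le_nhds,
      self_mem_nhdsWithin] with z hz hzy
    exact sub_eq_zero.mpr
      (mul_left_cancel₀ (sub_ne_zero.mpr hzy) (h.det_frame_mul hz.1 hz.2))

theorem r_ne (h : IsHorizonData k ν lam r s n m a b) : r ≠ 0 := by
  rintro rfl
  simpa using h.mul_roots

/-- The next few lemmas express s, λ and the factors 1 ± λ + ν rationally through ν and r. In these
parameters the square root of the discriminant disappears. -/
theorem s_eq (h : IsHorizonData k ν lam r s n m a b) : s = 1 / (ν * r) := by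
  have := h.r_ne
  have := h.ν_ne_zero
  have := h.mul_roots
  field_simp
  linarith

theorem lam_eq (h : IsHorizonData k ν lam r s n m a b) : lam = -(ν * r ^ 2 + 1) / r := by
  have := h.r_ne
  have := h.ν_ne_zero
  rw [h.add_roots, h.s_eq]
  field_simp

theorem e_eq (h : IsHorizonData k ν lam r s n m a b) :
    1 - lam + ν = (1 + ν * r) * (1 + r) / r := by
  have := h.r_ne
  rw [h.lam_eq]
  field_simp
  ring

theorem ep_eq (h : IsHorizonData k ν lam r s n m a b) :
    1 + ν + lam = -((1 - ν * r) * (1 - r) / r) := by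
  have := h.r_ne
  rw [h.lam_eq]
  field_simp
  ring

theorem factors_ne (h : IsHorizonData k ν lam r s n m a b) :
    1 + ν * r ≠ 0 ∧ 1 + r ≠ 0 ∧ 1 - ν * r ≠ 0 ∧ 1 - r ≠ 0 ∧ ν * r ^ 2 + 1 ≠ 0 := by
  have h1 := h.e_ne
  have h2 := h.ep_ne
  have h3 := h.lam_ne
  rw [h.e_eq] at h1
  rw [h.ep_eq] at h2
  rw [h.lam_eq] at h3
  refine ⟨?_, ?_, ?_, ?_, ?_⟩ <;> intro h0 <;> simp [h0] at h1 h2 h3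

/-- This is constancy of the surface gravity: at y = r the numerator of g(K,K)/(y - r) is H(x,r)²
times a factor free of x. Since (y - r) g_yy carries the same dependence on x, their ratio is
constant along the horizon. -/
theorem kkNum_root (h : IsHorizonData k ν lam r s n m a b) (x : ℝ) :
    kkNum ν lam r s x r * ((1 - ν * r) * (1 + ν * r) * (ν * r ^ 2 + 1) ^ 2)
      = -((1 - ν) * (ν * r ^ 2 - 1) * r * H ν lam x r ^ 2) := by
  have hr := h.r_ne
  have hν := h.ν_ne_zero
  obtain ⟨-, -, -, -, hT⟩ := h.factors_ne
  rw [h.lam_eq, h.s_eq]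
  unfold kkNum kPsiNum kPhiNum zNum qNum wNum pNum H
  field_simp
  ring

end IsHorizonData

/-! ### Division by `y - r` -/

/-- `f(x,y) - f(x,r)` is `y - r` times an analytic function of `(x, y)`. -/
structure HasSlope (r : ℝ) (f : ℝ → ℝ → ℝ) : Prop where
  analytic : ∀ z : ℝ × ℝ, AnalyticAt ℝ (fun q : ℝ × ℝ => f q.1 q.2) z
  slope : ∃ g : ℝ → ℝ → ℝ, (∀ z : ℝ × ℝ, AnalyticAt ℝ (fun q : ℝ × ℝ => g q.1 q.2) z) ∧
    ∀ x y, f x y = f x r + (y - r) * g x y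

namespace HasSlope

variable {r : ℝ} {f g : ℝ → ℝ → ℝ}

theorem const (c : ℝ) : HasSlope r (fun _ _ => c) :=
  ⟨fun _ => analyticAt_const, fun _ _ => 0, fun _ => analyticAt_const, fun _ _ => by ring⟩

theorem fst : HasSlope r (fun x _ => x) :=
  ⟨fun _ => analyticAt_fst, fun _ _ => 0, fun _ => analyticAt_const, fun _ _ => by ring⟩

theorem snd : HasSlope r (fun _ y => y) :=
  ⟨fun _ => analyticAt_snd, fun _ _ => 1, fun _ => analyticAt_const, fun _ _ => by ring⟩

theorem neg (hf : HasSlope r f) : HasSlope r (fun x y => -f x y) := by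
  obtain ⟨hf, u, hu, hfu⟩ := hf
  refine ⟨fun z => (hf z).fun_neg, fun x y => -u x y, fun z => (hu z).fun_neg, fun x y => ?_⟩
  rw [hfu x y]; ring

theorem add (hf : HasSlope r f) (hg : HasSlope r g) : HasSlope r (fun x y => f x y + g x y) := by
  obtain ⟨hf, u, hu, hfu⟩ := hf
  obtain ⟨hg, v, hv, hgv⟩ := hg
  refine ⟨fun z => (hf z).fun_add (hg z), fun x y => u x y + v x y,
    fun z => (hu z).fun_add (hv z), fun x y => ?_⟩
  rw [hfu x y, hgv x y]; ring

theorem sub (hf : HasSlope r f) (hg : HasSlope r g) : HasSlope r (fun x y => f x y - g x y) := by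
  simpa only [sub_eq_add_neg] using hf.add hg.neg

theorem mul (hf : HasSlope r f) (hg : HasSlope r g) : HasSlope r (fun x y => f x y * g x y) := by
  obtain ⟨hf, u, hu, hfu⟩ := hf
  obtain ⟨hg, v, hv, hgv⟩ := hg
  -- Leibniz rule for difference quotients; the frozen factor f(x, r) is analytic as a composition
  -- with (x, y) ↦ (x, r).
  refine ⟨fun z => (hf z).fun_mul (hg z), fun x y => u x y * g x y + f x r * v x y,
    fun z => ((hu z).fun_mul (hg z)).fun_add (AnalyticAt.fun_mul ?_ (hv z)), fun x y => ?_⟩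
  · exact AnalyticAt.fun_comp (g := fun q : ℝ × ℝ => f q.1 q.2) (f := fun q : ℝ × ℝ => (q.1, r))
      (hf (z.1, r)) (analyticAt_fst.prod analyticAt_const)
  · linear_combination g x y * hfu x y + f x r * hgv x y

end HasSlope

theorem hasSlope_H (ν lam r : ℝ) : HasSlope r (fun x y => H ν lam x y) := by
  unfold H
  repeat' first
    | exact HasSlope.const _ | exact HasSlope.fst | exact HasSlope.snd | apply HasSlope.sub
    | apply HasSlope.add | apply HasSlope.mul

theorem hasSlope_kkNum (ν lam r s : ℝ) : HasSlope r (fun x y => kkNum ν lam r s x y) := by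
  unfold kkNum kPsiNum kPhiNum zNum qNum wNum pNum
  repeat' first
    | exact HasSlope.const _ | exact HasSlope.fst | exact HasSlope.snd | apply HasSlope.sub
    | apply HasSlope.add | apply HasSlope.mul | apply HasSlope.neg

/-- The value of `σ²` at the horizon `y = r`. -/
def sigmaSqAt (k ν r : ℝ) : ℝ :=
  (2 * k * (ν * r ^ 2 + 1) * (1 - ν * r) / ((1 - ν) * (ν * r ^ 2 - 1) * (1 + r))) ^ 2

/-- The numerator of `σ² g(K, K) / (y - r) + (y - r) g_yy`. -/
def radNum (k ν lam r s x y : ℝ) : ℝ :=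
  sigmaSqAt k ν r * ((1 - ν) * (1 - lam + ν)) * kkNum ν lam r s x y
      * ((1 - y ^ 2) * (ν * (y - s)))
    - 4 * (1 + ν + lam) * k ^ 2 * H ν lam x y ^ 2

theorem hasSlope_radNum (k ν lam r s : ℝ) : HasSlope r (fun x y => radNum k ν lam r s x y) := by
  have h1 := hasSlope_H ν lam r
  have h2 := hasSlope_kkNum ν lam r s
  unfold radNum
  repeat' first
    | assumption
    | exact HasSlope.const _ | exact HasSlope.fst | exact HasSlope.snd | apply HasSlope.sub
    | apply HasSlope.add | apply HasSlope.mul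

namespace IsHorizonData

variable {k ν lam r s n m a b : ℝ}

theorem sub_roots (h : IsHorizonData k ν lam r s n m a b) :
    ν * (r - s) = (ν * r ^ 2 - 1) / r := by
  have := h.r_ne
  have := h.ν_ne_zero
  rw [h.s_eq]
  field_simp

theorem disc_ne (h : IsHorizonData k ν lam r s n m a b) (hrs : r ≠ s) : ν * r ^ 2 - 1 ≠ 0 := by
  intro h0
  have := h.sub_roots
  rw [h0, zero_div] at this
  exact (mul_ne_zero h.ν_ne_zero (sub_ne_zero.mpr hrs)) this

theorem sigmaSqAt_pos (h : IsHorizonData k ν lam r s n m a b) (hrs : r ≠ s) :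
    0 < sigmaSqAt k ν r := by
  obtain ⟨-, h2, h3, -, h5⟩ := h.factors_ne
  have hν : 1 - ν ≠ 0 := sub_ne_zero.mpr h.ν_ne.symm
  have hd := h.disc_ne hrs
  have hk := h.k_ne
  unfold sigmaSqAt
  positivity

/-- Both terms of `radNum` are x-independent multiples of H(x,r)² at y = r, and `sigmaSqAt` is the
ratio that makes them cancel. -/
theorem radNum_root (h : IsHorizonData k ν lam r s n m a b) (hrs : r ≠ s) (x : ℝ) :
    radNum k ν lam r s x r = 0 := by
  obtain ⟨h1, h2, h3, h4, h5⟩ := h.factors_ne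
  have hν : 1 - ν ≠ 0 := sub_ne_zero.mpr h.ν_ne.symm
  have hd := h.disc_ne hrs
  have hk := h.k_ne
  have hr := h.r_ne
  have hkk : kkNum ν lam r s x r = -((1 - ν) * (ν * r ^ 2 - 1) * r * H ν lam x r ^ 2)
      / ((1 - ν * r) * (1 + ν * r) * (ν * r ^ 2 + 1) ^ 2) := by
    rw [eq_div_iff (by positivity), h.kkNum_root x]
  unfold radNum sigmaSqAt
  rw [hkk, h.sub_roots, h.e_eq, h.ep_eq]
  field_simp
  ring

theorem radNum_div (h : IsHorizonData k ν lam r s n m a b) {x y : ℝ} (hxy : x ≠ y)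
    (hH : H ν lam x y ≠ 0) (h1 : y ^ 2 ≠ 1) (hs : y ≠ s) :
    sigmaSqAt k ν r * gKK ν lam r s x y + gRad k ν lam s x y
      = radNum k ν lam r s x y
        / (2 * (1 + ν + lam) * den ν lam x y * ((1 - y ^ 2) * (ν * (y - s)))) := by
  have hν : 1 - ν ≠ 0 := sub_ne_zero.mpr h.ν_ne.symm
  have hep := h.ep_ne
  have hν0 := h.ν_ne_zero
  have h1' := one_sub_sq_ne_zero h1
  have hs' : y - s ≠ 0 := sub_ne_zero.mpr hs
  have hx : x - y ≠ 0 := sub_ne_zero.mpr hxy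
  unfold gKK gRad radNum den conf
  field_simp
  ring

/-- E is the function whose multiples v̂²E and û²E are the diagonal entries of the extended metric.
It must be jointly analytic in (x, y), at y = r too, which a pointwise quotient by y - r would not
provide. -/
theorem exists_radial_quotient (h : IsHorizonData k ν lam r s n m a b) (hrs : r ≠ s) :
    ∃ E : ℝ → ℝ → ℝ, ∀ x y, x ≠ y → H ν lam x y ≠ 0 → y ^ 2 ≠ 1 → y ≠ s →
      AnalyticAt ℝ (fun q : ℝ × ℝ => E q.1 q.2) (x, y) ∧
      sigmaSqAt k ν r * gKK ν lam r s x y + gRad k ν lam s x y = (y - r) * E x y := by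
  obtain ⟨-, g, hg, hfg⟩ := hasSlope_radNum k ν lam r s
  refine ⟨fun x y => g x y / (2 * (1 + ν + lam) * den ν lam x y * ((1 - y ^ 2) * (ν * (y - s)))),
    fun x y hxy hH h1 hs => ⟨?_, ?_⟩⟩
  · have hx : AnalyticAt ℝ (fun q : ℝ × ℝ => q.1) (x, y) := analyticAt_fst
    have hy : AnalyticAt ℝ (fun q : ℝ × ℝ => q.2) (x, y) := analyticAt_snd
    refine AnalyticAt.fun_div (hg _) (AnalyticAt.fun_mul (AnalyticAt.fun_mul analyticAt_const
      (analyticAt_den hx hy)) ?_) ?_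
    · exact (analyticAt_const.fun_sub (hy.fun_pow 2)).fun_mul
        (analyticAt_const.fun_mul (hy.fun_sub analyticAt_const))
    · exact mul_ne_zero (mul_ne_zero (mul_ne_zero two_ne_zero h.ep_ne)
        (den_ne_zero h.ν_ne hxy hH)) (mul_ne_zero (one_sub_sq_ne_zero h1)
          (mul_ne_zero h.ν_ne_zero (sub_ne_zero.mpr hs)))
  · rw [h.radNum_div hxy hH h1 hs, hfg x y, h.radNum_root hrs]
    ring

end IsHorizonData

/-! ### Jacobians of the changes of coordinates -/

/-- The differential of the `j`-th coordinate. -/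
abbrev coordD (j : Fin 5) : Coords →L[ℝ] ℝ := ContinuousLinearMap.proj j

theorem hasFDerivAt_coord (j : Fin 5) (p : Coords) :
    HasFDerivAt (fun q : Coords => q j) (coordD j) p := hasFDerivAt_apply j p

theorem analyticAt_coord (j : Fin 5) (p : Coords) : AnalyticAt ℝ (fun q : Coords => q j) p :=
  (coordD j).analyticAt p

theorem jac_eq {Φ : Coords → Coords} {p : Coords} {A : Mat5}
    (h : ∀ i, HasFDerivAt (fun q => Φ q i) (∑ j, A i j • coordD j) p) : jac Φ p = A := by
  have h1 : HasFDerivAt Φ (ContinuousLinearMap.pi fun i => ∑ j, A i j • coordD j) p :=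
    hasFDerivAt_pi.2 h
  unfold jac
  rw [h1.fderiv]
  ext i j
  simp [LinearMap.toMatrix'_apply, Pi.single_apply]

/-- All the charts first pass to ψ - at and φ - bt. That shift cancels against the one in the
adapted form of the metric, leaving only the change U of the remaining coordinates. -/
theorem newComponents_eq {Φ : Coords → Coords} {g : Coords → Mat5} {p : Coords} {U U' h : Mat5}
    {a b : ℝ} (hjac : jac Φ p = U * shift a b) (hU : U * U' = 1)
    (hg : g p = (shift a b)ᵀ * h * shift a b) : newComponents Φ g p = U'ᵀ * h * U' := by
  have hinv : (jac Φ p)⁻¹ = shift (-a) (-b) * U' := by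
    refine Matrix.inv_eq_right_inv ?_
    rw [hjac, Matrix.mul_assoc, ← Matrix.mul_assoc (shift a b), shift_mul_shift, Matrix.one_mul, hU]
  have h2 : shift a b * (shift (-a) (-b) * U') = U' := by
    rw [← Matrix.mul_assoc, shift_mul_shift, Matrix.one_mul]
  unfold newComponents
  rw [hinv, hg]
  calc _ = (shift a b * (shift (-a) (-b) * U'))ᵀ * h * (shift a b * (shift (-a) (-b) * U')) := by
        rw [Matrix.transpose_mul (shift a b)]; simp only [Matrix.mul_assoc]
    _ = _ := by rw [h2]

/-- The Jacobian of `(t, y) ↦ (u, v)`. -/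
def uvMat (σ w : ℝ) : Mat5 :=
  !![1, σ / w, 0, 0, 0;
     1, -(σ / w), 0, 0, 0;
     0, 0, 1, 0, 0;
     0, 0, 0, 1, 0;
     0, 0, 0, 0, 1]

def uvInv (σ w : ℝ) : Mat5 :=
  !![1 / 2, 1 / 2, 0, 0, 0;
     w / (2 * σ), -(w / (2 * σ)), 0, 0, 0;
     0, 0, 1, 0, 0;
     0, 0, 0, 1, 0;
     0, 0, 0, 0, 1]

theorem uvMat_mul_uvInv {σ w : ℝ} (hσ : σ ≠ 0) (hw : w ≠ 0) : uvMat σ w * uvInv σ w = 1 := by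
  ext i j
  fin_cases i <;> fin_cases j <;> simp [uvMat, uvInv, Matrix.mul_apply, Fin.sum_univ_five] <;>
    field_simp <;> norm_num

theorem hasFDerivAt_log_sub {p : Coords} {r : ℝ} (hp : p 1 ≠ r) :
    HasFDerivAt (fun q : Coords => Real.log (q 1 - r)) ((1 / (p 1 - r)) • coordD 1) p := by
  rw [one_div]
  exact ((hasFDerivAt_coord 1 p).sub_const r).log (sub_ne_zero.mpr hp)

theorem jac_uvChart {σ a b r : ℝ} {p : Coords} (hp : p 1 ≠ r) :
    jac (uvChart σ a b r) p = uvMat σ (p 1 - r) * shift a b := by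
  have hlog := hasFDerivAt_log_sub hp
  refine jac_eq fun i => ?_
  fin_cases i
  · refine ((hasFDerivAt_coord 0 p).add (hlog.const_mul σ)).congr_fderiv ?_
    ext v
    simp [uvMat, shift, Matrix.mul_apply, Fin.sum_univ_five]; ring
  · refine ((hasFDerivAt_coord 0 p).sub (hlog.const_mul σ)).congr_fderiv ?_
    ext v
    simp [uvMat, shift, Matrix.mul_apply, Fin.sum_univ_five]; ring
  · refine ((hasFDerivAt_coord 2 p).sub ((hasFDerivAt_coord 0 p).const_mul a)).congr_fderiv ?_
    ext v
    simp [uvMat, shift, Matrix.mul_apply, Fin.sum_univ_five]; ring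
  · refine ((hasFDerivAt_coord 3 p).sub ((hasFDerivAt_coord 0 p).const_mul b)).congr_fderiv ?_
    ext v
    simp [uvMat, shift, Matrix.mul_apply, Fin.sum_univ_five]; ring
  · refine (hasFDerivAt_coord 4 p).congr_fderiv ?_
    ext v
    simp [uvMat, shift, Matrix.mul_apply, Fin.sum_univ_five]

/-- The Jacobian of `(t, y) ↦ (û, v̂)`. -/
def ksMat (γ w u v : ℝ) : Mat5 :=
  !![γ * u, u / (2 * w), 0, 0, 0;
     -(γ * v), v / (2 * w), 0, 0, 0;
     0, 0, 1, 0, 0;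
     0, 0, 0, 1, 0;
     0, 0, 0, 0, 1]

/-- Off the horizon the sign is locally constant, so it behaves as a constant when the chart is
differentiated. -/
theorem eventually_sign_eq {p : Coords} {r : ℝ} (hp : p 1 ≠ r) :
    ∀ᶠ q : Coords in 𝓝 p, Real.sign (q 1 - r) = Real.sign (p 1 - r) := by
  have hc : ContinuousAt (fun q : Coords => q 1 - r) p :=
    ((continuous_apply 1).sub continuous_const).continuousAt
  rcases lt_or_gt_of_ne (sub_ne_zero.mpr hp) with h | h
  · filter_upwards [hc.eventually_lt_const h] with q hq
    rw [Real.sign_of_neg h, Real.sign_of_neg hq]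
  · filter_upwards [hc.eventually_const_lt h] with q hq
    rw [Real.sign_of_pos h, Real.sign_of_pos hq]

theorem jac_ksChart {ε σ a b r : ℝ} (hσ : σ ≠ 0) {p : Coords} (hp : p 1 ≠ r) :
    jac (ksChart ε σ a b r) p = ksMat (1 / (2 * σ)) (p 1 - r) (ksChart ε σ a b r p 0)
      (ksChart ε σ a b r p 1) * shift a b := by
  have hlog := hasFDerivAt_log_sub hp
  have hw : p 1 - r ≠ 0 := sub_ne_zero.mpr hp
  refine jac_eq fun i => ?_
  fin_cases i
  · refine ((((hasFDerivAt_coord 0 p).add (hlog.const_mul σ)).const_mul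
      (1 / (2 * σ))).exp.const_mul ε).congr_fderiv ?_
    ext v
    simp [ksMat, shift, ksChart, uvChart, Matrix.mul_apply, Fin.sum_univ_five]
    field_simp
  · refine HasFDerivAt.congr_fderiv (f' := (ε * Real.sign (p 1 - r)) • _)
      (((((hasFDerivAt_coord 0 p).sub (hlog.const_mul σ)).const_mul
      (-(1 / (2 * σ)))).exp.const_mul (ε * Real.sign (p 1 - r))).congr_of_eventuallyEq ?_) ?_
    · filter_upwards [eventually_sign_eq hp] with q hq
      simp [ksChart, uvChart, hq]
    · ext v
      simp [ksMat, shift, ksChart, uvChart, Matrix.mul_apply, Fin.sum_univ_five]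
      field_simp
      ring
  · refine ((hasFDerivAt_coord 2 p).sub ((hasFDerivAt_coord 0 p).const_mul a)).congr_fderiv ?_
    ext v
    simp [ksMat, shift, Matrix.mul_apply, Fin.sum_univ_five]; ring
  · refine ((hasFDerivAt_coord 3 p).sub ((hasFDerivAt_coord 0 p).const_mul b)).congr_fderiv ?_
    ext v
    simp [ksMat, shift, Matrix.mul_apply, Fin.sum_univ_five]; ring
  · refine (hasFDerivAt_coord 4 p).congr_fderiv ?_
    ext v
    simp [ksMat, shift, Matrix.mul_apply, Fin.sum_univ_five]

/-- The Jacobian of the coordinates used at the degenerate horizon. -/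
def degMat (a₀ a₁ bψ bφ w : ℝ) : Mat5 :=
  !![1, -(a₀ / w ^ 2 + a₁ / w), 0, 0, 0;
     0, 1, 0, 0, 0;
     0, -(bψ / w), 1, 0, 0;
     0, -(bφ / w), 0, 1, 0;
     0, 0, 0, 0, 1]

theorem degMat_mul_neg (a₀ a₁ bψ bφ w : ℝ) :
    degMat a₀ a₁ bψ bφ w * degMat (-a₀) (-a₁) (-bψ) (-bφ) w = 1 := by
  ext i j
  fin_cases i <;> fin_cases j <;> simp [degMat, Matrix.mul_apply, Fin.sum_univ_five] <;> ring

theorem jac_degChart {k ν a₀ a₁ bψ bφ : ℝ} {p : Coords} (hp : p 1 ≠ y0 ν) :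
    jac (degChart k ν a₀ a₁ bψ bφ) p
      = degMat a₀ a₁ bψ bφ (p 1 - y0 ν) * shift (aPsi k ν) (aPhi k ν) := by
  have hlog := hasFDerivAt_log_sub hp
  have hw : p 1 - y0 ν ≠ 0 := sub_ne_zero.mpr hp
  have hinv : HasFDerivAt (fun q : Coords => a₀ / (q 1 - y0 ν))
      (-(a₀ / (p 1 - y0 ν) ^ 2) • coordD 1) p := by
    refine (((hasDerivAt_inv hw).comp_hasFDerivAt p
      ((hasFDerivAt_coord 1 p).sub_const (y0 ν))).const_mul a₀).congr_fderiv ?_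
    ext v
    simp; ring
  refine jac_eq fun i => ?_
  fin_cases i
  · refine (((hasFDerivAt_coord 0 p).add hinv).sub (hlog.const_mul a₁)).congr_fderiv ?_
    ext v
    simp [degMat, shift, Matrix.mul_apply, Fin.sum_univ_five]; ring
  · refine (hasFDerivAt_coord 1 p).congr_fderiv ?_
    ext v
    simp [degMat, shift, Matrix.mul_apply, Fin.sum_univ_five]
  · refine (((hasFDerivAt_coord 2 p).sub ((hasFDerivAt_coord 0 p).const_mul _)).sub
      (hlog.const_mul bψ)).congr_fderiv ?_
    ext v
    simp [degMat, shift, Matrix.mul_apply, Fin.sum_univ_five]; ring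
  · refine (((hasFDerivAt_coord 3 p).sub ((hasFDerivAt_coord 0 p).const_mul _)).sub
      (hlog.const_mul bφ)).congr_fderiv ?_
    ext v
    simp [degMat, shift, Matrix.mul_apply, Fin.sum_univ_five]; ring
  · refine (hasFDerivAt_coord 4 p).congr_fderiv ?_
    ext v
    simp [degMat, shift, Matrix.mul_apply, Fin.sum_univ_five]

/-! ### Non-degenerate horizons -/

theorem eventually_quadratic_ne {α β γ : ℝ} (h : α ≠ 0 ∨ β ≠ 0 ∨ γ ≠ 0) (r : ℝ) :
    ∀ᶠ y in 𝓝[≠] r, α * y ^ 2 + β * y + γ ≠ 0 := by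
  have hp : (Polynomial.C α * Polynomial.X ^ 2 + Polynomial.C β * Polynomial.X
      + Polynomial.C γ : Polynomial ℝ) ≠ 0 := by
    intro h0
    have h2 := congrArg (fun p => p.coeff 2) h0
    have h1 := congrArg (fun p => p.coeff 1) h0
    have h3 := congrArg (fun p => p.coeff 0) h0
    simp at h1 h2 h3
    rcases h with h | h | h <;> contradiction
  have hfin := (Polynomial.finite_setOfPred_isRoot hp).to_subtype
  filter_upwards [nhdsNE_of_nhdsNE_sdiff_finite (x := r) univ_mem hfin] with y hy h0
  exact hy.2 (by simpa [Polynomial.IsRoot] using h0)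

/-- The original line element makes sense near the horizon only if H(y,x) has no zeros accumulating
there. It is quadratic in y: vanishing of the linear coefficient forces νx = ±1, and then the other
two coefficients force λ = 0. -/
theorem eventually_H_swap_ne {ν lam : ℝ} (hl : lam ≠ 0) (he : 1 - lam + ν ≠ 0)
    (hep : 1 + ν + lam ≠ 0) (x r : ℝ) :
    ∀ᶠ y in 𝓝[≠] r, H ν lam y x ≠ 0 := by
  have key : -(2 * ν * x * lam) + ν * (-lam ^ 2 - ν ^ 2 + 1) * x ^ 2 ≠ 0
      ∨ 2 * lam * (1 - ν ^ 2 * x ^ 2) ≠ 0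
      ∨ lam ^ 2 + 2 * ν * x * lam - ν ^ 2 + 1 ≠ 0 := by
    by_contra! hcon
    obtain ⟨h1, h2, h3⟩ := hcon
    have h4 : (1 - ν * x) * (1 + ν * x) = 0 := by
      have := (mul_eq_zero.mp h2).resolve_left (mul_ne_zero two_ne_zero hl)
      linear_combination this
    rcases mul_eq_zero.mp h4 with hx | hx
    · have hx' : ν * x = 1 := by linarith
      have e1 : (lam + 1 - ν) * (1 + ν + lam) = 0 := by
        linear_combination h3 - 2 * lam * hx'
      have e2 : (lam + ν - 1) * (1 + ν + lam) = 0 := by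
        linear_combination -ν * h1 + (-2 * ν * lam + (-lam ^ 2 - ν ^ 2 + 1) * (ν * x + 1)) * hx'
      have e3 := (mul_eq_zero.mp e1).resolve_right hep
      have e4 := (mul_eq_zero.mp e2).resolve_right hep
      exact hl (by linarith)
    · have hx' : ν * x = -1 := by linarith
      have e1 : (lam - 1 + ν) * (1 - lam + ν) = 0 := by
        linear_combination -h3 + 2 * lam * hx'
      have e2 : (lam - ν + 1) * (1 - lam + ν) = 0 := by
        linear_combination ν * h1 + (2 * ν * lam - (-lam ^ 2 - ν ^ 2 + 1) * (ν * x - 1)) * hx'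
      have e3 := (mul_eq_zero.mp e1).resolve_right he
      have e4 := (mul_eq_zero.mp e2).resolve_right he
      exact hl (by linarith)
  filter_upwards [eventually_quadratic_ne key r] with y hy
  convert hy using 1
  unfold H; ring

/-- The components in the coordinates `(u, v)` that must vanish at the horizon. -/
theorem uv_entries {σ : ℝ} (hσ : σ ≠ 0) {i j : Fin 5} (hi : i ∈ ({0, 1} : Set (Fin 5)))
    (hj : j ∈ ({0, 1, 2, 3} : Set (Fin 5))) :
    ∃ c₁ c₂ c₃ c₄ : ℝ, ∀ w A B C₁ C₂ q₁ q₂ q₃ X : ℝ, w ≠ 0 →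
      ((uvInv σ w)ᵀ * blockMat (w * A) (w * C₁) (w * C₂) q₁ q₂ q₃ (B / w) X * uvInv σ w) i j
        = w * (c₁ * A + c₂ * B + c₃ * C₁ + c₄ * C₂) := by
  have h00 : ∀ w A B C₁ C₂ q₁ q₂ q₃ X : ℝ, w ≠ 0 → ∀ i ∈ ({0, 1} : Set (Fin 5)),
      ((uvInv σ w)ᵀ * blockMat (w * A) (w * C₁) (w * C₂) q₁ q₂ q₃ (B / w) X * uvInv σ w) i 2
        = w * (0 * A + 0 * B + 1 / 2 * C₁ + 0 * C₂) ∧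
      ((uvInv σ w)ᵀ * blockMat (w * A) (w * C₁) (w * C₂) q₁ q₂ q₃ (B / w) X * uvInv σ w) i 3
        = w * (0 * A + 0 * B + 0 * C₁ + 1 / 2 * C₂) := by
    rintro w A B C₁ C₂ q₁ q₂ q₃ X hw i (rfl | rfl) <;> constructor <;>
      simp [uvInv, blockMat, Matrix.mul_apply, Fin.sum_univ_five] <;> ring
  rcases hj with rfl | rfl | rfl | rfl
  · rcases hi with rfl | rfl
    · refine ⟨1 / 4, 1 / (4 * σ ^ 2), 0, 0, fun w A B C₁ C₂ q₁ q₂ q₃ X hw => ?_⟩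
      simp [uvInv, blockMat, Matrix.mul_apply, Fin.sum_univ_five]
      field_simp
      ring
    · refine ⟨1 / 4, -(1 / (4 * σ ^ 2)), 0, 0, fun w A B C₁ C₂ q₁ q₂ q₃ X hw => ?_⟩
      simp [uvInv, blockMat, Matrix.mul_apply, Fin.sum_univ_five]
      field_simp
      ring
  · rcases hi with rfl | rfl
    · refine ⟨1 / 4, -(1 / (4 * σ ^ 2)), 0, 0, fun w A B C₁ C₂ q₁ q₂ q₃ X hw => ?_⟩
      simp [uvInv, blockMat, Matrix.mul_apply, Fin.sum_univ_five]
      field_simp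
      ring
    · refine ⟨1 / 4, 1 / (4 * σ ^ 2), 0, 0, fun w A B C₁ C₂ q₁ q₂ q₃ X hw => ?_⟩
      simp [uvInv, blockMat, Matrix.mul_apply, Fin.sum_univ_five]
      field_simp
      ring
  · exact ⟨0, 0, 1 / 2, 0, fun w A B C₁ C₂ q₁ q₂ q₃ X hw => (h00 w A B C₁ C₂ q₁ q₂ q₃ X hw i hi).1⟩
  · exact ⟨0, 0, 0, 1 / 2, fun w A B C₁ C₂ q₁ q₂ q₃ X hw => (h00 w A B C₁ C₂ q₁ q₂ q₃ X hw i hi).2⟩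

theorem uv_entry_zero_zero {σ w : ℝ} (hσ : σ ≠ 0) (hw : w ≠ 0) (A B C₁ C₂ q₁ q₂ q₃ X : ℝ) :
    ((uvInv σ w)ᵀ * blockMat (w * A) (w * C₁) (w * C₂) q₁ q₂ q₃ (B / w) X * uvInv σ w) 0 0
      = w * ((σ ^ 2 * A + B) / (4 * σ ^ 2)) := by
  simp [uvInv, blockMat, Matrix.mul_apply, Fin.sum_univ_five]
  field_simp
  ring

theorem isBigO_sq_iff {F : ℝ → ℝ} {r : ℝ} (hF : DifferentiableAt ℝ F r) :
    (fun y => (y - r) * F y) =O[𝓝[≠] r] (fun y => (y - r) ^ 2) ↔ F r = 0 := by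
  have hne : ∀ᶠ y in 𝓝[≠] r, y - r ≠ 0 := by
    filter_upwards [self_mem_nhdsWithin] with y hy using sub_ne_zero.mpr hy
  constructor
  · intro h
    have h1 : F =O[𝓝[≠] r] (fun y => y - r) := by
      have h2 := (isBigO_refl (fun y : ℝ => (y - r)⁻¹) (𝓝[≠] r)).mul h
      refine (h2.congr' ?_ ?_)
      · filter_upwards [hne] with y hy
        field_simp
      · filter_upwards [hne] with y hy
        field_simp
    have h3 : Tendsto (fun y : ℝ => y - r) (𝓝[≠] r) (𝓝 0) := by
      have : Tendsto (fun y : ℝ => y - r) (𝓝 r) (𝓝 (r - r)) :=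
        (continuous_id.sub continuous_const).tendsto r
      rw [sub_self] at this
      exact this.mono_left nhdsWithin_le_nhds
    exact tendsto_nhds_unique (hF.continuousAt.tendsto.mono_left nhdsWithin_le_nhds)
      (h1.trans_tendsto h3)
  · intro h0
    have h1 : F =O[𝓝 r] (fun y => y - r) := by simpa [h0] using hF.isBigO_sub
    have h2 := (isBigO_refl (fun y : ℝ => y - r) (𝓝[≠] r)).mul (h1.mono nhdsWithin_le_nhds)
    simpa only [sq] using h2

namespace IsHorizonData

variable {k ν lam r s n m a b : ℝ}

theorem root_sq_ne (h : IsHorizonData k ν lam r s n m a b) : r ^ 2 ≠ 1 := by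
  obtain ⟨-, h2, -, h4, -⟩ := h.factors_ne
  intro h0
  have : (1 + r) * (1 - r) = 0 := by linear_combination -h0
  exact (mul_ne_zero h2 h4) this

/-- The metric in the adapted frame, near the horizon. -/
theorem eventually_metric_eq (h : IsHorizonData k ν lam r s n m a b) {t ψ φ x : ℝ} (hxr : x ≠ r)
    (hH : H ν lam x r ≠ 0) :
    ∀ᶠ y in 𝓝[≠] r, metric k ν lam ![t, y, ψ, φ, x] = (shift a b)ᵀ
      * blockMat ((y - r) * gKK ν lam r s x y) ((y - r) * gKPsi k ν lam m s x y)
        ((y - r) * gKPhi k ν lam n m s x y) (gPsiPsi k ν lam x y) (gPsiPhi k ν lam n x y)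
        (gPhiPhi k ν lam x y) (gRad k ν lam s x y / (y - r)) (conf k ν lam x y / G ν lam x)
      * shift a b := by
  filter_upwards [(eventually_regular hxr hH).filter_mono nhdsWithin_le_nhds,
    eventually_H_swap_ne h.lam_ne h.e_ne h.ep_ne x r] with y h1 h2
  exact h.metric_eq (p := ![t, y, ψ, φ, x]) h1.1 h1.2 h2

theorem uv_behaviour (h : IsHorizonData k ν lam r s n m a b) (hrs : r ≠ s) {σ : ℝ} (hσ : σ ≠ 0)
    {t ψ φ x : ℝ} (hxr : x ≠ r) (hH : H ν lam x r ≠ 0) :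
    (∀ i ∈ ({0, 1} : Set (Fin 5)), ∀ j ∈ ({0, 1, 2, 3} : Set (Fin 5)),
      Tendsto (fun y => newComponents (uvChart σ a b r) (metric k ν lam) ![t, y, ψ, φ, x] i j)
        (𝓝[≠] r) (𝓝 0)) ∧
    ((fun y => newComponents (uvChart σ a b r) (metric k ν lam) ![t, y, ψ, φ, x] 0 0)
        =O[𝓝[≠] r] (fun y => (y - r) ^ 2) ↔ σ ^ 2 = sigmaSqAt k ν r) := by
  have hx : AnalyticAt ℝ (fun _ : ℝ => x) r := by fun_prop
  have hy : AnalyticAt ℝ (fun z : ℝ => z) r := by fun_prop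
  have a1 := analyticAt_gKK (r := r) (s := s) h.ep_ne h.ν_ne hx hy hxr hH
  have a2 := analyticAt_gKPsi (k := k) (s := s) h.m_pos.ne' h.ν_ne hx hy hxr hH
  have a3 := analyticAt_gKPhi (k := k) (n := n) (s := s) h.lam_ne h.m_pos.ne' h.ν_ne hx hy hxr hH
  have a4 := analyticAt_gRad (k := k) (lam := lam) h.ν_ne_zero h.ν_ne hx hy hxr h.root_sq_ne hrs
  have hnew : ∀ᶠ y in 𝓝[≠] r, newComponents (uvChart σ a b r) (metric k ν lam) ![t, y, ψ, φ, x]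
      = (uvInv σ (y - r))ᵀ * blockMat ((y - r) * gKK ν lam r s x y)
        ((y - r) * gKPsi k ν lam m s x y)
        ((y - r) * gKPhi k ν lam n m s x y) (gPsiPsi k ν lam x y) (gPsiPhi k ν lam n x y)
        (gPhiPhi k ν lam x y) (gRad k ν lam s x y / (y - r)) (conf k ν lam x y / G ν lam x)
        * uvInv σ (y - r) := by
    filter_upwards [h.eventually_metric_eq (t := t) (ψ := ψ) (φ := φ) hxr hH,
      self_mem_nhdsWithin] with y hm hyr
    exact newComponents_eq (jac_uvChart hyr) (uvMat_mul_uvInv hσ (sub_ne_zero.mpr hyr)) hm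
  refine ⟨fun i hi j hj => ?_, ?_⟩
  · obtain ⟨c₁, c₂, c₃, c₄, hc⟩ := uv_entries hσ hi hj
    have hcont : ContinuousAt (fun y => (y - r) * (c₁ * gKK ν lam r s x y
        + c₂ * gRad k ν lam s x y + c₃ * gKPsi k ν lam m s x y
        + c₄ * gKPhi k ν lam n m s x y)) r := by
      have := a1.continuousAt
      have := a2.continuousAt
      have := a3.continuousAt
      have := a4.continuousAt
      fun_prop
    have hlim := hcont.tendsto.mono_left (nhdsWithin_le_nhds (s := {r}ᶜ))
    simp only [sub_self, zero_mul] at hlim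
    refine hlim.congr' ?_
    filter_upwards [hnew, self_mem_nhdsWithin] with y hy hyr
    rw [hy, hc _ _ _ _ _ _ _ _ _ (sub_ne_zero.mpr hyr)]
  · have hd : DifferentiableAt ℝ (fun y => (σ ^ 2 * gKK ν lam r s x y + gRad k ν lam s x y)
        / (4 * σ ^ 2)) r := by
      have := a1.differentiableAt
      have := a4.differentiableAt
      fun_prop
    have hcongr : (fun y => newComponents (uvChart σ a b r) (metric k ν lam)
        ![t, y, ψ, φ, x] 0 0) =ᶠ[𝓝[≠] r] fun y => (y - r)
          * ((σ ^ 2 * gKK ν lam r s x y + gRad k ν lam s x y) / (4 * σ ^ 2)) := by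
      filter_upwards [hnew, self_mem_nhdsWithin] with y hy hyr
      rw [hy, uv_entry_zero_zero hσ (sub_ne_zero.mpr hyr)]
    rw [isBigO_congr hcongr (EventuallyEq.refl _ _), isBigO_sq_iff hd]
    -- The combination σ²A + B vanishes at y = r for σ² = `sigmaSqAt k ν r`. Since B ≠ 0 there, also
    -- A ≠ 0, so no other value of σ² works.
    have h1 := h.radNum_div (y := r) hxr hH h.root_sq_ne hrs
    rw [h.radNum_root hrs, zero_div] at h1
    have hB : gRad k ν lam s x r ≠ 0 := by
      unfold gRad conf
      have := h.ν_ne_zero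
      have := h.k_ne
      have : 1 - ν ≠ 0 := sub_ne_zero.mpr h.ν_ne.symm
      have := sub_ne_zero.mpr hrs
      have := sub_ne_zero.mpr hxr
      have := one_sub_sq_ne_zero h.root_sq_ne
      simp only [ne_eq, neg_eq_zero]
      positivity
    have hA : gKK ν lam r s x r ≠ 0 := by
      intro h0
      rw [h0, mul_zero, zero_add] at h1
      exact hB h1
    rw [div_eq_zero_iff, or_iff_left (by positivity)]
    constructor
    · intro h2
      exact mul_right_cancel₀ hA (by linarith)
    · rintro h2
      rw [h2, h1]

end IsHorizonData

/-! ### Extension across a non-degenerate horizon -/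

/-- The extended metric in the coordinates `(û, v̂, ψ̂, φ̂, x)`. -/
def ksExtMat (σ A B C₁ C₂ E q₁ q₂ q₃ X u v : ℝ) : Mat5 :=
  !![v ^ 2 * E, B - σ ^ 2 * A, σ * v * C₁, σ * v * C₂, 0;
     B - σ ^ 2 * A, u ^ 2 * E, -(σ * u * C₁), -(σ * u * C₂), 0;
     σ * v * C₁, -(σ * u * C₁), q₁, q₂, 0;
     σ * v * C₂, -(σ * u * C₂), q₂, q₃, 0;
     0, 0, 0, 0, X]

theorem ksExtMat_isSymm (σ A B C₁ C₂ E q₁ q₂ q₃ X u v : ℝ) :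
    (ksExtMat σ A B C₁ C₂ E q₁ q₂ q₃ X u v).IsSymm := by
  ext i j
  fin_cases i <;> fin_cases j <;> rfl

theorem analyticAt_ksExtMat {F : Type*} [NormedAddCommGroup F] [NormedSpace ℝ F] {σ : ℝ} {p : F}
    {A B C₁ C₂ E q₁ q₂ q₃ X u v : F → ℝ} (hA : AnalyticAt ℝ A p) (hB : AnalyticAt ℝ B p)
    (hC₁ : AnalyticAt ℝ C₁ p) (hC₂ : AnalyticAt ℝ C₂ p) (hE : AnalyticAt ℝ E p)
    (hq₁ : AnalyticAt ℝ q₁ p) (hq₂ : AnalyticAt ℝ q₂ p) (hq₃ : AnalyticAt ℝ q₃ p)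
    (hX : AnalyticAt ℝ X p) (hu : AnalyticAt ℝ u p) (hv : AnalyticAt ℝ v p) (i j : Fin 5) :
    AnalyticAt ℝ (fun z => ksExtMat σ (A z) (B z) (C₁ z) (C₂ z) (E z) (q₁ z) (q₂ z) (q₃ z) (X z)
      (u z) (v z) i j) p := by
  fin_cases i <;> fin_cases j <;>
    simp only [ksExtMat, Fin.zero_eta, Fin.mk_one, Fin.reduceFinMk, Matrix.of_apply,
      Matrix.cons_val', Matrix.cons_val_zero, Matrix.cons_val_one, Matrix.cons_val,
      Matrix.cons_val_fin_one] <;> fun_prop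

/-- The relation `hE` removes E: (uvE)² - (B - σ²A)² = 4σ²AB and uvE + B - σ²A = 2B. The second
factor is then the left side of `IsHorizonData.det_frame`. -/
theorem det_ksExtMat {σ A B E u v : ℝ} (hE : σ ^ 2 * A + B = u * v * E)
    (C₁ C₂ q₁ q₂ q₃ X : ℝ) :
    (ksExtMat σ A B C₁ C₂ E q₁ q₂ q₃ X u v).det = 4 * σ ^ 2 * X * B
      * (A * (q₁ * q₃ - q₂ ^ 2)
        - u * v * (C₁ ^ 2 * q₃ - 2 * C₁ * C₂ * q₂ + C₂ ^ 2 * q₁)) := by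
  have h1 : (ksExtMat σ A B C₁ C₂ E q₁ q₂ q₃ X u v).det
      = X * ((q₁ * q₃ - q₂ ^ 2) * ((u * v * E) ^ 2 - (B - σ ^ 2 * A) ^ 2)
        - 2 * (u * v) * σ ^ 2 * (u * v * E + B - σ ^ 2 * A)
          * (C₁ ^ 2 * q₃ - 2 * C₁ * C₂ * q₂ + C₂ ^ 2 * q₁)) := by
    simp [ksExtMat, Matrix.det_succ_row_zero, Fin.sum_univ_succ, Fin.succAbove]
    ring
  rw [h1, ← hE]
  ring

/-- Here dt = σ(du/u - dv/v) and dy = v du + u dv, so du² has coefficient w(σ²A + B)/u² = v²E, du dv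
receives B - σ²A as matrix entry, and wC dt becomes σC(v du - u dv). -/
theorem ksMat_pullback {σ w u v A B E : ℝ} (hσ : σ ≠ 0) (hw : w ≠ 0) (huv : u * v = w)
    (hE : σ ^ 2 * A + B = w * E) (C₁ C₂ q₁ q₂ q₃ X : ℝ) :
    (ksMat (1 / (2 * σ)) w u v)ᵀ * ksExtMat σ A B C₁ C₂ E q₁ q₂ q₃ X u v
        * ksMat (1 / (2 * σ)) w u v
      = blockMat (w * A) (w * C₁) (w * C₂) q₁ q₂ q₃ (B / w) X := by
  have hu : u ≠ 0 := by rintro rfl; simp at huv; exact hw huv.symm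
  obtain rfl : v = w / u := by field_simp; linarith
  obtain rfl : E = (σ ^ 2 * A + B) / w := by field_simp; linarith
  ext i j
  fin_cases i <;> fin_cases j <;>
    simp [ksMat, ksExtMat, blockMat, Matrix.mul_apply, Fin.sum_univ_five] <;> field_simp <;> ring

theorem analyticAt_log_of_ne {E : Type*} [NormedAddCommGroup E] [NormedSpace ℝ E] {f : E → ℝ}
    {p : E} (hf : AnalyticAt ℝ f p) (h0 : f p ≠ 0) :
    AnalyticAt ℝ (fun q => Real.log (f q)) p := by
  rcases lt_or_gt_of_ne h0 with h | h
  · have := AnalyticAt.fun_comp (g := Real.log) (f := fun q => -f q)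
      (analyticAt_log (by linarith)) hf.fun_neg
    simpa only [Real.log_neg_eq_log] using this
  · exact (analyticAt_log h).fun_comp hf

theorem ksChart_mul {ε σ a b r : ℝ} (hε : ε = 1 ∨ ε = -1) (hσ : σ ≠ 0) {p : Coords}
    (hp : p 1 ≠ r) : ksChart ε σ a b r p 0 * ksChart ε σ a b r p 1 = p 1 - r := by
  have hw : p 1 - r ≠ 0 := sub_ne_zero.mpr hp
  have hε2 : ε ^ 2 = 1 := by rcases hε with rfl | rfl <;> norm_num
  have h1 : Real.exp (1 / (2 * σ) * (p 0 + σ * Real.log (p 1 - r)))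
      * Real.exp (-(1 / (2 * σ)) * (p 0 - σ * Real.log (p 1 - r))) = |p 1 - r| := by
    rw [← Real.exp_add, ← Real.exp_log_eq_abs hw]
    congr 1
    field_simp
    ring
  have h2 : Real.sign (p 1 - r) * |p 1 - r| = p 1 - r := by
    rcases lt_or_gt_of_ne hw with h | h
    · rw [Real.sign_of_neg h, abs_of_neg h]; ring
    · rw [Real.sign_of_pos h, abs_of_pos h]; ring
  calc ksChart ε σ a b r p 0 * ksChart ε σ a b r p 1
      = ε ^ 2 * (Real.sign (p 1 - r)
        * (Real.exp (1 / (2 * σ) * (p 0 + σ * Real.log (p 1 - r)))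
          * Real.exp (-(1 / (2 * σ)) * (p 0 - σ * Real.log (p 1 - r))))) := by
        simp only [ksChart, uvChart, Matrix.cons_val_zero, Matrix.cons_val_one]; ring
    _ = p 1 - r := by rw [h1, h2, hε2, one_mul]

theorem analyticAt_ksChart {ε σ a b r : ℝ} {p : Coords} (hp : p 1 ≠ r) :
    AnalyticAt ℝ (ksChart ε σ a b r) p := by
  have h0 := analyticAt_coord 0 p
  have hlog : AnalyticAt ℝ (fun q : Coords => Real.log (q 1 - r)) p :=
    analyticAt_log_of_ne ((analyticAt_coord 1 p).fun_sub analyticAt_const) (sub_ne_zero.mpr hp)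
  refine AnalyticAt.pi fun i => ?_
  fin_cases i
  · exact analyticAt_const.fun_mul (analyticAt_const.fun_mul
      (h0.fun_add (analyticAt_const.fun_mul hlog))).rexp'
  · have h1 : AnalyticAt ℝ (fun q : Coords => ε * Real.sign (p 1 - r)
        * Real.exp (-(1 / (2 * σ)) * (q 0 - σ * Real.log (q 1 - r)))) p :=
      analyticAt_const.fun_mul (analyticAt_const.fun_mul
        (h0.fun_sub (analyticAt_const.fun_mul hlog))).rexp'
    refine h1.congr ?_
    filter_upwards [eventually_sign_eq hp] with q hq
    simp [ksChart, uvChart, hq]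
  · exact (analyticAt_coord 2 p).fun_sub (analyticAt_const.fun_mul h0)
  · exact (analyticAt_coord 3 p).fun_sub (analyticAt_const.fun_mul h0)
  · exact analyticAt_coord 4 p

/-- The product ûv̂ recovers y, after which û recovers t and the remaining coordinates follow. -/
theorem ksChart_injOn {ε σ a b r : ℝ} (hε : ε = 1 ∨ ε = -1) (hσ : σ ≠ 0) :
    Set.InjOn (ksChart ε σ a b r) {p | p 1 ≠ r} := by
  intro p hp q hq hpq
  have hε0 : ε ≠ 0 := by rcases hε with rfl | rfl <;> norm_num
  have h1 : p 1 = q 1 := by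
    have hp' := ksChart_mul (a := a) (b := b) hε hσ hp
    have hq' := ksChart_mul (a := a) (b := b) hε hσ hq
    rw [hpq, hq'] at hp'
    linarith
  have h0 : p 0 = q 0 := by
    have e := congrFun hpq 0
    simp only [ksChart, uvChart, Matrix.cons_val_zero] at e
    have e1 := mul_left_cancel₀ (by positivity) (Real.exp_injective (mul_left_cancel₀ hε0 e))
    rw [h1] at e1
    linarith
  have h2 : p 2 = q 2 := by
    have e : p 2 - a * p 0 = q 2 - a * q 0 := congrFun hpq 2
    rw [h0] at e
    linarith
  have h3 : p 3 = q 3 := by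
    have e : p 3 - b * p 0 = q 3 - b * q 0 := congrFun hpq 3
    rw [h0] at e
    linarith
  have h4 : p 4 = q 4 := congrFun hpq 4
  ext i
  fin_cases i <;> assumption

/-- The domain of the extension across `y = r`, where `s` is the other root. -/
def extDomain (ν lam r s : ℝ) : Set Coords :=
  {p | G ν lam (p 4) ≠ 0 ∧ p 4 ≠ ksY r p ∧ ksY r p ^ 2 ≠ 1 ∧ ksY r p ≠ s ∧
    H ν lam (p 4) (ksY r p) ≠ 0}

theorem continuous_H {X : Type*} [TopologicalSpace X] {f g : X → ℝ} (ν lam : ℝ)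
    (hf : Continuous f) (hg : Continuous g) : Continuous fun p => H ν lam (f p) (g p) := by
  unfold H; fun_prop

theorem continuous_G {X : Type*} [TopologicalSpace X] {f : X → ℝ} (ν lam : ℝ)
    (hf : Continuous f) : Continuous fun p => G ν lam (f p) := by
  unfold G; fun_prop

theorem isOpen_extDomain (ν lam r s : ℝ) : IsOpen (extDomain ν lam r s) := by
  have hx : Continuous fun p : Coords => p 4 := continuous_apply 4
  have hy : Continuous fun p : Coords => ksY r p := by unfold ksY; fun_prop
  exact (isOpen_ne_fun (continuous_G ν lam hx) continuous_const).inter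
    ((isOpen_ne_fun hx hy).inter ((isOpen_ne_fun (hy.pow 2) continuous_const).inter
      ((isOpen_ne_fun hy continuous_const).inter
        (isOpen_ne_fun (continuous_H ν lam hx hy) continuous_const))))

namespace IsHorizonData

variable {k ν lam r s n m a b : ℝ}

theorem ne_roots (h : IsHorizonData k ν lam r s n m a b) {y : ℝ} (hy : G ν lam y ≠ 0) :
    y ^ 2 ≠ 1 ∧ y ≠ r ∧ y ≠ s := by
  unfold G at hy
  rw [h.quadratic] at hy
  refine ⟨?_, ?_, ?_⟩ <;> intro h0 <;> simp [h0] at hy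

theorem exists_extension (h : IsHorizonData k ν lam r s n m a b) (hrs : r ≠ s) {σ : ℝ}
    (hσ : σ ^ 2 = sigmaSqAt k ν r) :
    ∃ gExt : Coords → Mat5, IsAnalyticMetricOn gExt (extDomain ν lam r s) ∧
      (∀ p q, p 0 = q 0 → p 1 = q 1 → p 4 = q 4 → gExt p = gExt q) ∧
      (∀ p ∈ extDomain ν lam r s, (gExt p).det =
        -(64 * k ^ 8 * σ ^ 2 * H ν lam (p 4) (ksY r p) ^ 2)
          / ((1 - ν) ^ 6 * (p 4 - ksY r p) ^ 8)) ∧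
      ∀ ε : ℝ, ε = 1 ∨ ε = -1 → IsIsometricEmbeddingOn (ksChart ε σ a b r)
        (domain ν lam) (metric k ν lam) (extDomain ν lam r s) gExt := by
  have hσ0 : σ ≠ 0 := by
    rintro rfl
    have := h.sigmaSqAt_pos hrs
    rw [← hσ] at this
    simp at this
  obtain ⟨E, hE⟩ := h.exists_radial_quotient hrs
  rw [← hσ] at hE
  have hν : 1 - ν ≠ 0 := sub_ne_zero.mpr h.ν_ne.symm
  have hdet : ∀ p ∈ extDomain ν lam r s, (ksExtMat σ (gKK ν lam r s (p 4) (ksY r p))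
      (gRad k ν lam s (p 4) (ksY r p)) (gKPsi k ν lam m s (p 4) (ksY r p))
      (gKPhi k ν lam n m s (p 4) (ksY r p)) (E (p 4) (ksY r p)) (gPsiPsi k ν lam (p 4) (ksY r p))
      (gPsiPhi k ν lam n (p 4) (ksY r p)) (gPhiPhi k ν lam (p 4) (ksY r p))
      (conf k ν lam (p 4) (ksY r p) / G ν lam (p 4)) (p 0) (p 1)).det
      = -(64 * k ^ 8 * σ ^ 2 * H ν lam (p 4) (ksY r p) ^ 2)
          / ((1 - ν) ^ 6 * (p 4 - ksY r p) ^ 8) := by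
    rintro p ⟨hG, hxy, h1, hs, hH⟩
    have huv : p 0 * p 1 = ksY r p - r := by unfold ksY; ring
    rw [det_ksExtMat (by rw [(hE _ _ hxy hH h1 hs).2, huv]), huv, h.det_frame hxy hH]
    have h1' := one_sub_sq_ne_zero h1
    have hs' := sub_ne_zero.mpr hs
    have hx' := sub_ne_zero.mpr hxy
    have hν0 := h.ν_ne_zero
    unfold gRad conf
    field_simp
    ring
  -- The extended metric is the matrix field displayed in `hdet`.
  refine ⟨_, ⟨isOpen_extDomain ν lam r s, ?_, fun p _ => ksExtMat_isSymm _ _ _ _ _ _ _ _ _ _ _ _,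
    fun p hp => ?_⟩, fun p q h0 h1 h4 => ?_, hdet, fun ε hε => ⟨?_, ?_, ?_, ?_⟩⟩
  · rintro i j p ⟨hG, hxy, h1, hs, hH⟩
    have hx := analyticAt_coord 4 p
    have hu := analyticAt_coord 0 p
    have hv := analyticAt_coord 1 p
    have hy : AnalyticAt ℝ (fun p => ksY r p) p := analyticAt_const.fun_add (hu.fun_mul hv)
    have hG' : AnalyticAt ℝ (fun p : Coords => G ν lam (p 4)) p :=
      analyticAt_G analyticAt_const analyticAt_const hx
    have a1 := analyticAt_gKK (r := r) (s := s) h.ep_ne h.ν_ne hx hy hxy hH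
    have a2 := analyticAt_gKPsi (k := k) (s := s) h.m_pos.ne' h.ν_ne hx hy hxy hH
    have a3 := analyticAt_gKPhi (k := k) (n := n) (s := s) h.lam_ne h.m_pos.ne' h.ν_ne hx hy hxy hH
    have a4 := analyticAt_gRad (k := k) (lam := lam) h.ν_ne_zero h.ν_ne hx hy hxy h1 hs
    have a5 := analyticAt_gPsiPsi (k := k) h.e_ne h.ν_ne hx hy hxy hH
    have a6 := analyticAt_gPsiPhi (k := k) (n := n) h.ν_ne hx hy hxy hH
    have a7 := analyticAt_gPhiPhi (k := k) h.ν_ne hx hy hxy hH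
    have a8 := (analyticAt_conf (k := k) (lam := lam) h.ν_ne hx hy hxy).fun_div hG' hG
    have a9 : AnalyticAt ℝ (fun p => E (p 4) (ksY r p)) p :=
      AnalyticAt.fun_comp (g := fun q : ℝ × ℝ => E q.1 q.2) (f := fun p => (p 4, ksY r p))
        (hE _ _ hxy hH h1 hs).1 (hx.prod hy)
    exact analyticAt_ksExtMat a1 a4 a2 a3 a9 a5 a6 a7 a8 hu hv i j
  · rw [hdet p hp]
    obtain ⟨-, hxy, -, -, hH⟩ := hp
    have hk := h.k_ne
    have hx' := sub_ne_zero.mpr hxy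
    exact div_ne_zero (neg_ne_zero.mpr (by positivity)) (by positivity)
  · simp only [ksY, h0, h1, h4]
  · exact fun p hp => analyticAt_ksChart (h.ne_roots hp.2.1).2.1
  · exact (ksChart_injOn hε hσ0).mono fun p hp => (h.ne_roots hp.2.1).2.1
  · rintro p ⟨hG, hG', hxy, hH, -⟩
    obtain ⟨h1, hr, hs⟩ := h.ne_roots hG'
    have hy : ksY r (ksChart ε σ a b r p) = p 1 := by
      unfold ksY; rw [ksChart_mul hε hσ0 hr]; ring
    have h4 : ksChart ε σ a b r p 4 = p 4 := rfl
    refine ⟨?_, ?_, ?_, ?_, ?_⟩ <;> simp only [hy, h4] <;> assumption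
  · rintro p ⟨hG, hG', hxy, hH, hH'⟩
    obtain ⟨h1, hr, hs⟩ := h.ne_roots hG'
    have huv := ksChart_mul (a := a) (b := b) hε hσ0 hr
    have hy : ksY r (ksChart ε σ a b r p) = p 1 := by
      unfold ksY; rw [huv]; ring
    have h4 : ksChart ε σ a b r p 4 = p 4 := rfl
    rw [jac_ksChart hσ0 hr, hy, h4, h.metric_eq hxy hH hH',
      ← ksMat_pullback hσ0 (sub_ne_zero.mpr hr) huv (hE _ _ hxy hH h1 hs).2,
      Matrix.transpose_mul]
    simp only [Matrix.mul_assoc]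

end IsHorizonData

/-! ### The parameters of the two horizons -/

/-- Only q² is prescribed: the two signs of q interchange the roots, so both horizons are handled at
once. -/
theorem isHorizonData_of_sq {k ν lam q : ℝ} (hk : k ≠ 0) (hν : 0 < ν) (hν1 : ν ≠ 1)
    (hl : |lam| < 1 + ν) (hl0 : lam ≠ 0) (hq : q ^ 2 = lam ^ 2 - 4 * ν) :
    IsHorizonData k ν lam (-(lam - q) / (2 * ν)) (-(lam + q) / (2 * ν)) √ν
      √((1 + ν) ^ 2 - lam ^ 2) (aConst k ν lam)
      (((ν - 1) * q + lam * (1 + ν)) * (1 + ν - lam)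
        / (4 * k * lam * √(ν * ((1 + ν) ^ 2 - lam ^ 2)))) := by
  obtain ⟨h1, h2⟩ := abs_lt.mp hl
  have he : 0 < 1 - lam + ν := by linarith
  have hep : 0 < 1 + ν + lam := by linarith
  have hpos : 0 < (1 + ν) ^ 2 - lam ^ 2 := by nlinarith
  have hn : 0 < √ν := Real.sqrt_pos.mpr hν
  have hm : 0 < √((1 + ν) ^ 2 - lam ^ 2) := Real.sqrt_pos.mpr hpos
  have hn2 : √ν ^ 2 = ν := Real.sq_sqrt hν.le
  refine ⟨hk, hν1, hl0, hn, hn2, hm, ?_, he.ne', ?_, ?_, rfl, ?_⟩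
  · rw [Real.sq_sqrt hpos.le]; ring
  · field_simp; linear_combination -hq
  · field_simp; ring
  · unfold aConst
    rw [Real.sqrt_mul hν.le]
    field_simp
    rw [hn2]
    ring

/-- The stated formula for σ² is not visibly a square. The link is that (1 - νr)/(1 + r) is
proportional to λ(1 - ν) + q(1 + ν), whose square is twice the bracket in the formula. -/
theorem sigmaSqAt_of_sq {k ν lam q : ℝ} (hν : 0 < ν) (hν1 : ν ≠ 1)
    (hl : |lam| < 1 + ν) (hl0 : lam ≠ 0) (hq : q ^ 2 = lam ^ 2 - 4 * ν) (hq0 : q ≠ 0) :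
    sigmaSqAt k ν (-(lam - q) / (2 * ν)) = 2 * k ^ 2 * lam ^ 2 *
        (lam ^ 2 * (ν ^ 2 + 1) - lam * (ν ^ 2 - 1) * q - 2 * ν * (ν + 1) ^ 2)
      / ((ν - 1) ^ 2 * (lam ^ 2 - 4 * ν) * (-lam + ν + 1) ^ 2) := by
  have h := isHorizonData_of_sq one_ne_zero hν hν1 hl hl0 hq
  have hr := h.r_ne
  have he := h.e_ne
  have hν1' : 1 - ν ≠ 0 := sub_ne_zero.mpr hν1.symm
  have hν2' : ν - 1 ≠ 0 := sub_ne_zero.mpr hν1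
  have he' : -lam + ν + 1 ≠ 0 := by convert he using 1; ring
  set r := -(lam - q) / (2 * ν) with hrdef
  have hq' : q = 2 * ν * r + lam := by rw [hrdef]; field_simp; ring
  clear_value r
  have h1 : ν * r ^ 2 + 1 = -(lam * r) := by
    linear_combination h.quadratic r
  have h2 : ν * r ^ 2 - 1 = r * q := by rw [hq']; linear_combination -h1
  have h3 : 1 + r ≠ 0 := h.factors_ne.2.1
  have h4 : (1 - ν * r) / (1 + r) = -(lam * (1 - ν) + q * (1 + ν)) / (2 * (1 - lam + ν)) := by
    field_simp
    rw [hq']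
    linear_combination (2 + 2 * ν) * h1
  have h5 : sigmaSqAt k ν r = (2 * k * lam / ((1 - ν) * q) * ((1 - ν * r) / (1 + r))) ^ 2 := by
    unfold sigmaSqAt
    rw [h1, h2]
    field_simp
  have h6 : (lam * (1 - ν) + q * (1 + ν)) ^ 2
      = 2 * (lam ^ 2 * (ν ^ 2 + 1) - lam * (ν ^ 2 - 1) * q - 2 * ν * (ν + 1) ^ 2) := by
    linear_combination (1 + ν) ^ 2 * hq
  rw [h5, h4, ← hq, mul_pow, div_pow (-_), neg_sq, h6, show 1 - lam + ν = -lam + ν + 1 by ring,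
    show 1 - ν = -(ν - 1) by ring]
  field_simp

namespace Horizon

/-- The signed square root of the discriminant for which the horizon is the upper root. -/
def disc (ν lam : ℝ) : Horizon → ℝ
  | h => √(lam ^ 2 - 4 * ν)
  | c => -√(lam ^ 2 - 4 * ν)

variable {k ν lam : ℝ}

theorem disc_sq (hl : 4 * ν < lam ^ 2) (hor : Horizon) :
    hor.disc ν lam ^ 2 = lam ^ 2 - 4 * ν := by
  have := Real.sq_sqrt (sub_pos.mpr hl).le
  cases hor <;> simpa [disc] using this

theorem disc_ne_zero (hl : 4 * ν < lam ^ 2) (hor : Horizon) : hor.disc ν lam ≠ 0 := by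
  have := Real.sqrt_pos.mpr (sub_pos.mpr hl)
  cases hor <;> simp only [disc, ne_eq, neg_eq_zero] <;> exact this.ne'

theorem root_eq (hor : Horizon) : hor.root ν lam = -(lam - hor.disc ν lam) / (2 * ν) := by
  cases hor <;> simp [root, disc, yh, yc]

theorem otherRoot_eq (hor : Horizon) :
    hor.otherRoot ν lam = -(lam + hor.disc ν lam) / (2 * ν) := by
  cases hor <;> simp [otherRoot, disc, yh, yc, sub_eq_add_neg]

theorem root_ne_otherRoot (hν : 0 < ν) (hl : 4 * ν < lam ^ 2) (hor : Horizon) :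
    hor.root ν lam ≠ hor.otherRoot ν lam := by
  rw [root_eq, otherRoot_eq]
  intro h
  field_simp at h
  exact hor.disc_ne_zero hl (by linarith)

theorem b_eq (hor : Horizon) : hor.b k ν lam = ((ν - 1) * hor.disc ν lam + lam * (1 + ν))
    * (1 + ν - lam) / (4 * k * lam * √(ν * ((1 + ν) ^ 2 - lam ^ 2))) := by
  cases hor
  · rfl
  · simp only [b, disc]; ring

theorem sigmaSq_eq (hor : Horizon) : hor.sigmaSq k ν lam = 2 * k ^ 2 * lam ^ 2 *
        (lam ^ 2 * (ν ^ 2 + 1) - lam * (ν ^ 2 - 1) * hor.disc ν lam - 2 * ν * (ν + 1) ^ 2)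
      / ((ν - 1) ^ 2 * (lam ^ 2 - 4 * ν) * (-lam + ν + 1) ^ 2) := by
  cases hor
  · rfl
  · simp only [sigmaSq, disc]; ring

theorem isHorizonData (hk : k ≠ 0) (hν : 0 < ν) (hν1 : ν ≠ 1) (hl : |lam| < 1 + ν)
    (hd : 4 * ν < lam ^ 2) (hor : Horizon) :
    IsHorizonData k ν lam (hor.root ν lam) (hor.otherRoot ν lam) √ν √((1 + ν) ^ 2 - lam ^ 2)
      (aConst k ν lam) (hor.b k ν lam) := by
  rw [root_eq, otherRoot_eq, b_eq]
  refine isHorizonData_of_sq hk hν hν1 hl ?_ (hor.disc_sq hd)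
  rintro rfl
  linarith

theorem sigmaSq_eq_sigmaSqAt (hν : 0 < ν) (hν1 : ν ≠ 1) (hl : |lam| < 1 + ν)
    (hd : 4 * ν < lam ^ 2) (hor : Horizon) :
    hor.sigmaSq k ν lam = sigmaSqAt k ν (hor.root ν lam) := by
  rw [root_eq, sigmaSq_eq, sigmaSqAt_of_sq hν hν1 hl ?_ (hor.disc_sq hd) (hor.disc_ne_zero hd)]
  rintro rfl
  linarith

end Horizon

/-! ### The neighbourhood of the horizon covered by the extension -/

/-- With R = -r, the discriminant is a positive multiple of (1 - ν)(1 - νR⁴). For νR⁴ > 1 it is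
negative; for νR⁴ ≤ 1 the expansion around x = -1 has nonnegative coefficients and positive constant
term. -/
theorem horizon_quadratic_pos {ν r x : ℝ} (hν : 0 < ν) (hν1 : ν < 1) (hr : r < -1) (hx : -1 ≤ x) :
    0 < x ^ 2 * ν * r ^ 2 * (r ^ 2 + 1) - 2 * x * r * (ν * r ^ 2 + 1) + r ^ 2 + 1 := by
  obtain ⟨R, rfl⟩ : ∃ R, r = -R := ⟨-r, by ring⟩
  obtain ⟨X, rfl⟩ : ∃ X, x = X - 1 := ⟨x + 1, by ring⟩
  have hR : 0 < R - 1 := by linarith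
  have hR0 : 0 < R := by linarith
  have hX : 0 ≤ X := by linarith
  rcases le_or_gt (ν * R ^ 4) 1 with h | h
  · have h1 : 0 ≤ (1 - ν * R ^ 3) + ν * R * (R - 1) := by
      have h2 : ν * R ^ 3 ≤ 1 := by
        have : ν * R ^ 3 * 1 ≤ ν * R ^ 3 * R := by gcongr; linarith
        linarith
      have : 0 ≤ ν * R * (R - 1) := by positivity
      linarith
    have h3 : 0 < (R - 1) ^ 2 * (1 + ν * R ^ 2)
        + X * (2 * R * ((1 - ν * R ^ 3) + ν * R * (R - 1)))
        + X ^ 2 * (ν * R ^ 2 * (R ^ 2 + 1)) := by positivity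
    linarith
  · have h1 : 0 < ν * R ^ 2 * (R ^ 2 + 1) := by positivity
    -- Completed square: this is the quadratic multiplied by its leading coefficient.
    have h2 : 0 < (ν * R ^ 2 * (R ^ 2 + 1) * (X - 1) + R * (ν * R ^ 2 + 1)) ^ 2
        + R ^ 2 * ((1 - ν) * (ν * R ^ 4 - 1)) := by
      have : 0 < (1 - ν) * (ν * R ^ 4 - 1) := mul_pos (by linarith) (by linarith)
      positivity
    refine pos_of_mul_pos_right (a := ν * R ^ 2 * (R ^ 2 + 1)) ?_ h1.le
    linarith

/-- The conditions are open in (x, y) and hold on the compact segment [-1, 1] × {r}, hence on a tube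
around it. -/
theorem exists_uniform_neighbourhood {ν lam r s : ℝ} (hr : r < -1) (hrs : r ≠ s)
    (hH : ∀ x ∈ Set.Icc (-1 : ℝ) 1, H ν lam x r ≠ 0) :
    ∃ δ > 0, ∀ x y, |x| < 1 → |y - r| < δ → x ≠ y ∧ y ^ 2 ≠ 1 ∧ y ≠ s ∧ H ν lam x y ≠ 0 := by
  have hev : ∀ᶠ y in 𝓝 r, ∀ x ∈ Set.Icc (-1 : ℝ) 1,
      x ≠ y ∧ y ^ 2 ≠ 1 ∧ y ≠ s ∧ H ν lam x y ≠ 0 := by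
    refine isCompact_Icc.eventually_forall_of_forall_eventually fun x hx => ?_
    have c1 : ContinuousAt (fun z : ℝ × ℝ => H ν lam z.2 z.1) (r, x) :=
      (continuous_H ν lam continuous_snd continuous_fst).continuousAt
    have c2 : ContinuousAt (fun z : ℝ × ℝ => z.2 - z.1) (r, x) := by fun_prop
    have c3 : ContinuousAt (fun z : ℝ × ℝ => z.1 ^ 2) (r, x) := by fun_prop
    have c4 : ContinuousAt (fun z : ℝ × ℝ => z.1) (r, x) := by fun_prop
    filter_upwards [c1.eventually_ne (hH x hx),
      c2.eventually_ne (y := 0) (by have := hx.1; intro h0; simp at h0; linarith),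
      c3.eventually_ne (y := 1) (by simp only; nlinarith), c4.eventually_ne hrs] with z h1 h2 h3 h4
    exact ⟨sub_ne_zero.mp h2, h3, h4, h1⟩
  obtain ⟨δ, hδ, h⟩ := Metric.eventually_nhds_iff.mp hev
  exact ⟨δ, hδ, fun x y hx hy => h (by rwa [Real.dist_eq]) x
    ⟨(abs_lt.mp hx).1.le, (abs_lt.mp hx).2.le⟩⟩

namespace IsHorizonData

variable {k ν lam r s n m a b : ℝ}

theorem H_root_mul (h : IsHorizonData k ν lam r s n m a b) (x : ℝ) :
    H ν lam x r * r ^ 2 = (1 - ν * r) * (1 + ν * r)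
      * (x ^ 2 * ν * r ^ 2 * (r ^ 2 + 1) - 2 * x * r * (ν * r ^ 2 + 1) + r ^ 2 + 1) := by
  have := h.r_ne
  rw [h.lam_eq]
  unfold H
  field_simp
  ring

theorem H_root_ne (h : IsHorizonData k ν lam r s n m a b) (hν1 : ν < 1) (hr : r < -1) {x : ℝ}
    (hx : -1 ≤ x) : H ν lam x r ≠ 0 := by
  have hν : 0 < ν := by rw [← h.n_sq]; exact pow_pos h.n_pos 2
  have h1 := h.H_root_mul x
  have h2 := horizon_quadratic_pos hν hν1 hr hx
  obtain ⟨f1, -, f3, -, -⟩ := h.factors_ne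
  intro h0
  rw [h0, zero_mul] at h1
  exact mul_ne_zero (mul_ne_zero f3 f1) h2.ne' h1.symm

/-- The sum -λ/ν is negative and the product 1/ν exceeds 1, so both roots are negative. As (1 + r)(1
+ s) = (1 - λ + ν)/ν > 0, they lie on the same side of -1, and both in (-1, 0) would give a product
below 1. -/
theorem roots_lt (h : IsHorizonData k ν lam r s n m a b) (hν1 : ν < 1) (hl : 0 < lam)
    (hl1 : lam < 1 + ν) : r < -1 ∧ s < -1 := by
  have hν : 0 < ν := by rw [← h.n_sq]; exact pow_pos h.n_pos 2
  have h1 : 0 < r * s := pos_of_mul_pos_right (by rw [h.mul_roots]; norm_num) hν.le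
  have h2 : r + s < 0 := by
    have := h.add_roots
    by_contra! h0
    nlinarith
  have h3 : 0 < (1 + r) * (1 + s) := by
    refine pos_of_mul_pos_right (a := ν) ?_ hν.le
    have := h.add_roots
    have := h.mul_roots
    nlinarith
  have h4 : 1 < r * s := by
    have := h.mul_roots
    by_contra! h0
    nlinarith
  have hr0 : r < 0 := by
    by_contra! h0
    nlinarith
  have hs0 : s < 0 := by
    by_contra! h0
    nlinarith
  rcases pos_and_pos_or_neg_and_neg_of_mul_pos h3 with ⟨h5, h6⟩ | ⟨h5, h6⟩
  · nlinarith
  · exact ⟨by linarith, by linarith⟩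

theorem G_ne_zero (h : IsHorizonData k ν lam r s n m a b) (hr : r < -1) (hs : s < -1) {x : ℝ}
    (hx : |x| < 1) : G ν lam x ≠ 0 := by
  have := (abs_lt.mp hx).1
  unfold G
  rw [h.quadratic]
  refine mul_ne_zero ?_ (mul_ne_zero (mul_ne_zero h.ν_ne_zero ?_) ?_)
  · have := (sq_lt_one_iff_abs_lt_one x).mpr hx
    linarith
  · linarith
  · linarith

theorem exists_subset_extDomain (h : IsHorizonData k ν lam r s n m a b) (hrs : r ≠ s)
    (hν1 : ν < 1) (hl : 0 < lam) (hl1 : lam < 1 + ν) :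
    ∃ δ > 0, {p : Coords | |p 4| < 1 ∧ |p 0 * p 1| < δ} ⊆ extDomain ν lam r s := by
  obtain ⟨hr, hs⟩ := h.roots_lt hν1 hl hl1
  obtain ⟨δ, hδ, hU⟩ := exists_uniform_neighbourhood hr hrs
    fun x hx => h.H_root_ne hν1 hr hx.1
  refine ⟨δ, hδ, fun p hp => ?_⟩
  obtain ⟨h1, h2, h3, h4⟩ := hU (p 4) (ksY r p) hp.1 (by simpa [ksY] using hp.2)
  exact ⟨h.G_ne_zero hr hs hp.1, h1, h2, h3, h4⟩

end IsHorizonData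

/-! ### The degenerate horizon: regular components -/

/-- The reduced numerator of `g(K, K)` at the degenerate horizon. -/
def degKillKillNum (n x y : ℝ) : ℝ :=
    ((-n ^ 8 - 3 * n ^ 6 + 5 * n ^ 4 - n ^ 2) * x ^ 4 + (-6 * n ^ 7 + 12 * n ^ 5
    + 2 * n ^ 3) * x ^ 3 + (n ^ 8 + 7 * n ^ 6 + 19 * n ^ 4 - 3 * n ^ 2) * x ^ 2 + (6 * n ^ 7
    + 20 * n ^ 5 - 2 * n ^ 3) * x + 8 * n ^ 6) * y ^ 2 + ((2 * n ^ 7 - 12 * n ^ 5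
    + 2 * n ^ 3) * x ^ 4 + (-4 * n ^ 6 - 24 * n ^ 4 + 12 * n ^ 2) * x ^ 3 + (-2 * n ^ 7
    - 18 * n ^ 5 + 18 * n ^ 3 + 2 * n) * x ^ 2 + (-12 * n ^ 6 + 24 * n ^ 4 + 4 * n ^ 2) * x
    - 2 * n ^ 5 + 12 * n ^ 3 - 2 * n) * y - 8 * n ^ 2 * x ^ 4 + (2 * n ^ 5 - 20 * n ^ 3
    - 6 * n) * x ^ 3 + (3 * n ^ 6 - 19 * n ^ 4 - 7 * n ^ 2 - 1) * x ^ 2 + (-2 * n ^ 5 - 12 * n ^ 3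
    + 6 * n) * x + n ^ 6 - 5 * n ^ 4 + 3 * n ^ 2 + 1

/-- The coefficient of `y ^ 0` in the polynomial `degZZNum`. -/
def degZZCoeff0 (n x : ℝ) : ℝ :=
    (-8 * n ^ 8 - 16 * n ^ 6 - 8 * n ^ 4) * x ^ 4 + (2 * n ^ 11 - 44 * n ^ 7 - 48 * n ^ 5
    - 6 * n ^ 3) * x ^ 3 + (-n ^ 12 + 11 * n ^ 10 - 10 * n ^ 8 - 74 * n ^ 6 - 5 * n ^ 4
    - 17 * n ^ 2) * x ^ 2 + (-2 * n ^ 11 + 8 * n ^ 9 - 4 * n ^ 7 - 16 * n ^ 5 - 10 * n ^ 3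
    - 8 * n) * x - n ^ 10 + 3 * n ^ 8 + 6 * n ^ 6 - 2 * n ^ 4 - 5 * n ^ 2 - 1

/-- The coefficient of `y ^ 1` in the polynomial `degZZNum`. -/
def degZZCoeff1 (n x : ℝ) : ℝ :=
    (2 * n ^ 13 - 8 * n ^ 11 - 20 * n ^ 9 - 8 * n ^ 7 + 2 * n ^ 5) * x ^ 4 + (-24 * n ^ 10
    - 56 * n ^ 8 - 40 * n ^ 6 + 56 * n ^ 4) * x ^ 3 + (4 * n ^ 11 - 40 * n ^ 9 - 80 * n ^ 7
    + 72 * n ^ 5 + 44 * n ^ 3) * x ^ 2 + (8 * n ^ 10 - 40 * n ^ 8 + 40 * n ^ 6 + 40 * n ^ 4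
    + 16 * n ^ 2) * x + 10 * n ^ 9 - 16 * n ^ 7 + 36 * n ^ 5 + 2 * n

/-- The coefficient of `y ^ 2` in the polynomial `degZZNum`. -/
def degZZCoeff2 (n x : ℝ) : ℝ :=
    (-n ^ 14 - 5 * n ^ 12 + 6 * n ^ 10 + 30 * n ^ 8 - 5 * n ^ 6 + 7 * n ^ 4) * x ^ 4
    + (-8 * n ^ 13 - 10 * n ^ 11 + 56 * n ^ 9 + 76 * n ^ 7 + 16 * n ^ 5 - 2 * n ^ 3) * x ^ 3
    + (-9 * n ^ 12 - 9 * n ^ 10 + 106 * n ^ 8 + 138 * n ^ 6 - 33 * n ^ 4 - n ^ 2) * x ^ 2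
    + (-6 * n ^ 11 + 8 * n ^ 9 + 100 * n ^ 7 + 56 * n ^ 5 - 30 * n ^ 3) * x + 4 * n ^ 8
    + 36 * n ^ 6 - 4 * n ^ 4 - 4 * n ^ 2

/-- The coefficient of `y ^ 3` in the polynomial `degZZNum`. -/
def degZZCoeff3 (n x : ℝ) : ℝ :=
    (16 * n ^ 11 + 8 * n ^ 9 + 8 * n ^ 5) * x ^ 4 + (16 * n ^ 12 + 56 * n ^ 10 - 8 * n ^ 8
    + 8 * n ^ 6 - 8 * n ^ 4) * x ^ 3 + (40 * n ^ 11 + 72 * n ^ 9 - 72 * n ^ 7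
    - 40 * n ^ 5) * x ^ 2 + (40 * n ^ 10 + 8 * n ^ 8 - 104 * n ^ 6 - 8 * n ^ 4) * x + 8 * n ^ 7
    - 48 * n ^ 5 + 8 * n ^ 3

/-- The coefficient of `y ^ 4` in the polynomial `degZZNum`. -/
def degZZCoeff4 (n x : ℝ) : ℝ :=
    (-4 * n ^ 12 - 12 * n ^ 10 + 20 * n ^ 8 - 4 * n ^ 6) * x ^ 4 + (-32 * n ^ 11 - 8 * n ^ 9
    + 16 * n ^ 7 - 8 * n ^ 5) * x ^ 3 + (-8 * n ^ 12 - 36 * n ^ 10 - 44 * n ^ 8 - 12 * n ^ 6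
    + 4 * n ^ 4) * x ^ 2 + (-56 * n ^ 9 - 48 * n ^ 7 + 8 * n ^ 5) * x - 32 * n ^ 8

/-- The numerator of `g_zz` at the degenerate horizon. -/
def degZZNum (n x y : ℝ) : ℝ :=
    degZZCoeff4 n x * y ^ 4 + degZZCoeff3 n x * y ^ 3 + degZZCoeff2 n x * y ^ 2
    + degZZCoeff1 n x * y + degZZCoeff0 n x

/-- Here νr² = 1, so the right side of `IsHorizonData.kkNum_root` vanishes: the surface gravity is
zero and g(K,K) has a double zero. -/
theorem kkNum_degenerate {n : ℝ} (hn : n ≠ 0) (x y : ℝ) :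
    kkNum (n ^ 2) (2 * n) (-1 / n) (-1 / n) x y
      = (1 - n ^ 2) / 4 * ((y - -1 / n) * degKillKillNum n x y) := by
  unfold kkNum kPsiNum kPhiNum zNum qNum wNum pNum degKillKillNum
  field_simp
  ring

/-- The linear function proportional to `a₀ + a₁ (y - y₀)` for the admissible constants. -/
def degLin (n y : ℝ) : ℝ := (1 - n ^ 2) + (1 + n ^ 2) * (n * y + 1)

/-- For the admissible constants the left side is, up to regular factors, (z - y₀)² g_zz. Its double
zero is the regularity of g_zz, and `degZZNum` is the polynomial quotient. -/
theorem degZZNum_eq {n : ℝ} (hn : n ≠ 0) (x y : ℝ) :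
    (1 - y ^ 2) * n ^ 2 * (degLin n y ^ 2 * degKillKillNum n x y
        - 2 * degLin n y * (1 - n ^ 2) * ((1 - x ^ 2) * kPhiNum (n ^ 2) (2 * n) (-1 / n) x y)
        + (1 - n ^ 2) ^ 2 * ((1 - x ^ 2) * pNum (n ^ 2) (2 * n) x y))
        - (1 - n ^ 2) ^ 2 * H (n ^ 2) (2 * n) x y ^ 2
      = n ^ 2 * ((y - -1 / n) ^ 2 * degZZNum n x y) := by
  have h1 : kPhiNum (n ^ 2) (2 * n) (-1 / n) x y
      = n * (n * y + 1) * wNum (n ^ 2) (2 * n) x y + pNum (n ^ 2) (2 * n) x y := by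
    unfold kPhiNum
    field_simp
    ring
  have h2 : n ^ 2 * ((y - -1 / n) ^ 2 * degZZNum n x y) = (n * y + 1) ^ 2 * degZZNum n x y := by
    field_simp
    ring
  rw [h1, h2]
  unfold degLin wNum pNum degKillKillNum H degZZNum degZZCoeff0 degZZCoeff1 degZZCoeff2 degZZCoeff3
    degZZCoeff4
  ring

/-! ### Extension across the degenerate horizon -/

/-- `IsHorizonData` does not require r ≠ s, so the adapted frame is available at the double root.
With ν = n² and λ = 2n one has 1 - λ + ν = (1 - n)² and 1 + ν + λ = (1 + n)², whence m = 1 - n². -/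
theorem isHorizonData_degenerate {k n : ℝ} (hk : k ≠ 0) (hn : 0 < n) (hn1 : n < 1) :
    IsHorizonData k (n ^ 2) (2 * n) (-1 / n) (-1 / n) n (1 - n ^ 2) (aPsi k (n ^ 2))
      (aPhi k (n ^ 2)) := by
  have h1 : 0 < 1 - n := by linarith
  have h2 : 0 < 1 - n ^ 2 := by nlinarith
  have h3 : 1 + n ≠ 0 := by positivity
  refine ⟨hk, by linarith, by positivity, hn, rfl, h2, by ring, ?_, ?_, ?_, ?_, ?_⟩
  · have : (1 - n) ^ 2 ≠ 0 := by positivity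
    convert this using 1
    ring
  · field_simp
  · field_simp; ring
  · unfold aPsi
    rw [Real.sqrt_sq hn.le]
    field_simp
    ring
  · unfold aPsi aPhi
    rw [Real.sqrt_sq hn.le]
    field_simp
    ring

/-- `g(K, K) / (y - y₀)²`. -/
def degKK (n x y : ℝ) : ℝ := (1 - n) ^ 4 * degKillKillNum n x y / (8 * den (n ^ 2) (2 * n) x y)

/-- `(y - y₀)² g_yy`. -/
def degRad (k n x y : ℝ) : ℝ := -(conf k (n ^ 2) (2 * n) x y / ((1 - y ^ 2) * n ^ 2))

/-- `a₀ + a₁ (y - y₀)`, for the constants labelled by `s = 1`. -/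
def degShift (k n y : ℝ) : ℝ := 4 * k * degLin n y / ((1 - n) ^ 2 * (1 - n ^ 2))

/-- `g_zΨ`, for the constants labelled by `s = 1`. -/
def degZPsi (k n x y : ℝ) : ℝ :=
  2 * k ^ 2 * n ^ 2 * ((1 + y) * (2 * degLin n y * zNum (n ^ 2) (2 * n) x y
    - 2 * n * (1 + n ^ 2) * ((x - y) * (1 - x ^ 2)) * qNum (n ^ 2) (2 * n) x y))
    / ((1 - n ^ 2) * den (n ^ 2) (2 * n) x y)

/-- `g_zΦ`, for the constants labelled by `s = 1`. -/
def degZPhi (k n x y : ℝ) : ℝ :=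
  2 * k ^ 2 * n * ((1 - x ^ 2) * (n * degLin n y * wNum (n ^ 2) (2 * n) x y
    + (1 + n ^ 2) * pNum (n ^ 2) (2 * n) x y))
    / ((1 - n ^ 2) * den (n ^ 2) (2 * n) x y)

/-- `g_zz`. -/
def degZZ (k n x y : ℝ) : ℝ :=
  2 * k ^ 2 * degZZNum n x y / ((1 - n ^ 2) ^ 2 * (1 - y ^ 2) * den (n ^ 2) (2 * n) x y)

section Identities

variable {k n x y : ℝ}

theorem gKK_degenerate (hn : 0 < n) (hn1 : n < 1) (hxy : x ≠ y)
    (hH : H (n ^ 2) (2 * n) x y ≠ 0) :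
    gKK (n ^ 2) (2 * n) (-1 / n) (-1 / n) x y = (y - -1 / n) * degKK n x y := by
  have hν : n ^ 2 ≠ 1 := by nlinarith
  have hd := den_ne_zero hν hxy hH
  have h3 : 1 + n ≠ 0 := by positivity
  have h4 : 1 + n ^ 2 + 2 * n = (1 + n) ^ 2 := by ring
  have h5 : 1 - 2 * n + n ^ 2 = (1 - n) ^ 2 := by ring
  have h6 : 1 - n ^ 2 = (1 - n) * (1 + n) := by ring
  unfold gKK degKK
  rw [kkNum_degenerate hn.ne', h4, h5, h6]
  generalize y - -1 / n = w
  field_simp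
  ring

theorem gRad_degenerate (hn : 0 < n) (hy : y ≠ -1 / n) :
    gRad k (n ^ 2) (2 * n) (-1 / n) x y / (y - -1 / n) = degRad k n x y / (y - -1 / n) ^ 2 := by
  have hw : y - -1 / n ≠ 0 := sub_ne_zero.mpr hy
  unfold gRad degRad
  generalize y - -1 / n = w at *
  generalize conf k (n ^ 2) (2 * n) x y = c
  generalize 1 - y ^ 2 = e
  field_simp

/-- At y₀ the `zNum` part of `kPsiNum` drops out and the `qNum` part matches g_ψφ, so the numerator
of g_zΨ has a zero that cancels its pole. -/
theorem degZPsi_mul (hn : 0 < n) (hn1 : n < 1) (hxy : x ≠ y) (hH : H (n ^ 2) (2 * n) x y ≠ 0) :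
    (y - -1 / n) * degZPsi k n x y
      = gKPsi k (n ^ 2) (2 * n) (1 - n ^ 2) (-1 / n) x y * degShift k n y
        - gPsiPhi k (n ^ 2) (2 * n) n x y := by
  have hν : n ^ 2 ≠ 1 := by nlinarith
  have hd := den_ne_zero hν hxy hH
  have h1 : 1 - n ≠ 0 := by linarith
  have h2 : 1 - n ^ 2 ≠ 0 := sub_ne_zero.mpr hν.symm
  have h5 : 1 - 2 * n + n ^ 2 = (1 - n) ^ 2 := by ring
  have hw : n * y + 1 = n * (y - -1 / n) := by field_simp; ring
  have hl : degLin n y = (1 - n ^ 2) + (1 + n ^ 2) * (n * (y - -1 / n)) := by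
    unfold degLin; rw [hw]
  unfold degZPsi gKPsi degShift gPsiPhi kPsiNum psiPhiNum
  rw [h5, hl]
  generalize y - -1 / n = w at *
  generalize den (n ^ 2) (2 * n) x y = d at *
  generalize zNum (n ^ 2) (2 * n) x y = z
  generalize qNum (n ^ 2) (2 * n) x y = q
  field_simp
  ring

theorem degZPhi_mul (hn : 0 < n) (hn1 : n < 1) (hxy : x ≠ y) (hH : H (n ^ 2) (2 * n) x y ≠ 0) :
    (y - -1 / n) * degZPhi k n x y
      = gKPhi k (n ^ 2) (2 * n) n (1 - n ^ 2) (-1 / n) x y * degShift k n y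
        - gPhiPhi k (n ^ 2) (2 * n) x y := by
  have hν : n ^ 2 ≠ 1 := by nlinarith
  have hd := den_ne_zero hν hxy hH
  have h1 : 1 - n ≠ 0 := by linarith
  have h2 : 1 - n ^ 2 ≠ 0 := sub_ne_zero.mpr hν.symm
  have h5 : 1 - 2 * n + n ^ 2 = (1 - n) ^ 2 := by ring
  have hw : n * y + 1 = n * (y - -1 / n) := by field_simp; ring
  have hl : degLin n y = (1 - n ^ 2) + (1 + n ^ 2) * (n * (y - -1 / n)) := by
    unfold degLin; rw [hw]
  unfold degZPhi gKPhi degShift gPhiPhi kPhiNum phiPhiNum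
  rw [h5, hl]
  generalize y - -1 / n = w at *
  generalize den (n ^ 2) (2 * n) x y = d at *
  generalize wNum (n ^ 2) (2 * n) x y = z
  generalize pNum (n ^ 2) (2 * n) x y = q
  field_simp
  ring

theorem degZZ_mul (hn : 0 < n) (hn1 : n < 1) (hxy : x ≠ y) (hH : H (n ^ 2) (2 * n) x y ≠ 0)
    (hy : y ^ 2 ≠ 1) :
    (y - -1 / n) ^ 2 * degZZ k n x y = degKK n x y * degShift k n y ^ 2
      - 2 * degShift k n y * gKPhi k (n ^ 2) (2 * n) n (1 - n ^ 2) (-1 / n) x y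
      + gPhiPhi k (n ^ 2) (2 * n) x y + degRad k n x y := by
  have hν : n ^ 2 ≠ 1 := by nlinarith
  have hx : x - y ≠ 0 := sub_ne_zero.mpr hxy
  have h1 : 1 - n ≠ 0 := by linarith
  have h2 : 1 - n ^ 2 ≠ 0 := sub_ne_zero.mpr hν.symm
  have h3 := one_sub_sq_ne_zero hy
  have h5 : 1 - 2 * n + n ^ 2 = (1 - n) ^ 2 := by ring
  have key := degZZNum_eq hn.ne' x y
  have h6 : (y - -1 / n) ^ 2 * degZZ k n x y
      = 2 * k ^ 2 * (n ^ 2 * ((y - -1 / n) ^ 2 * degZZNum n x y))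
        / (n ^ 2 * ((1 - n ^ 2) ^ 2 * (1 - y ^ 2) * den (n ^ 2) (2 * n) x y)) := by
    unfold degZZ
    generalize y - -1 / n = w
    generalize den (n ^ 2) (2 * n) x y = d
    field_simp
  rw [h6, ← key]
  unfold degKK degShift gKPhi gPhiPhi degRad conf den phiPhiNum
  rw [h5]
  generalize H (n ^ 2) (2 * n) x y = h at *
  generalize kPhiNum (n ^ 2) (2 * n) (-1 / n) x y = w
  generalize pNum (n ^ 2) (2 * n) x y = q
  generalize degLin n y = l
  generalize degKillKillNum n x y = t
  field_simp
  ring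

theorem degShift_eq (hn : 0 < n) (hn1 : n < 1) :
    degShift k n y = 4 * k / (1 - n) ^ 2
      + 4 * k * n * (1 + n ^ 2) / ((1 - n) ^ 2 * (1 - n ^ 2)) * (y - -1 / n) := by
  have hν : n ^ 2 ≠ 1 := by nlinarith
  have h1 : 1 - n ≠ 0 := by linarith
  have h2 : 1 - n ^ 2 ≠ 0 := sub_ne_zero.mpr hν.symm
  unfold degShift degLin
  field_simp
  ring

end Identities

section Analytic

variable {E : Type*} [NormedAddCommGroup E] [NormedSpace ℝ E] {f g : E → ℝ} {p : E} {k n : ℝ}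

theorem analyticAt_degKK (hn : n ^ 2 ≠ 1) (hf : AnalyticAt ℝ f p) (hg : AnalyticAt ℝ g p)
    (hxy : f p ≠ g p) (hH : H (n ^ 2) (2 * n) (f p) (g p) ≠ 0) :
    AnalyticAt ℝ (fun q => degKK n (f q) (g q)) p := by
  unfold degKK degKillKillNum
  exact AnalyticAt.fun_div (by fun_prop) (by fun_prop)
    (mul_ne_zero (by norm_num) (den_ne_zero hn hxy hH))

theorem analyticAt_degRad (hn0 : n ≠ 0) (hn : n ^ 2 ≠ 1) (hf : AnalyticAt ℝ f p)
    (hg : AnalyticAt ℝ g p) (hxy : f p ≠ g p) (hy : g p ^ 2 ≠ 1) :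
    AnalyticAt ℝ (fun q => degRad k n (f q) (g q)) p := by
  unfold degRad
  exact AnalyticAt.fun_neg (AnalyticAt.fun_div (analyticAt_conf hn hf hg hxy) (by fun_prop)
    (mul_ne_zero (one_sub_sq_ne_zero hy) (pow_ne_zero 2 hn0)))

@[fun_prop]
theorem analyticAt_degLin (hg : AnalyticAt ℝ g p) : AnalyticAt ℝ (fun q => degLin n (g q)) p := by
  unfold degLin; fun_prop

theorem analyticAt_degShift (hg : AnalyticAt ℝ g p) :
    AnalyticAt ℝ (fun q => degShift k n (g q)) p := by
  unfold degShift
  simp only [div_eq_mul_inv]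
  fun_prop

theorem analyticAt_degZPsi (hn : n ^ 2 ≠ 1) (hf : AnalyticAt ℝ f p) (hg : AnalyticAt ℝ g p)
    (hxy : f p ≠ g p) (hH : H (n ^ 2) (2 * n) (f p) (g p) ≠ 0) :
    AnalyticAt ℝ (fun q => degZPsi k n (f q) (g q)) p := by
  unfold degZPsi
  exact AnalyticAt.fun_div (by fun_prop) (by fun_prop)
    (mul_ne_zero (sub_ne_zero.mpr hn.symm) (den_ne_zero hn hxy hH))

theorem analyticAt_degZPhi (hn : n ^ 2 ≠ 1) (hf : AnalyticAt ℝ f p) (hg : AnalyticAt ℝ g p)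
    (hxy : f p ≠ g p) (hH : H (n ^ 2) (2 * n) (f p) (g p) ≠ 0) :
    AnalyticAt ℝ (fun q => degZPhi k n (f q) (g q)) p := by
  unfold degZPhi
  exact AnalyticAt.fun_div (by fun_prop) (by fun_prop)
    (mul_ne_zero (sub_ne_zero.mpr hn.symm) (den_ne_zero hn hxy hH))

theorem analyticAt_degZZ (hn : n ^ 2 ≠ 1) (hf : AnalyticAt ℝ f p) (hg : AnalyticAt ℝ g p)
    (hxy : f p ≠ g p) (hH : H (n ^ 2) (2 * n) (f p) (g p) ≠ 0) (hy : g p ^ 2 ≠ 1) :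
    AnalyticAt ℝ (fun q => degZZ k n (f q) (g q)) p := by
  unfold degZZ degZZNum degZZCoeff0 degZZCoeff1 degZZCoeff2 degZZCoeff3 degZZCoeff4
  exact AnalyticAt.fun_div (by fun_prop) (by fun_prop)
    (mul_ne_zero (mul_ne_zero (pow_ne_zero 2 (sub_ne_zero.mpr hn.symm)) (one_sub_sq_ne_zero hy))
      (den_ne_zero hn hxy hH))

end Analytic

/-- The additional zero of g(K,K) allows one more factor y - y₀ to be cancelled from
`IsHorizonData.det_frame`; continuity covers y = y₀. -/
theorem det_frame_degenerate {k n x y : ℝ} (hk : k ≠ 0) (hn : 0 < n) (hn1 : n < 1) (hxy : x ≠ y)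
    (hH : H (n ^ 2) (2 * n) x y ≠ 0) :
    degKK n x y * (gPsiPsi k (n ^ 2) (2 * n) x y * gPhiPhi k (n ^ 2) (2 * n) x y
          - gPsiPhi k (n ^ 2) (2 * n) n x y ^ 2)
        - (gKPsi k (n ^ 2) (2 * n) (1 - n ^ 2) (-1 / n) x y ^ 2 * gPhiPhi k (n ^ 2) (2 * n) x y
          - 2 * gKPsi k (n ^ 2) (2 * n) (1 - n ^ 2) (-1 / n) x y
            * gKPhi k (n ^ 2) (2 * n) n (1 - n ^ 2) (-1 / n) x y
            * gPsiPhi k (n ^ 2) (2 * n) n x y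
          + gKPhi k (n ^ 2) (2 * n) n (1 - n ^ 2) (-1 / n) x y ^ 2
            * gPsiPsi k (n ^ 2) (2 * n) x y)
      = 4 * k ^ 4 * G (n ^ 2) (2 * n) x * ((1 - y ^ 2) * n ^ 2)
          / ((1 - n ^ 2) ^ 2 * (x - y) ^ 4) := by
  have h := isHorizonData_degenerate hk hn hn1
  have hν := h.ν_ne
  have key : ∀ z, x ≠ z → H (n ^ 2) (2 * n) x z ≠ 0 → z ≠ -1 / n →
    degKK n x z * (gPsiPsi k (n ^ 2) (2 * n) x z * gPhiPhi k (n ^ 2) (2 * n) x z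
          - gPsiPhi k (n ^ 2) (2 * n) n x z ^ 2)
        - (gKPsi k (n ^ 2) (2 * n) (1 - n ^ 2) (-1 / n) x z ^ 2 * gPhiPhi k (n ^ 2) (2 * n) x z
          - 2 * gKPsi k (n ^ 2) (2 * n) (1 - n ^ 2) (-1 / n) x z
            * gKPhi k (n ^ 2) (2 * n) n (1 - n ^ 2) (-1 / n) x z
            * gPsiPhi k (n ^ 2) (2 * n) n x z
          + gKPhi k (n ^ 2) (2 * n) n (1 - n ^ 2) (-1 / n) x z ^ 2
            * gPsiPsi k (n ^ 2) (2 * n) x z)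
        - 4 * k ^ 4 * G (n ^ 2) (2 * n) x * ((1 - z ^ 2) * n ^ 2)
          / ((1 - n ^ 2) ^ 2 * (x - z) ^ 4) = 0 := by
    intro z hxz hHz hz
    have h1 := h.det_frame hxz hHz
    rw [gKK_degenerate hn hn1 hxz hHz] at h1
    refine (mul_eq_zero.mp ?_).resolve_left (sub_ne_zero.mpr hz)
    linear_combination h1
  rcases ne_or_eq y (-1 / n) with hy | hy
  · exact sub_eq_zero.mp (key y hxy hH hy)
  · have fx : AnalyticAt ℝ (fun _ : ℝ => x) y := by fun_prop
    have fy : AnalyticAt ℝ (fun z : ℝ => z) y := by fun_prop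
    have a1 := (analyticAt_degKK hν fx fy hxy hH).continuousAt
    have a2 := (analyticAt_gPsiPsi (k := k) h.e_ne hν fx fy hxy hH).continuousAt
    have a3 := (analyticAt_gPsiPhi (k := k) (n := n) hν fx fy hxy hH).continuousAt
    have a4 := (analyticAt_gPhiPhi (k := k) hν fx fy hxy hH).continuousAt
    have a5 := (analyticAt_gKPsi (k := k) (s := -1 / n) h.m_pos.ne' hν fx fy hxy hH).continuousAt
    have a6 := (analyticAt_gKPhi (k := k) (n := n) (s := -1 / n) h.lam_ne h.m_pos.ne' hν fx fy
      hxy hH).continuousAt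
    have a7 : ContinuousAt (fun z => 4 * k ^ 4 * G (n ^ 2) (2 * n) x * ((1 - z ^ 2) * n ^ 2)
          / ((1 - n ^ 2) ^ 2 * (x - z) ^ 4)) y := by
      refine ContinuousAt.div (by fun_prop) (by fun_prop) ?_
      exact mul_ne_zero (pow_ne_zero 2 (sub_ne_zero.mpr hν.symm))
        (pow_ne_zero 4 (sub_ne_zero.mpr hxy))
    refine sub_eq_zero.mp (eq_zero_of_eventually_punctured (r := y) (F := fun z =>
      degKK n x z * (gPsiPsi k (n ^ 2) (2 * n) x z * gPhiPhi k (n ^ 2) (2 * n) x z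
          - gPsiPhi k (n ^ 2) (2 * n) n x z ^ 2)
        - (gKPsi k (n ^ 2) (2 * n) (1 - n ^ 2) (-1 / n) x z ^ 2 * gPhiPhi k (n ^ 2) (2 * n) x z
          - 2 * gKPsi k (n ^ 2) (2 * n) (1 - n ^ 2) (-1 / n) x z
            * gKPhi k (n ^ 2) (2 * n) n (1 - n ^ 2) (-1 / n) x z
            * gPsiPhi k (n ^ 2) (2 * n) n x z
          + gKPhi k (n ^ 2) (2 * n) n (1 - n ^ 2) (-1 / n) x z ^ 2
            * gPsiPsi k (n ^ 2) (2 * n) x z)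
        - 4 * k ^ 4 * G (n ^ 2) (2 * n) x * ((1 - z ^ 2) * n ^ 2)
          / ((1 - n ^ 2) ^ 2 * (x - z) ^ 4)) (by fun_prop) ?_)
    filter_upwards [(eventually_regular hxy hH).filter_mono nhdsWithin_le_nhds,
      self_mem_nhdsWithin] with z hz hzy
    exact key z hz.1 hz.2 (by rw [← hy]; exact hzy)

/-! ### Boundedness at the degenerate horizon -/

theorem eq_zero_of_div_isBigO_one {F : ℝ → ℝ} {r : ℝ} (hF : ContinuousAt F r)
    (h : (fun y => F y / (y - r)) =O[𝓝[≠] r] fun _ => (1 : ℝ)) : F r = 0 := by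
  have hlim : Tendsto (fun y : ℝ => y - r) (𝓝[≠] r) (𝓝 0) := by
    have : Tendsto (fun y : ℝ => y - r) (𝓝 r) (𝓝 (r - r)) :=
      (continuous_id.sub continuous_const).tendsto r
    rw [sub_self] at this
    exact this.mono_left nhdsWithin_le_nhds
  have h1 : F =O[𝓝[≠] r] fun y => y - r := by
    refine (h.mul (isBigO_refl (fun y : ℝ => y - r) (𝓝[≠] r))).congr' ?_ (by simp)
    filter_upwards [self_mem_nhdsWithin] with y hy
    exact div_mul_cancel₀ _ (sub_ne_zero.mpr hy)
  exact tendsto_nhds_unique (hF.tendsto.mono_left nhdsWithin_le_nhds) (h1.trans_tendsto hlim)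

theorem isBigO_one_of_continuousAt {F : ℝ → ℝ} {r : ℝ} (hF : ContinuousAt F r) :
    F =O[𝓝[≠] r] fun _ => (1 : ℝ) :=
  (hF.tendsto.mono_left nhdsWithin_le_nhds).isBigO_one ℝ

theorem div_isBigO_one_of_div_sq {F : ℝ → ℝ} {r : ℝ}
    (h : (fun y => F y / (y - r) ^ 2) =O[𝓝[≠] r] fun _ => (1 : ℝ)) :
    (fun y => F y / (y - r)) =O[𝓝[≠] r] fun _ => (1 : ℝ) := by
  have h1 : (fun y : ℝ => y - r) =O[𝓝[≠] r] fun _ => (1 : ℝ) :=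
    isBigO_one_of_continuousAt (by fun_prop)
  refine (h.mul h1).congr' ?_ (by simp)
  filter_upwards [self_mem_nhdsWithin] with y hy
  have := sub_ne_zero.mpr (Set.mem_compl_singleton_iff.mp hy)
  field_simp

/-- Near a double zero of the norm of `K`, the radial components of the metric are bounded for
exactly two choices of the constants. -/
theorem radial_isBigO_one_iff {r α β : ℝ} {A B C₁ C₂ q₁ q₂ q₃ Z₁ Z₂ Z : ℝ → ℝ}
    (hA : ContinuousAt A r) (hB : ContinuousAt B r) (hC₁ : ContinuousAt C₁ r)
    (hC₂ : ContinuousAt C₂ r) (hq₁ : ContinuousAt q₁ r) (hq₂ : ContinuousAt q₂ r)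
    (hq₃ : ContinuousAt q₃ r) (hZ₁ : ContinuousAt Z₁ r) (hZ₂ : ContinuousAt Z₂ r)
    (hZ : ContinuousAt Z r) (hα : α ≠ 0)
    (h₁ : ∀ᶠ y in 𝓝 r, (y - r) * Z₁ y = C₁ y * (α + β * (y - r)) - q₂ y)
    (h₂ : ∀ᶠ y in 𝓝 r, (y - r) * Z₂ y = C₂ y * (α + β * (y - r)) - q₃ y)
    (h₃ : ∀ᶠ y in 𝓝 r, (y - r) ^ 2 * Z y = A y * (α + β * (y - r)) ^ 2
      - 2 * (α + β * (y - r)) * C₂ y + q₃ y + B y)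
    (hdet : A r * (q₁ r * q₃ r - q₂ r ^ 2)
      - (C₁ r ^ 2 * q₃ r - 2 * C₁ r * C₂ r * q₂ r + C₂ r ^ 2 * q₁ r) ≠ 0) (hB0 : B r ≠ 0)
    (a₀ a₁ bψ bφ : ℝ) :
    ((fun y => (A y * (a₀ + a₁ * (y - r)) ^ 2 + 2 * (a₀ + a₁ * (y - r)) * (C₁ y * bψ + C₂ y * bφ)
        + (q₁ y * bψ ^ 2 + 2 * q₂ y * bψ * bφ + q₃ y * bφ ^ 2) + B y) / (y - r) ^ 2)
          =O[𝓝[≠] r] (fun _ => (1 : ℝ)) ∧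
      (fun y => (C₁ y * (a₀ + a₁ * (y - r)) + q₁ y * bψ + q₂ y * bφ) / (y - r))
          =O[𝓝[≠] r] (fun _ => (1 : ℝ)) ∧
      (fun y => (C₂ y * (a₀ + a₁ * (y - r)) + q₂ y * bψ + q₃ y * bφ) / (y - r))
          =O[𝓝[≠] r] (fun _ => (1 : ℝ))) ↔
      ∃ s, (s = 1 ∨ s = -1) ∧ a₀ = s * α ∧ a₁ = s * β ∧ bψ = 0 ∧ bφ = -s := by
  constructor
  · rintro ⟨o1, o2, o3⟩
    -- Boundedness kills the leading coefficients of all three poles; `f1`, `f2`, `f3` record the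
    -- same equations for the known solution (α, 0, -1).
    have e1 : C₁ r * a₀ + q₁ r * bψ + q₂ r * bφ = 0 := by
      simpa using eq_zero_of_div_isBigO_one (by fun_prop) o2
    have e2 : C₂ r * a₀ + q₂ r * bψ + q₃ r * bφ = 0 := by
      simpa using eq_zero_of_div_isBigO_one (by fun_prop) o3
    have e3 : A r * a₀ ^ 2 + 2 * a₀ * (C₁ r * bψ + C₂ r * bφ)
        + (q₁ r * bψ ^ 2 + 2 * q₂ r * bψ * bφ + q₃ r * bφ ^ 2) + B r = 0 := by
      simpa using eq_zero_of_div_isBigO_one (by fun_prop) (div_isBigO_one_of_div_sq o1)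
    have f1 : q₂ r = C₁ r * α := by
      have := h₁.self_of_nhds
      simp at this
      linarith
    have f2 : q₃ r = C₂ r * α := by
      have := h₂.self_of_nhds
      simp at this
      linarith
    have f3 : A r * α ^ 2 - α * C₂ r + B r = 0 := by
      have := h₃.self_of_nhds
      simp at this
      linear_combination -this - f2
    -- By `f1` and `f2`, α² times the expression in `hdet` equals (Aα² - αC₂)(q₁q₃ - q₂²). So `e1`,
    -- `e2` have rank two, and their solutions (a₀, bψ, bφ) are the multiples of (α, 0, -1).
    have hq : q₁ r * q₃ r - q₂ r ^ 2 ≠ 0 := by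
      intro h0
      refine hdet (mul_left_cancel₀ (pow_ne_zero 2 hα) ?_)
      rw [f1, f2] at h0 ⊢
      linear_combination (A r * α ^ 2 - α * C₂ r) * h0
    have hbψ : bψ = 0 := by
      refine (mul_eq_zero.mp ?_).resolve_left (mul_ne_zero hq hα)
      linear_combination α * (q₃ r * e1 - q₂ r * e2) + a₀ * (q₃ r * f1 - q₂ r * f2)
    subst hbψ
    have ha₀ : a₀ = -bφ * α := by
      have : a₀ + bφ * α = 0 := by
        refine (mul_eq_zero.mp ?_).resolve_left hq
        linear_combination α * (q₁ r * e2 - q₂ r * e1) + a₀ * (q₁ r * f2 - q₂ r * f1)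
      linarith
    -- The equation `e3` is quadratic apart from B(r) ≠ 0, so comparison with `f3` fixes the
    -- multiple up to sign.
    have hb2 : bφ ^ 2 = 1 := by
      have : (bφ ^ 2 - 1) * B r = 0 := by
        rw [ha₀] at e3
        linear_combination bφ ^ 2 * f3 - e3 + bφ ^ 2 * f2
      have := (mul_eq_zero.mp this).resolve_right hB0
      linarith
    have ha₁ : a₁ = -bφ * β := by
      -- Subtracting the bounded g_zz of the known solution leaves this function over y - r, so it
      -- vanishes at r. Its value there, times α, is 2bφB(r)(a₁ + bφβ).
      have hK : ContinuousAt (fun y => (a₁ + bφ * β) * (A y * (a₀ + a₁ * (y - r)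
          - bφ * (α + β * (y - r))) + 2 * bφ * C₂ y)) r := by fun_prop
      have h0 := eq_zero_of_div_isBigO_one hK
        ((o1.sub (isBigO_one_of_continuousAt hZ)).congr' ?_ EventuallyEq.rfl)
      · simp only [sub_self, mul_zero, add_zero] at h0
        have h1 : (a₁ + bφ * β) * (2 * (bφ * B r)) = 0 := by
          rw [ha₀] at h0
          linear_combination α * h0 + (a₁ + bφ * β) * 2 * bφ * f3
        have h2 : bφ ≠ 0 := by rintro rfl; norm_num at hb2
        have := (mul_eq_zero.mp h1).resolve_right (by positivity)
        linarith
      · filter_upwards [h₃.filter_mono nhdsWithin_le_nhds, self_mem_nhdsWithin] with y hy hyr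
        have hw := sub_ne_zero.mpr (Set.mem_compl_singleton_iff.mp hyr)
        rw [div_sub' (pow_ne_zero 2 hw), hy, ha₀]
        generalize y - r = w at *
        rw [div_eq_div_iff (pow_ne_zero 2 hw) hw]
        linear_combination (w * (q₃ y + A y * (α + β * w) ^ 2
          - 2 * (α + β * w) * C₂ y)) * hb2
    refine ⟨-bφ, ?_, ha₀, ha₁, rfl, by ring⟩
    rcases sq_eq_one_iff.mp hb2 with h | h
    · right; linarith
    · left; linarith
  · rintro ⟨s, hs, rfl, rfl, rfl, rfl⟩
    have hs2 : s ^ 2 = 1 := by rcases hs with rfl | rfl <;> norm_num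
    refine ⟨?_, ?_, ?_⟩
    · refine (isBigO_one_of_continuousAt hZ).congr' ?_ EventuallyEq.rfl
      filter_upwards [h₃.filter_mono nhdsWithin_le_nhds, self_mem_nhdsWithin] with y hy hyr
      have hw := sub_ne_zero.mpr (Set.mem_compl_singleton_iff.mp hyr)
      rw [eq_div_iff (pow_ne_zero 2 hw), mul_comm, hy]
      linear_combination (2 * (α + β * (y - r)) * C₂ y - q₃ y
        - A y * (α + β * (y - r)) ^ 2) * hs2
    · refine (isBigO_one_of_continuousAt (hZ₁.const_mul s)).congr' ?_ EventuallyEq.rfl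
      filter_upwards [h₁.filter_mono nhdsWithin_le_nhds, self_mem_nhdsWithin] with y hy hyr
      have hw := sub_ne_zero.mpr (Set.mem_compl_singleton_iff.mp hyr)
      rw [eq_div_iff hw]
      linear_combination s * hy
    · refine (isBigO_one_of_continuousAt (hZ₂.const_mul s)).congr' ?_ EventuallyEq.rfl
      filter_upwards [h₂.filter_mono nhdsWithin_le_nhds, self_mem_nhdsWithin] with y hy hyr
      have hw := sub_ne_zero.mpr (Set.mem_compl_singleton_iff.mp hyr)
      rw [eq_div_iff hw]
      linear_combination s * hy

/-! ### The coordinates regular at the degenerate horizon -/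

/-- Negating the four constants inverts the Jacobian: with L = a₀ + a₁w, dt = dv + (L/w²)dz, and the
shifted angles have differentials dΨ + (b^ψ/w)dz and dΦ + (b^φ/w)dz. -/
theorem deg_entries (a₀ a₁ bψ bφ A B C₁ C₂ q₁ q₂ q₃ X : ℝ) {w : ℝ} (hw : w ≠ 0) :
    let U := degMat (-a₀) (-a₁) (-bψ) (-bφ) w
    let g := Uᵀ * blockMat (w * (w * A)) (w * C₁) (w * C₂) q₁ q₂ q₃ (B / w ^ 2) X * U
    g 0 0 = w ^ 2 * A ∧ g 0 2 = w * C₁ ∧ g 0 3 = w * C₂ ∧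
    g 1 1 = (A * (a₀ + a₁ * w) ^ 2 + 2 * (a₀ + a₁ * w) * (C₁ * bψ + C₂ * bφ)
        + (q₁ * bψ ^ 2 + 2 * q₂ * bψ * bφ + q₃ * bφ ^ 2) + B) / w ^ 2 ∧
    g 1 2 = (C₁ * (a₀ + a₁ * w) + q₁ * bψ + q₂ * bφ) / w ∧
    g 1 3 = (C₂ * (a₀ + a₁ * w) + q₂ * bψ + q₃ * bφ) / w := by
  refine ⟨?_, ?_, ?_, ?_, ?_, ?_⟩ <;>
    simp [degMat, blockMat, Matrix.mul_apply, Fin.sum_univ_five] <;> field_simp <;> ring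

theorem sq_ne_one_of_lt {x : ℝ} (h : x < -1) : x ^ 2 ≠ 1 := by nlinarith

theorem neg_one_div_lt {n : ℝ} (hn : 0 < n) (hn1 : n < 1) : -1 / n < -1 := by
  rw [div_lt_iff₀ hn]; linarith

theorem deg_behaviour {k n : ℝ} (hk : k ≠ 0) (hn : 0 < n) (hn1 : n < 1)
    (a₀ a₁ bψ bφ t ψ φ : ℝ) {x : ℝ} (hx : |x| < 1) :
    (fun y => newComponents (degChart k (n ^ 2) a₀ a₁ bψ bφ) (metric k (n ^ 2) (2 * n))
        ![t, y, ψ, φ, x] 0 0) =O[𝓝[≠] (-1 / n)] (fun y => (y - -1 / n) ^ 2) ∧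
    (fun y => newComponents (degChart k (n ^ 2) a₀ a₁ bψ bφ) (metric k (n ^ 2) (2 * n))
        ![t, y, ψ, φ, x] 0 2) =O[𝓝[≠] (-1 / n)] (fun y => y - -1 / n) ∧
    (fun y => newComponents (degChart k (n ^ 2) a₀ a₁ bψ bφ) (metric k (n ^ 2) (2 * n))
        ![t, y, ψ, φ, x] 0 3) =O[𝓝[≠] (-1 / n)] (fun y => y - -1 / n) ∧
    ((∀ j ∈ ({1, 2, 3} : Set (Fin 5)),
      (fun y => newComponents (degChart k (n ^ 2) a₀ a₁ bψ bφ) (metric k (n ^ 2) (2 * n))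
        ![t, y, ψ, φ, x] 1 j) =O[𝓝[≠] (-1 / n)] (fun _ => (1 : ℝ))) ↔
      ∃ s, (s = 1 ∨ s = -1) ∧ IsDegConstants k (n ^ 2) s a₀ a₁ bψ bφ) := by
  have h := isHorizonData_degenerate hk hn hn1
  have hν := h.ν_ne
  have hr := neg_one_div_lt hn hn1
  have hr2 := sq_ne_one_of_lt hr
  have hxr : x ≠ -1 / n := by
    have := (abs_lt.mp hx).1
    linarith
  have hH := h.H_root_ne (by nlinarith) hr (abs_lt.mp hx).1.le
  have hy0 : y0 (n ^ 2) = -1 / n := by unfold y0; rw [Real.sqrt_sq hn.le]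
  have fx : AnalyticAt ℝ (fun _ : ℝ => x) (-1 / n) := by fun_prop
  have fy : AnalyticAt ℝ (fun z : ℝ => z) (-1 / n) := by fun_prop
  have c1 := (analyticAt_degKK hν fx fy hxr hH).continuousAt
  have c2 := (analyticAt_degRad (k := k) hn.ne' hν fx fy hxr hr2).continuousAt
  have c3 := (analyticAt_gKPsi (k := k) (s := -1 / n) h.m_pos.ne' hν fx fy hxr hH).continuousAt
  have c4 := (analyticAt_gKPhi (k := k) (n := n) (s := -1 / n) h.lam_ne h.m_pos.ne' hν fx fy
    hxr hH).continuousAt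
  have c5 := (analyticAt_gPsiPsi (k := k) h.e_ne hν fx fy hxr hH).continuousAt
  have c6 := (analyticAt_gPsiPhi (k := k) (n := n) hν fx fy hxr hH).continuousAt
  have c7 := (analyticAt_gPhiPhi (k := k) hν fx fy hxr hH).continuousAt
  have c8 := (analyticAt_degZPsi (k := k) hν fx fy hxr hH).continuousAt
  have c9 := (analyticAt_degZPhi (k := k) hν fx fy hxr hH).continuousAt
  have c10 := (analyticAt_degZZ (k := k) hν fx fy hxr hH hr2).continuousAt
  have hreg := eventually_regular hxr hH
  have hnew : ∀ᶠ y in 𝓝[≠] (-1 / n), y - -1 / n ≠ 0 ∧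
      newComponents (degChart k (n ^ 2) a₀ a₁ bψ bφ) (metric k (n ^ 2) (2 * n)) ![t, y, ψ, φ, x]
      = (degMat (-a₀) (-a₁) (-bψ) (-bφ) (y - -1 / n))ᵀ * blockMat
        ((y - -1 / n) * ((y - -1 / n) * degKK n x y))
        ((y - -1 / n) * gKPsi k (n ^ 2) (2 * n) (1 - n ^ 2) (-1 / n) x y)
        ((y - -1 / n) * gKPhi k (n ^ 2) (2 * n) n (1 - n ^ 2) (-1 / n) x y)
        (gPsiPsi k (n ^ 2) (2 * n) x y) (gPsiPhi k (n ^ 2) (2 * n) n x y)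
        (gPhiPhi k (n ^ 2) (2 * n) x y) (degRad k n x y / (y - -1 / n) ^ 2)
        (conf k (n ^ 2) (2 * n) x y / G (n ^ 2) (2 * n) x)
        * degMat (-a₀) (-a₁) (-bψ) (-bφ) (y - -1 / n) := by
    filter_upwards [h.eventually_metric_eq (t := t) (ψ := ψ) (φ := φ) hxr hH,
      self_mem_nhdsWithin, hreg.filter_mono nhdsWithin_le_nhds] with y hm hyr hy
    refine ⟨sub_ne_zero.mpr hyr, ?_⟩
    rw [gKK_degenerate hn hn1 hy.1 hy.2, gRad_degenerate hn hyr] at hm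
    have hj := jac_degChart (k := k) (ν := n ^ 2) (a₀ := a₀) (a₁ := a₁) (bψ := bψ) (bφ := bφ)
      (p := ![t, y, ψ, φ, x]) (by rw [hy0]; exact hyr)
    rw [hy0] at hj
    exact newComponents_eq hj (degMat_mul_neg _ _ _ _ _) hm
  have congr : ∀ (i j : Fin 5) (F : ℝ → ℝ) (g : ℝ → ℝ),
      (∀ᶠ y in 𝓝[≠] (-1 / n), newComponents (degChart k (n ^ 2) a₀ a₁ bψ bφ)
        (metric k (n ^ 2) (2 * n)) ![t, y, ψ, φ, x] i j = F y) →
      ((fun y => newComponents (degChart k (n ^ 2) a₀ a₁ bψ bφ) (metric k (n ^ 2) (2 * n))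
        ![t, y, ψ, φ, x] i j) =O[𝓝[≠] (-1 / n)] g ↔ F =O[𝓝[≠] (-1 / n)] g) :=
    fun i j F g hF => isBigO_congr hF EventuallyEq.rfl
  have key := radial_isBigO_one_iff (α := 4 * k / (1 - n) ^ 2)
    (β := 4 * k * n * (1 + n ^ 2) / ((1 - n) ^ 2 * (1 - n ^ 2))) c1 c2 c3 c4 c5 c6 c7 c8 c9 c10
    ?_ ?_ ?_ ?_ ?_ ?_ a₀ a₁ bψ bφ
  · refine ⟨?_, ?_, ?_, ?_⟩
    · rw [congr 0 0 _ _ (hnew.mono fun y hy => (congrFun (congrFun hy.2 0) 0).trans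
        (deg_entries _ _ _ _ _ _ _ _ _ _ _ _ hy.1).1)]
      simpa using (isBigO_refl (fun y : ℝ => (y - -1 / n) ^ 2) _).mul
        (isBigO_one_of_continuousAt c1)
    · rw [congr 0 2 _ _ (hnew.mono fun y hy => (congrFun (congrFun hy.2 0) 2).trans
        (deg_entries _ _ _ _ _ _ _ _ _ _ _ _ hy.1).2.1)]
      simpa using (isBigO_refl (fun y : ℝ => y - -1 / n) _).mul (isBigO_one_of_continuousAt c3)
    · rw [congr 0 3 _ _ (hnew.mono fun y hy => (congrFun (congrFun hy.2 0) 3).trans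
        (deg_entries _ _ _ _ _ _ _ _ _ _ _ _ hy.1).2.2.1)]
      simpa using (isBigO_refl (fun y : ℝ => y - -1 / n) _).mul (isBigO_one_of_continuousAt c4)
    · simp only [Set.mem_insert_iff, Set.mem_singleton_iff, forall_eq_or_imp, forall_eq]
      rw [congr 1 1 _ _ (hnew.mono fun y hy => (congrFun (congrFun hy.2 1) 1).trans
        (deg_entries _ _ _ _ _ _ _ _ _ _ _ _ hy.1).2.2.2.1),
        congr 1 2 _ _ (hnew.mono fun y hy => (congrFun (congrFun hy.2 1) 2).trans
        (deg_entries _ _ _ _ _ _ _ _ _ _ _ _ hy.1).2.2.2.2.1),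
        congr 1 3 _ _ (hnew.mono fun y hy => (congrFun (congrFun hy.2 1) 3).trans
        (deg_entries _ _ _ _ _ _ _ _ _ _ _ _ hy.1).2.2.2.2.2), key]
      unfold IsDegConstants
      rw [Real.sqrt_sq hn.le]
  · have : 1 - n ≠ 0 := by linarith
    positivity
  · filter_upwards [hreg] with y hy
    rw [degZPsi_mul hn hn1 hy.1 hy.2, degShift_eq hn hn1]
  · filter_upwards [hreg] with y hy
    rw [degZPhi_mul hn hn1 hy.1 hy.2, degShift_eq hn hn1]
  · have hc : ContinuousAt (fun y : ℝ => y ^ 2) (-1 / n) := by fun_prop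
    filter_upwards [hreg, hc.eventually_ne hr2] with y hy hy2
    rw [degZZ_mul hn hn1 hy.1 hy.2 hy2, degShift_eq hn hn1]
  · rw [det_frame_degenerate hk hn hn1 hxr hH]
    have := h.G_ne_zero hr hr hx
    have := one_sub_sq_ne_zero hr2
    have := sub_ne_zero.mpr hxr
    have := sub_ne_zero.mpr hν.symm
    positivity
  · unfold degRad conf
    have := one_sub_sq_ne_zero hr2
    have := sub_ne_zero.mpr hxr
    have := sub_ne_zero.mpr hν.symm
    simp only [ne_eq, neg_eq_zero]
    positivity

/-- The extended metric in the coordinates `(v, z, Ψ, Φ, x)`, where `w = z - y₀`. -/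
def degExtMat (A C₁ C₂ V Z₁ Z₂ Z q₁ q₂ q₃ X w : ℝ) : Mat5 :=
  !![w ^ 2 * A, V, w * C₁, w * C₂, 0;
     V, Z, Z₁, Z₂, 0;
     w * C₁, Z₁, q₁, q₂, 0;
     w * C₂, Z₂, q₂, q₃, 0;
     0, 0, 0, 0, X]

theorem degExtMat_isSymm (A C₁ C₂ V Z₁ Z₂ Z q₁ q₂ q₃ X w : ℝ) :
    (degExtMat A C₁ C₂ V Z₁ Z₂ Z q₁ q₂ q₃ X w).IsSymm := by
  ext i j
  fin_cases i <;> fin_cases j <;> rfl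

theorem analyticAt_degExtMat {F : Type*} [NormedAddCommGroup F] [NormedSpace ℝ F] {p : F}
    {A C₁ C₂ V Z₁ Z₂ Z q₁ q₂ q₃ X w : F → ℝ} (hA : AnalyticAt ℝ A p)
    (hC₁ : AnalyticAt ℝ C₁ p) (hC₂ : AnalyticAt ℝ C₂ p) (hV : AnalyticAt ℝ V p)
    (hZ₁ : AnalyticAt ℝ Z₁ p) (hZ₂ : AnalyticAt ℝ Z₂ p) (hZ : AnalyticAt ℝ Z p)
    (hq₁ : AnalyticAt ℝ q₁ p) (hq₂ : AnalyticAt ℝ q₂ p) (hq₃ : AnalyticAt ℝ q₃ p)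
    (hX : AnalyticAt ℝ X p) (hw : AnalyticAt ℝ w p) (i j : Fin 5) :
    AnalyticAt ℝ (fun z => degExtMat (A z) (C₁ z) (C₂ z) (V z) (Z₁ z) (Z₂ z) (Z z) (q₁ z) (q₂ z)
      (q₃ z) (X z) (w z) i j) p := by
  fin_cases i <;> fin_cases j <;>
    simp only [degExtMat, Fin.zero_eta, Fin.mk_one, Fin.reduceFinMk, Matrix.of_apply,
      Matrix.cons_val', Matrix.cons_val_zero, Matrix.cons_val_one, Matrix.cons_val,
      Matrix.cons_val_fin_one] <;> fun_prop

section

variable {A B C₁ C₂ Z₁ Z₂ Z q₁ q₂ q₃ w L : ℝ}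

/-- In the determinant Z₁ and Z₂ occur only through wZ₁ and wZ₂, and Z only through w²Z. The
relations are thus substituted without dividing by w, and the formula holds on the horizon w = 0
itself. -/
theorem det_degExtMat {s : ℝ} (hs : s ^ 2 = 1) (h₁ : w * Z₁ = C₁ * L - q₂)
    (h₂ : w * Z₂ = C₂ * L - q₃) (h₃ : w ^ 2 * Z = A * L ^ 2 - 2 * L * C₂ + q₃ + B) (X : ℝ) :
    (degExtMat A C₁ C₂ (s * (A * L - C₂)) (s * Z₁) (s * Z₂) Z q₁ q₂ q₃ X w).det
      = X * B * (A * (q₁ * q₃ - q₂ ^ 2)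
        - (C₁ ^ 2 * q₃ - 2 * C₁ * C₂ * q₂ + C₂ ^ 2 * q₁)) := by
  have e : (degExtMat A C₁ C₂ (s * (A * L - C₂)) (s * Z₁) (s * Z₂) Z q₁ q₂ q₃ X w).det
      = X * (A * ((w ^ 2 * Z) * (q₁ * q₃ - q₂ ^ 2)
          - s ^ 2 * ((w * Z₁) ^ 2 * q₃ - 2 * (w * Z₁) * (w * Z₂) * q₂ + (w * Z₂) ^ 2 * q₁))
        - s ^ 2 * (A * L - C₂) ^ 2 * (q₁ * q₃ - q₂ ^ 2)
        + 2 * s ^ 2 * (A * L - C₂) * (C₁ * (w * Z₁) * q₃ - C₁ * (w * Z₂) * q₂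
          - C₂ * (w * Z₁) * q₂ + C₂ * (w * Z₂) * q₁)
        - (w ^ 2 * Z) * (C₁ ^ 2 * q₃ - 2 * C₁ * C₂ * q₂ + C₂ ^ 2 * q₁)
        + s ^ 2 * (C₁ * (w * Z₂) - C₂ * (w * Z₁)) ^ 2) := by
    simp [degExtMat, Matrix.det_succ_row_zero, Fin.sum_univ_succ, Fin.succAbove]
    ring
  rw [e, h₁, h₂, h₃, hs]
  ring

theorem degMat_pullback {s α β : ℝ} (hs : s ^ 2 = 1) (hw : w ≠ 0) (hL : L = α + β * w)
    (h₁ : w * Z₁ = C₁ * L - q₂) (h₂ : w * Z₂ = C₂ * L - q₃)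
    (h₃ : w ^ 2 * Z = A * L ^ 2 - 2 * L * C₂ + q₃ + B) (X : ℝ) :
    (degMat (s * α) (s * β) 0 (-s) w)ᵀ
        * degExtMat A C₁ C₂ (s * (A * L - C₂)) (s * Z₁) (s * Z₂) Z q₁ q₂ q₃ X w
        * degMat (s * α) (s * β) 0 (-s) w
      = blockMat (w * (w * A)) (w * C₁) (w * C₂) q₁ q₂ q₃ (B / w ^ 2) X := by
  obtain rfl : Z₁ = (C₁ * L - q₂) / w := by field_simp; linarith
  obtain rfl : Z₂ = (C₂ * L - q₃) / w := by field_simp; linarith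
  obtain rfl : Z = (A * L ^ 2 - 2 * L * C₂ + q₃ + B) / w ^ 2 := by field_simp; linarith
  have h0 : s * α / w ^ 2 + s * β / w = s * (L / w ^ 2) := by rw [hL]; field_simp
  unfold degMat
  rw [h0]
  ext i j
  fin_cases i <;> fin_cases j <;>
    simp [degExtMat, blockMat, Matrix.mul_apply, Fin.sum_univ_five] <;> field_simp <;>
    first | ring1 | (simp only [hs]; ring1)

end

theorem analyticAt_degChart {k ν a₀ a₁ bψ bφ : ℝ} {p : Coords} (hp : p 1 ≠ y0 ν) :
    AnalyticAt ℝ (degChart k ν a₀ a₁ bψ bφ) p := by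
  have h0 := analyticAt_coord 0 p
  have h1 := analyticAt_coord 1 p
  have hw : p 1 - y0 ν ≠ 0 := sub_ne_zero.mpr hp
  have hsub := h1.fun_sub (analyticAt_const (v := y0 ν))
  have hlog := analyticAt_log_of_ne hsub hw
  refine AnalyticAt.pi fun i => ?_
  fin_cases i
  · exact (h0.fun_add (analyticAt_const.fun_div hsub hw)).fun_sub (analyticAt_const.fun_mul hlog)
  · exact h1
  · exact ((analyticAt_coord 2 p).fun_sub (analyticAt_const.fun_mul h0)).fun_sub
      (analyticAt_const.fun_mul hlog)
  · exact ((analyticAt_coord 3 p).fun_sub (analyticAt_const.fun_mul h0)).fun_sub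
      (analyticAt_const.fun_mul hlog)
  · exact analyticAt_coord 4 p

/-- Since y is itself a coordinate, the map for fixed y is an affine bijection of the others,
whatever values the singular terms take at y = y₀. -/
theorem degChart_injective (k ν a₀ a₁ bψ bφ : ℝ) :
    Function.Injective (degChart k ν a₀ a₁ bψ bφ) := by
  intro p q hpq
  have h1 : p 1 = q 1 := congrFun hpq 1
  have h0 : p 0 = q 0 := by
    have e : p 0 + a₀ / (p 1 - y0 ν) - a₁ * Real.log (p 1 - y0 ν)
        = q 0 + a₀ / (q 1 - y0 ν) - a₁ * Real.log (q 1 - y0 ν) := congrFun hpq 0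
    rw [h1] at e
    linarith
  have h2 : p 2 = q 2 := by
    have e : p 2 - aPsi k ν * p 0 - bψ * Real.log (p 1 - y0 ν)
        = q 2 - aPsi k ν * q 0 - bψ * Real.log (q 1 - y0 ν) := congrFun hpq 2
    rw [h0, h1] at e
    linarith
  have h3 : p 3 = q 3 := by
    have e : p 3 - aPhi k ν * p 0 - bφ * Real.log (p 1 - y0 ν)
        = q 3 - aPhi k ν * q 0 - bφ * Real.log (q 1 - y0 ν) := congrFun hpq 3
    rw [h0, h1] at e
    linarith
  have h4 : p 4 = q 4 := congrFun hpq 4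
  ext i
  fin_cases i <;> assumption

theorem isOpen_degDomain (ν : ℝ) : IsOpen (degDomain ν) := by
  have hx : Continuous fun p : Coords => p 4 := continuous_apply 4
  have hy : Continuous fun p : Coords => p 1 := continuous_apply 1
  exact (isOpen_ne_fun (continuous_G _ _ hx) continuous_const).inter
    ((isOpen_ne_fun hx hy).inter ((isOpen_ne_fun (hy.pow 2) continuous_const).inter
      (isOpen_ne_fun (continuous_H _ _ hx hy) continuous_const)))

theorem exists_degenerate_extension {k n s a₀ a₁ bψ bφ : ℝ} (hk : k ≠ 0) (hn : 0 < n)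
    (hn1 : n < 1) (hs : s = 1 ∨ s = -1) (hc : IsDegConstants k (n ^ 2) s a₀ a₁ bψ bφ) :
    ∃ gExt : Coords → Mat5, IsAnalyticMetricOn gExt (degDomain (n ^ 2)) ∧
      (∀ p q, p 1 = q 1 → p 4 = q 4 → gExt p = gExt q) ∧
      (∀ p ∈ degDomain (n ^ 2), (gExt p).det =
        -(16 * k ^ 8 * H (n ^ 2) (2 * n) (p 4) (p 1) ^ 2)
          / ((1 - n ^ 2) ^ 6 * (p 4 - p 1) ^ 8)) ∧
      IsIsometricEmbeddingOn (degChart k (n ^ 2) a₀ a₁ bψ bφ) (domain (n ^ 2) (2 * n))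
        (metric k (n ^ 2) (2 * n)) (degDomain (n ^ 2)) gExt := by
  have h := isHorizonData_degenerate hk hn hn1
  have hν := h.ν_ne
  have hν' := sub_ne_zero.mpr hν.symm
  have hsqrt : √(n ^ 2) = n := Real.sqrt_sq hn.le
  have hy0 : y0 (n ^ 2) = -1 / n := by unfold y0; rw [hsqrt]
  have hs2 : s ^ 2 = 1 := by rcases hs with rfl | rfl <;> norm_num
  unfold IsDegConstants at hc
  rw [hsqrt] at hc
  obtain ⟨rfl, rfl, rfl, rfl⟩ := hc
  have hW : ∀ p ∈ degDomain (n ^ 2), G (n ^ 2) (2 * n) (p 4) ≠ 0 ∧ p 4 ≠ p 1 ∧ p 1 ^ 2 ≠ 1 ∧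
      H (n ^ 2) (2 * n) (p 4) (p 1) ≠ 0 := by
    intro p hp
    simp only [degDomain, hsqrt] at hp
    exact hp
  have hdet : ∀ p ∈ degDomain (n ^ 2), (degExtMat (degKK n (p 4) (p 1))
      (gKPsi k (n ^ 2) (2 * n) (1 - n ^ 2) (-1 / n) (p 4) (p 1))
      (gKPhi k (n ^ 2) (2 * n) n (1 - n ^ 2) (-1 / n) (p 4) (p 1))
      (s * (degKK n (p 4) (p 1) * degShift k n (p 1)
        - gKPhi k (n ^ 2) (2 * n) n (1 - n ^ 2) (-1 / n) (p 4) (p 1)))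
      (s * degZPsi k n (p 4) (p 1)) (s * degZPhi k n (p 4) (p 1)) (degZZ k n (p 4) (p 1))
      (gPsiPsi k (n ^ 2) (2 * n) (p 4) (p 1)) (gPsiPhi k (n ^ 2) (2 * n) n (p 4) (p 1))
      (gPhiPhi k (n ^ 2) (2 * n) (p 4) (p 1))
      (conf k (n ^ 2) (2 * n) (p 4) (p 1) / G (n ^ 2) (2 * n) (p 4)) (p 1 - -1 / n)).det
      = -(16 * k ^ 8 * H (n ^ 2) (2 * n) (p 4) (p 1) ^ 2)
          / ((1 - n ^ 2) ^ 6 * (p 4 - p 1) ^ 8) := by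
    intro p hp
    obtain ⟨hG, hxy, h1, hH⟩ := hW p hp
    rw [det_degExtMat hs2 (degZPsi_mul hn hn1 hxy hH) (degZPhi_mul hn hn1 hxy hH)
      (degZZ_mul hn hn1 hxy hH h1), det_frame_degenerate hk hn hn1 hxy hH]
    have h1' := one_sub_sq_ne_zero h1
    have hx' := sub_ne_zero.mpr hxy
    unfold degRad conf
    field_simp
    ring
  -- The extended metric is the matrix field displayed in `hdet`; the sign s enters only the entries
  -- vz, zΨ and zΦ.
  refine ⟨_, ⟨isOpen_degDomain _, ?_, fun p _ => degExtMat_isSymm _ _ _ _ _ _ _ _ _ _ _ _,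
    fun p hp => ?_⟩, fun p q h1 h4 => ?_, hdet, ⟨?_, ?_, ?_, ?_⟩⟩
  · intro i j p hp
    obtain ⟨hG, hxy, h1, hH⟩ := hW p hp
    have hx := analyticAt_coord 4 p
    have hy := analyticAt_coord 1 p
    have hG' : AnalyticAt ℝ (fun p : Coords => G (n ^ 2) (2 * n) (p 4)) p :=
      analyticAt_G analyticAt_const analyticAt_const hx
    have a1 := analyticAt_degKK hν hx hy hxy hH
    have a2 := analyticAt_gKPsi (k := k) (s := -1 / n) h.m_pos.ne' hν hx hy hxy hH
    have a3 := analyticAt_gKPhi (k := k) (n := n) (s := -1 / n) h.lam_ne h.m_pos.ne' hν hx hy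
      hxy hH
    have a4 := analyticAt_gPsiPsi (k := k) h.e_ne hν hx hy hxy hH
    have a5 := analyticAt_gPsiPhi (k := k) (n := n) hν hx hy hxy hH
    have a6 := analyticAt_gPhiPhi (k := k) hν hx hy hxy hH
    have a7 := (analyticAt_conf (k := k) (lam := 2 * n) hν hx hy hxy).fun_div hG' hG
    exact analyticAt_degExtMat a1 a2 a3
      (analyticAt_const.fun_mul ((a1.fun_mul (analyticAt_degShift hy)).fun_sub a3))
      (analyticAt_const.fun_mul (analyticAt_degZPsi hν hx hy hxy hH))
      (analyticAt_const.fun_mul (analyticAt_degZPhi hν hx hy hxy hH))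
      (analyticAt_degZZ hν hx hy hxy hH h1) a4 a5 a6 a7 (hy.fun_sub analyticAt_const) i j
  · rw [hdet p hp]
    obtain ⟨-, hxy, -, hH⟩ := hW p hp
    have hx' := sub_ne_zero.mpr hxy
    exact div_ne_zero (neg_ne_zero.mpr (by positivity)) (by positivity)
  · simp only [h1, h4]
  · exact fun p hp => analyticAt_degChart (by rw [hy0]; exact (h.ne_roots hp.2.1).2.1)
  · exact (degChart_injective _ _ _ _ _ _).injOn
  · rintro p ⟨hG, hG', hxy, hH, -⟩
    simp only [degDomain, hsqrt]
    exact ⟨hG, hxy, (h.ne_roots hG').1, hH⟩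
  · rintro p ⟨hG, hG', hxy, hH, hH'⟩
    obtain ⟨h1, hr, -⟩ := h.ne_roots hG'
    have e1 : ∀ c₀ c₁ c₂ c₃, degChart k (n ^ 2) c₀ c₁ c₂ c₃ p 1 = p 1 := fun _ _ _ _ => rfl
    have e4 : ∀ c₀ c₁ c₂ c₃, degChart k (n ^ 2) c₀ c₁ c₂ c₃ p 4 = p 4 := fun _ _ _ _ => rfl
    rw [jac_degChart (by rw [hy0]; exact hr), e1, e4, hy0, h.metric_eq hxy hH hH',
      gKK_degenerate hn hn1 hxy hH, gRad_degenerate hn hr,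
      ← degMat_pullback hs2 (sub_ne_zero.mpr hr) (degShift_eq hn hn1)
        (degZPsi_mul hn hn1 hxy hH) (degZPhi_mul hn hn1 hxy hH) (degZZ_mul hn hn1 hxy hH h1),
      Matrix.transpose_mul]
    simp only [Matrix.mul_assoc]

theorem exists_subset_degDomain {n : ℝ} (hn : 0 < n) (hn1 : n < 1) :
    ∃ δ > 0, {p : Coords | |p 4| < 1 ∧ |p 1 - -1 / n| < δ} ⊆ degDomain (n ^ 2) := by
  have h := isHorizonData_degenerate one_ne_zero hn hn1
  have hr := neg_one_div_lt hn hn1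
  -- There is no second root to avoid; s = 0 is a dummy value different from y₀.
  obtain ⟨δ, hδ, hU⟩ := exists_uniform_neighbourhood (s := 0) hr (by linarith)
    fun x hx => h.H_root_ne (by nlinarith) hr hx.1
  refine ⟨δ, hδ, fun p hp => ?_⟩
  obtain ⟨h1, h2, -, h4⟩ := hU (p 4) (p 1) hp.1 hp.2
  simp only [degDomain, Real.sqrt_sq hn.le]
  exact ⟨h.G_ne_zero hr hr hp.1, h1, h2, h4⟩

end PomeranskySenkov

end

/-! ### The theorem: both cases assembled -/

open PomeranskySenkov in
theorem mainTheorem4 (k ν lam : ℝ) (hk : k ≠ 0) (hν : 0 < ν) :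
    -- two distinct, non-degenerate horizons
    (ν ≠ 1 → |lam| < 1 + ν → 4 * ν < lam ^ 2 → ∀ hor : Horizon,
      -- behaviour at `y = y⋆` of the metric coefficients in the coordinates `(u, v, ψ̂, φ̂, x)`
      (∀ σ : ℝ, σ ≠ 0 → ∀ t ψ φ x : ℝ, G ν lam x ≠ 0 → x ≠ hor.root ν lam →
        H ν lam x (hor.root ν lam) ≠ 0 →
        let gNew : ℝ → Mat5 := fun y =>
          newComponents (uvChart σ (aConst k ν lam) (hor.b k ν lam) (hor.root ν lam))
            (metric k ν lam) ![t, y, ψ, φ, x]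
        (∀ i ∈ ({0, 1} : Set (Fin 5)), ∀ j ∈ ({0, 1, 2, 3} : Set (Fin 5)),
          Tendsto (fun y => gNew y i j) (𝓝[≠] (hor.root ν lam)) (𝓝 0)) ∧
        ((fun y => gNew y 0 0) =O[𝓝[≠] (hor.root ν lam)] (fun y => (y - hor.root ν lam) ^ 2) ↔
          σ ^ 2 = hor.sigmaSq k ν lam)) ∧
      0 < hor.sigmaSq k ν lam ∧
      -- the analytic extension in the coordinates `(û, v̂, ψ̂, φ̂, x)`
      (∀ σ : ℝ, σ ^ 2 = hor.sigmaSq k ν lam →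
        ∃ gExt : Coords → Mat5,
          IsAnalyticMetricOn gExt (ksDomain ν lam hor) ∧
          (∀ p q, p 0 = q 0 → p 1 = q 1 → p 4 = q 4 → gExt p = gExt q) ∧
          (∀ p ∈ ksDomain ν lam hor, (gExt p).det =
            -(64 * k ^ 8 * σ ^ 2 * H ν lam (p 4) (ksY (hor.root ν lam) p) ^ 2)
              / ((1 - ν) ^ 6 * (p 4 - ksY (hor.root ν lam) p) ^ 8)) ∧
          (∀ ε : ℝ, ε = 1 ∨ ε = -1 →
            IsIsometricEmbeddingOn
              (ksChart ε σ (aConst k ν lam) (hor.b k ν lam) (hor.root ν lam))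
              (domain ν lam) (metric k ν lam) (ksDomain ν lam hor) gExt)) ∧
      -- for admissible parameters the extension covers a whole neighbourhood of `û v̂ = 0`
      (ν < 1 → 0 < lam → ∃ δ > 0,
        {p : Coords | |p 4| < 1 ∧ |p 0 * p 1| < δ} ⊆ ksDomain ν lam hor)) ∧
    -- the degenerate horizon
    (ν < 1 → lam = 2 * √ν →
      -- regularity at `z = y₀` in the coordinates `(v, z, Ψ, Φ, x)` fixes the constants
      (∀ a₀ a₁ bψ bφ t ψ φ x : ℝ, |x| < 1 →
        let gNew : ℝ → Mat5 := fun y =>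
          newComponents (degChart k ν a₀ a₁ bψ bφ) (metric k ν lam) ![t, y, ψ, φ, x]
        (fun y => gNew y 0 0) =O[𝓝[≠] (y0 ν)] (fun y => (y - y0 ν) ^ 2) ∧
        (fun y => gNew y 0 2) =O[𝓝[≠] (y0 ν)] (fun y => y - y0 ν) ∧
        (fun y => gNew y 0 3) =O[𝓝[≠] (y0 ν)] (fun y => y - y0 ν) ∧
        ((∀ j ∈ ({1, 2, 3} : Set (Fin 5)),
            (fun y => gNew y 1 j) =O[𝓝[≠] (y0 ν)] (fun _ => (1 : ℝ))) ↔
          IsDegConstants k ν 1 a₀ a₁ bψ bφ ∨ IsDegConstants k ν (-1) a₀ a₁ bψ bφ)) ∧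
      -- the analytic extensions, one for each choice of the constants
      (∀ s a₀ a₁ bψ bφ : ℝ, s = 1 ∨ s = -1 → IsDegConstants k ν s a₀ a₁ bψ bφ →
        ∃ gExt : Coords → Mat5,
          IsAnalyticMetricOn gExt (degDomain ν) ∧
          (∀ p q, p 1 = q 1 → p 4 = q 4 → gExt p = gExt q) ∧
          (∀ p ∈ degDomain ν, (gExt p).det =
            -(16 * k ^ 8 * H ν lam (p 4) (p 1) ^ 2) / ((1 - ν) ^ 6 * (p 4 - p 1) ^ 8)) ∧
          IsIsometricEmbeddingOn (degChart k ν a₀ a₁ bψ bφ)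
            (domain ν lam) (metric k ν lam) (degDomain ν) gExt) ∧
      -- the extension covers a whole neighbourhood of `z = y₀`
      (∃ δ > 0, {p : Coords | |p 4| < 1 ∧ |p 1 - y0 ν| < δ} ⊆ degDomain ν)) := by
  refine ⟨fun hν1 hl hd hor => ?_, fun hν1 hlam => ?_⟩
  · have h := hor.isHorizonData hk hν hν1 hl hd
    have hrs := hor.root_ne_otherRoot hν hd
    rw [hor.sigmaSq_eq_sigmaSqAt hν hν1 hl hd]
    exact ⟨fun σ hσ t ψ φ x _ hxr hH => h.uv_behaviour hrs hσ hxr hH, h.sigmaSqAt_pos hrs,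
      fun σ hσ => h.exists_extension hrs hσ,
      fun hν1' hl0 => h.exists_subset_extDomain hrs hν1' hl0 (abs_lt.mp hl).2⟩
  -- Writing ν = n² makes every constant of the degenerate case rational in k and n.
  · obtain ⟨n, hn, rfl⟩ : ∃ n, 0 < n ∧ ν = n ^ 2 :=
      ⟨√ν, Real.sqrt_pos.mpr hν, (Real.sq_sqrt hν.le).symm⟩
    have hsqrt : √(n ^ 2) = n := Real.sqrt_sq hn.le
    have hn1 : n < 1 := by nlinarith
    have hy0 : y0 (n ^ 2) = -1 / n := by unfold y0; rw [hsqrt]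
    rw [hsqrt] at hlam
    subst hlam
    rw [hy0]
    refine ⟨fun a₀ a₁ bψ bφ t ψ φ x hx => ?_,
      fun s a₀ a₁ bψ bφ hs hc => exists_degenerate_extension hk hn hn1 hs hc,
      exists_subset_degDomain hn hn1⟩
    obtain ⟨h1, h2, h3, h4⟩ := deg_behaviour hk hn hn1 a₀ a₁ bψ bφ t ψ φ hx
    refine ⟨h1, h2, h3, h4.trans ?_⟩
    simp only [or_and_right, exists_or, exists_eq_left]
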